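/- Let $B=(b_{ij})$ be an $n\times m$ integer matrix such that the action of the torus $T^m=(\mathbf C^\times)^m$ on $\mathbf A^n$ with weights $B$ is faithful and $B$ is unimodular (all nonzero $m\times m$ minors are $\pm1$). On $T^*\mathbf A^n$ with coordinate functions $x_i,y_i$ and bracket $\{x_i,y_j\}=\delta_{ij}$, $\{x_i,x_j\}=\{y_i,y_j\}=0$, let $c\in T^m$ act by $c\cdot x_i=\prod_j c_j^{b_{ij}}x_i$, $c\cdot y_i=\prod_j c_j^{-b_{ij}}y_i$, with moment map $\mu=\big(\sum_i b_{ij}x_iy_i\big)_{j}$. Let $X=\mu^{-1}(0)/\!/T^m$ be the affine hypertoric cone, with its reduced Poisson bracket and the $\mathbf C^\times$-action induced by dilation of $T^*\mathbf A^n$ (coordinate functions have degree one, so the bracket has degree $-2$), and let $\mathrm{pr}:\mu^{-1}(0)\to X$ be the projection. A symplectic leaf of $X$ is a maximal connected locally closed subvariety whose tangent space at each point is the space of values of Hamiltonian vector fields there; the vertex of $X$ is $\mathrm{pr}(0)$. Let $Z$ be a symplectic leaf of $X$ other than the vertex and $z\in Z$. Among the parabolic subgroups of $T^m$ (those of the form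 $\mathrm{Stab}(v)$, $v\in\mathbf A^n$) whose set $F\subseteq\{1,\dots,n\}$ of coordinates on which they act nontrivially satisfies $\bar Z=\mathrm{pr}(\mu^{-1}(0)\cap T^*\mathbf A^{F^c})$, there is a largest one, $\hat T$. With $F$ the set belonging to $\hat T$, let $S=T^*\mathbf A^F/\!/\!/\!/\hat T$ be the hypertoric cone of the slice, i.e. the Hamiltonian reduction at $0$ of $T^*\mathbf A^F$ by $\hat T$. Then there is a $\mathbf C^\times$-stable Zariski open neighborhood $X^\circ$ of $z$ in $X$, the nonvanishing locus of a homogeneous regular function, and an isomorphism of $\mathbf C^\times$-Poisson varieties $$X^\circ\cong Z^\circ\times S,\qquad Z^\circ=X^\circ\cap Z,$$ under which $X^\circ\cap Z$ corresponds to $Z^\circ\times\{\text{vertex of }S\}$. Here $\mathbf C^\times$ acts on $S$ so that, for some integers $w_i$ ($i\in F$), it is induced by giving $x_i$ degree $w_i$ and $y_i$ degree $2-w_i$ on $T^*\mathbf A^F$. Moreover $Z^\circ$ is $\mathbf C^\times$-Poisson isomorphic to the complement of at most $n$ linear hyperplanes in an affine space $\mathbf A^{2d}$, $2d=\dim Z$,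 with coordinates $p_1,\dots,p_d,q_1,\dots,q_d$ and standard bracket $\{p_i,q_j\}=\delta_{ij}$, $\{p_i,p_j\}=\{q_i,q_j\}=0$, where each coordinate function is homogeneous (of some integer degree, not necessarily one) and $\deg p_i+\deg q_i=2$, i.e. the symplectic form has weight two. -/

import Mathlib

open scoped TensorProduct

/-! ### Poisson brackets as biderivations -/

namespace Hypertoric

noncomputable section

/-- A `ℂ`-bilinear bracket `b f g = {f, g}` on a commutative algebra which is a derivation in each
of its arguments.  All the brackets below are the standard Poisson brackets. -/
abbrev Biderivation (A : Type) [CommRing A] [Algebra ℂ A] : Type :=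
  Derivation ℂ A (Derivation ℂ A A)

/-- The canonical Poisson bracket on the coordinate ring `ℂ[x_i, y_i]` of `T^*𝔸^ι`, where
`x_i = X (inl i)` and `y_i = X (inr i)`: it is determined by `{x_i, f} = ∂f/∂y_i` and
`{y_i, f} = -∂f/∂x_i`, so `{x_i, y_j} = δ_ij` and `{x_i, x_j} = {y_i, y_j} = 0`. -/
def polyBracket (ι : Type) : Biderivation (MvPolynomial (ι ⊕ ι) ℂ) :=
  MvPolynomial.mkDerivation ℂ
    (Sum.elim (fun i => MvPolynomial.pderiv (Sum.inr i)) (fun i => -MvPolynomial.pderiv (Sum.inl i)))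

section sub

variable {R : Type} [CommRing R] [Algebra ℂ R]

/-- The restriction of a derivation to a subalgebra which it preserves. -/
def subDer (V : Subalgebra ℂ R) (D : Derivation ℂ R R) (h : ∀ v ∈ V, D v ∈ V) :
    Derivation ℂ V V :=
  Derivation.mk'
    { toFun := fun v => ⟨D v, h v v.2⟩
      map_add' := fun a b => Subtype.ext (by simp)
      map_smul' := fun c a => Subtype.ext (by simp) }
    (fun a b => Subtype.ext (by simp))

/-- The restriction of a bracket to a subalgebra closed under it. -/
def subBracket (b : Biderivation R) (V : Subalgebra ℂ R) (h : ∀ u ∈ V, ∀ v ∈ V, b u v ∈ V) :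
    Biderivation V :=
  Derivation.mk'
    { toFun := fun u => subDer V (b u) (h u u.2)
      map_add' := fun u v => by ext w; simp [subDer]
      map_smul' := fun c u => by ext w; simp [subDer] }
    (fun u v => by ext w; simp [subDer])

theorem subBracket_apply (b : Biderivation R) (V : Subalgebra ℂ R)
    (h : ∀ u ∈ V, ∀ v ∈ V, b u v ∈ V) (u v : V) :
    ((subBracket b V h u v : V) : R) = b u v := rfl

/-- The bracket induced on the quotient by an ideal `J` with `{R, J} ⊆ J` and `{J, R} ⊆ J`:
`{f + J, g + J} = {f, g} + J`. -/
def quotBracket (b : Biderivation R) (J : Ideal R)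
    (h₁ : ∀ u, ∀ v ∈ J, b u v ∈ J) (h₂ : ∀ u ∈ J, ∀ v, b u v ∈ J) : Biderivation (R ⧸ J) :=
  let π : R →ₐ[ℂ] R ⧸ J := Ideal.Quotient.mkₐ ℂ J
  have hπ : Function.Surjective π := Ideal.Quotient.mkₐ_surjective ℂ J
  have hs : ∀ u v, π v = 0 → π (b u v) = 0 := fun u v hv =>
    Ideal.Quotient.eq_zero_iff_mem.2 (h₁ u v (Ideal.Quotient.eq_zero_iff_mem.1 hv))
  have key : ∀ u u' v, π u = π u' → π (b u v) = π (b u' v) := fun u u' v huv => by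
    have h := h₂ (u - u') (Ideal.Quotient.eq.1 huv) v
    rw [map_sub] at h
    exact Ideal.Quotient.eq.2 h
  let F : R ⧸ J → Derivation ℂ (R ⧸ J) (R ⧸ J) := fun a =>
    Derivation.liftOfSurjective (f := π) hπ (d := b (Function.surjInv hπ a)) (hs _)
  have hF : ∀ u v, F (π u) (π v) = π (b u v) := fun u v => by
    rw [Derivation.liftOfSurjective_apply]
    exact key _ _ _ (Function.surjInv_eq hπ (π u))
  Derivation.mk'
    { toFun := F
      map_add' := fun a a' => by
        obtain ⟨u, rfl⟩ := hπ a
        obtain ⟨u', rfl⟩ := hπ a'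
        ext c
        obtain ⟨v, rfl⟩ := hπ c
        rw [← map_add, hF, Derivation.add_apply, hF, hF, ← map_add, map_add b,
          Derivation.add_apply]
      map_smul' := fun r a => by
        obtain ⟨u, rfl⟩ := hπ a
        ext c
        obtain ⟨v, rfl⟩ := hπ c
        rw [← map_smul, hF, RingHom.id_apply, Derivation.smul_apply, hF, ← map_smul, Derivation.map_smul,
          Derivation.smul_apply] }
    (fun a a' => by
      obtain ⟨u, rfl⟩ := hπ a
      obtain ⟨u', rfl⟩ := hπ a'
      ext c
      obtain ⟨v, rfl⟩ := hπ c
      simp only [LinearMap.coe_mk, AddHom.coe_mk]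
      rw [← map_mul, hF, Derivation.add_apply, Derivation.smul_apply, Derivation.smul_apply, hF, hF,
        Derivation.leibniz, Derivation.add_apply, Derivation.smul_apply, Derivation.smul_apply,
        map_add, smul_eq_mul, smul_eq_mul, map_mul, map_mul, smul_eq_mul, smul_eq_mul])

theorem quotBracket_mk (b : Biderivation R) (J : Ideal R)
    (h₁ : ∀ u, ∀ v ∈ J, b u v ∈ J) (h₂ : ∀ u ∈ J, ∀ v, b u v ∈ J) (u v : R) :
    quotBracket b J h₁ h₂ (Ideal.Quotient.mkₐ ℂ J u) (Ideal.Quotient.mkₐ ℂ J v) =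
      Ideal.Quotient.mkₐ ℂ J (b u v) := by
  have hπ : Function.Surjective (Ideal.Quotient.mkₐ ℂ J) := Ideal.Quotient.mkₐ_surjective ℂ J
  refine (Derivation.liftOfSurjective_apply hπ (d := b (Function.surjInv hπ _)) (fun v hv =>
    Ideal.Quotient.eq_zero_iff_mem.2 (h₁ _ v (Ideal.Quotient.eq_zero_iff_mem.1 hv))) v).trans ?_
  have h := h₂ _ (Ideal.Quotient.eq.1
    (Function.surjInv_eq hπ ((Ideal.Quotient.mkₐ ℂ J) u))) v
  rw [map_sub] at h
  exact Ideal.Quotient.eq.2 h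

end sub

section away

variable {A : Type} [CommRing A] [Algebra ℂ A]

/-- The unique extension to the localization `A[1/f]` of a derivation from `A` to an
`A[1/f]`-module. -/
def extDer (f : A) {N : Type} [AddCommGroup N] [Module ℂ N] [Module A N]
    [Module (Localization.Away f) N] [IsScalarTower ℂ A N]
    [IsScalarTower A (Localization.Away f) N] [IsScalarTower ℂ (Localization.Away f) N]
    (D : Derivation ℂ A N) : Derivation ℂ (Localization.Away f) N :=
  ((D.liftKaehlerDifferential.liftBaseChange (Localization.Away f)) ∘ₗ
    (KaehlerDifferential.tensorKaehlerEquivOfFormallyEtale ℂ A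
      (Localization.Away f)).symm.toLinearMap).compDer
    (KaehlerDifferential.D ℂ (Localization.Away f))

theorem extDer_algebraMap (f : A) {N : Type} [AddCommGroup N] [Module ℂ N] [Module A N]
    [Module (Localization.Away f) N] [IsScalarTower ℂ A N]
    [IsScalarTower A (Localization.Away f) N] [IsScalarTower ℂ (Localization.Away f) N]
    (D : Derivation ℂ A N) (a : A) :
    extDer f D (algebraMap A (Localization.Away f) a) = D a := by
  simp [extDer, KaehlerDifferential.tensorKaehlerEquivOfFormallyEtale_symm_D_algebraMap]

theorem der_away_ext (f : A) {N : Type} [AddCommGroup N] [Module ℂ N]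
    [Module (Localization.Away f) N]
    {D E : Derivation ℂ (Localization.Away f) N}
    (h : ∀ a : A, D (algebraMap A (Localization.Away f) a) =
      E (algebraMap A (Localization.Away f) a)) : D = E := by
  ext x
  obtain ⟨⟨a, s⟩, hs⟩ := IsLocalization.surj (Submonoid.powers f) x
  have hu : IsUnit (algebraMap A (Localization.Away f) s) := IsLocalization.map_units _ s
  have h1 := congrArg D hs
  have h2 := congrArg E hs
  simp only [Derivation.leibniz, h] at h1 h2
  have h3 := h1.trans h2.symm
  rw [add_right_inj] at h3
  exact hu.smul_left_cancel.1 h3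

/-- The extension of derivations of `A` to derivations of `A[1/f]`, as an `A`-linear map. -/
def extDerₗ (f : A) :
    Derivation ℂ A A →ₗ[A] Derivation ℂ (Localization.Away f) (Localization.Away f) where
  toFun D := extDer f ((Algebra.linearMap A (Localization.Away f)).compDer D)
  map_add' D E := der_away_ext f fun a => by simp [extDer_algebraMap]
  map_smul' c D := der_away_ext f fun a => by simp [extDer_algebraMap, Algebra.smul_def]

/-- The bracket on `A[1/f]` extending a bracket on `A`, that is, the Poisson structure of the
principal open subset `{f ≠ 0}`. -/
def awayBracket (b : Biderivation A) (f : A) : Biderivation (Localization.Away f) :=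
  extDer f ((extDerₗ f).compDer b)

theorem awayBracket_algebraMap (b : Biderivation A) (f : A) (u v : A) :
    awayBracket b f (algebraMap A (Localization.Away f) u) (algebraMap A (Localization.Away f) v) =
      algebraMap A (Localization.Away f) (b u v) := by
  simp [awayBracket, extDer_algebraMap, extDerₗ]

end away

/-- The product Poisson bracket on `A ⊗ B`:
`{a ⊗ b, a' ⊗ b'} = {a, a'} ⊗ b b' + a a' ⊗ {b, b'}`. -/
def prodBracket {A B : Type} [CommRing A] [Algebra ℂ A] [CommRing B] [Algebra ℂ B]
    (bA : Biderivation A) (bB : Biderivation B) : A ⊗[ℂ] B →ₗ[ℂ] A ⊗[ℂ] B →ₗ[ℂ] A ⊗[ℂ] B :=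
  TensorProduct.map₂
      (LinearMap.mk₂ ℂ (fun u v => bA u v) (by simp) (by simp) (by simp) (by simp))
      (LinearMap.mul ℂ B) +
    TensorProduct.map₂ (LinearMap.mul ℂ A)
      (LinearMap.mk₂ ℂ (fun u v => bB u v) (by simp) (by simp) (by simp) (by simp))

theorem prodBracket_tmul {A B : Type} [CommRing A] [Algebra ℂ A] [CommRing B] [Algebra ℂ B]
    (bA : Biderivation A) (bB : Biderivation B) (a a' : A) (b b' : B) :
    prodBracket bA bB (a ⊗ₜ b) (a' ⊗ₜ b') = bA a a' ⊗ₜ (b * b') + (a * a') ⊗ₜ bB b b' := rfl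

/-! ### Actions of `ℂˣ` on localizations -/

/-- `f` is homogeneous for the action `ρ` of `ℂˣ` on functions: for some integer `e` (the degree),
`t · f = t ^ e f` for all `t`. -/
def IsWeightVector {A : Type} [CommRing A] [Algebra ℂ A] (ρ : ℂˣ → A →ₐ[ℂ] A) (f : A) : Prop :=
  ∃ e : ℤ, ∀ t : ℂˣ, ρ t f = ((t ^ e : ℂˣ) : ℂ) • f

theorem IsWeightVector.isUnit {A : Type} [CommRing A] [Algebra ℂ A] {ρ : ℂˣ → A →ₐ[ℂ] A} {f : A}
    (hf : IsWeightVector ρ f) (t : ℂˣ) :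
    IsUnit ((Algebra.algHom ℂ A (Localization.Away f)).comp (ρ t) f) := by
  obtain ⟨e, he⟩ := hf
  rw [AlgHom.comp_apply, he, map_smul]
  have h : IsUnit (algebraMap A (Localization.Away f) f) :=
    IsLocalization.Away.algebraMap_isUnit f
  exact h.smul (t ^ e : ℂˣ)

/-- The action of `ℂˣ` on `A[1/f]` extending an action `ρ` on `A`, for homogeneous `f`. -/
def awayAct {A : Type} [CommRing A] [Algebra ℂ A] (ρ : ℂˣ → A →ₐ[ℂ] A) (f : A)
    (hf : IsWeightVector ρ f) (t : ℂˣ) : Localization.Away f →ₐ[ℂ] Localization.Away f :=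
  IsLocalization.Away.liftAlgHom f (f := (Algebra.algHom ℂ A (Localization.Away f)).comp (ρ t))
    (hf.isUnit t)

/-! ### Closed points and symplectic leaves -/

/-- The closed points of the affine variety `Spec A`. -/
def Pts (A : Type) [CommRing A] [Algebra ℂ A] : Type := A →ₐ[ℂ] ℂ

/-- The point of `Spec A` that an algebra homomorphism to `ℂ` represents as a prime ideal. -/
def Pts.toSpec {A : Type} [CommRing A] [Algebra ℂ A] (z : Pts A) : PrimeSpectrum A :=
  ⟨RingHom.ker (show A →ₐ[ℂ] ℂ from z), RingHom.ker_isPrime _⟩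

/-- The value at a point of a regular function. -/
def Pts.val {A : Type} [CommRing A] [Algebra ℂ A] (z : Pts A) : A →ₐ[ℂ] ℂ := z

/-- The point of `Spec A` underlying a point of the principal open subset `{f ≠ 0}`. -/
def Pts.ofAway {A : Type} [CommRing A] [Algebra ℂ A] {f : A} (p : Pts (Localization.Away f)) :
    Pts A :=
  p.val.comp (Algebra.algHom ℂ A (Localization.Away f))

/-- The Zariski topology on closed points. -/
instance (A : Type) [CommRing A] [Algebra ℂ A] : TopologicalSpace (Pts A) :=
  TopologicalSpace.induced Pts.toSpec inferInstance

/-- The Zariski tangent space at `z` of the reduced subvariety carried by a locally closed set `Z`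
of closed points of `Spec A`: the derivations `A → ℂ` at `z` that kill every function vanishing
on `Z`. -/
def tangentSpace {A : Type} [CommRing A] [Algebra ℂ A] (Z : Set (Pts A)) (z : Pts A) :
    Submodule ℂ (A →ₗ[ℂ] ℂ) where
  carrier := {v | (∀ f g, v (f * g) = z.val f * v g + z.val g * v f) ∧
    ∀ f, (∀ z' ∈ Z, z'.val f = 0) → v f = 0}
  add_mem' := fun {v w} hv hw =>
    ⟨fun f g => by simp only [LinearMap.add_apply, hv.1, hw.1]; ring,
      fun f hf => by simp [hv.2 f hf, hw.2 f hf]⟩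
  zero_mem' := ⟨by simp, by simp⟩
  smul_mem' := fun c v hv =>
    ⟨fun f g => by simp only [LinearMap.smul_apply, hv.1, smul_eq_mul]; ring,
      fun f hf => by simp [hv.2 f hf]⟩

/-- The values at `z` of the Hamiltonian vector fields `{f, -}`. -/
def hamiltonianSpace {A : Type} [CommRing A] [Algebra ℂ A] (b : Biderivation A) (z : Pts A) :
    Submodule ℂ (A →ₗ[ℂ] ℂ) where
  carrier := {v | ∃ f, ∀ g, v g = z.val (b f g)}
  add_mem' := by
    rintro v w ⟨f, hf⟩ ⟨f', hf'⟩
    exact ⟨f + f', fun g => by simp [hf, hf']⟩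
  zero_mem' := ⟨0, by simp⟩
  smul_mem' := by
    rintro c v ⟨f, hf⟩
    exact ⟨c • f, fun g => by simp [hf]⟩

/-- A connected locally closed subvariety `Z` whose tangent space at each of its points is the
space of values of Hamiltonian vector fields. -/
structure IsSymplecticPiece {A : Type} [CommRing A] [Algebra ℂ A] (b : Biderivation A)
    (Z : Set (Pts A)) : Prop where
  isConnected : IsConnected Z
  isLocallyClosed : IsLocallyClosed Z
  tangent_eq : ∀ z ∈ Z, tangentSpace Z z = hamiltonianSpace b z

/-- A symplectic leaf: a maximal subvariety of the preceding kind. -/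
def IsSymplecticLeaf {A : Type} [CommRing A] [Algebra ℂ A] (b : Biderivation A)
    (Z : Set (Pts A)) : Prop :=
  Maximal (IsSymplecticPiece b) Z

/-! ### Diagonal actions on `T^*𝔸^ι` -/

/-- The diagonal automorphism of a polynomial ring multiplying the variable `X i` by `u i`. -/
def scale {σ : Type} (u : σ → ℂˣ) : MvPolynomial σ ℂ →ₐ[ℂ] MvPolynomial σ ℂ :=
  MvPolynomial.aeval fun i => (u i : ℂ) • MvPolynomial.X i

theorem scale_monomial {σ : Type} (u : σ → ℂˣ) (s : σ →₀ ℕ) (a : ℂ) :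
    scale u (MvPolynomial.monomial s a) =
      MvPolynomial.monomial s (((s.prod fun i k => u i ^ k : ℂˣ) : ℂ) * a) := by
  have h : ∀ i k, ((u i : ℂ) • (MvPolynomial.X i : MvPolynomial σ ℂ)) ^ k =
      MvPolynomial.C ((u i : ℂ) ^ k) * MvPolynomial.X i ^ k := fun i k => by
    rw [smul_pow, MvPolynomial.smul_eq_C_mul]
  rw [scale, MvPolynomial.aeval_monomial, MvPolynomial.algebraMap_eq, MvPolynomial.monomial_eq]
  simp only [h, Finsupp.prod_mul]
  simp only [Finsupp.prod, Units.coe_prod, Units.val_pow_eq_pow_val, map_mul, map_prod]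
  ring

theorem coeff_scale {σ : Type} (u : σ → ℂˣ) (p : MvPolynomial σ ℂ) (s : σ →₀ ℕ) :
    (scale u p).coeff s = ((s.prod fun i k => u i ^ k : ℂˣ) : ℂ) * p.coeff s := by
  classical
  induction p using MvPolynomial.induction_on' with
  | monomial t a =>
    rw [scale_monomial, MvPolynomial.coeff_monomial, MvPolynomial.coeff_monomial]
    split_ifs with h
    · rw [h]
    · simp
  | add p q hp hq => rw [map_add, MvPolynomial.coeff_add, MvPolynomial.coeff_add, hp, hq, mul_add]

theorem scale_comm {σ : Type} (u v : σ → ℂˣ) (p : MvPolynomial σ ℂ) :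
    scale u (scale v p) = scale v (scale u p) := by
  ext s
  rw [coeff_scale, coeff_scale, coeff_scale, coeff_scale, mul_left_comm]

/-- The character `c ↦ ∏ j, c_j ^ χ_j` of the torus `(ℂˣ)^m`. -/
def character {m : ℕ} (χ : Fin m → ℤ) : (Fin m → ℂˣ) →* ℂˣ where
  toFun c := ∏ j, c j ^ χ j
  map_one' := by simp
  map_mul' c d := by simp [mul_zpow, Finset.prod_mul_distrib]

section reduction

variable {ι : Type} {m : ℕ}

/-- The action of the torus `(ℂˣ)^m` with weights `B` on the coordinate ring of `T^*𝔸^ι`: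
`c · x_i = ∏ j, c_j ^ B_ij x_i` and `c · y_i = ∏ j, c_j ^ (-B_ij) y_i`. -/
def torusAct (B : Matrix ι (Fin m) ℤ) (c : Fin m → ℂˣ) :
    MvPolynomial (ι ⊕ ι) ℂ →ₐ[ℂ] MvPolynomial (ι ⊕ ι) ℂ :=
  scale (Sum.elim (fun i => character (B i) c) (fun i => (character (B i) c)⁻¹))

/-- The action of `ℂˣ` on the coordinate ring of `T^*𝔸^ι` for which `x_i` has degree `w i` and
`y_i` has degree `2 - w i`; the canonical bracket has degree `-2`.  For `w = 1` it is the dilation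
action of the vector space `T^*𝔸^ι`. -/
def weightAct (w : ι → ℤ) (t : ℂˣ) : MvPolynomial (ι ⊕ ι) ℂ →ₐ[ℂ] MvPolynomial (ι ⊕ ι) ℂ :=
  scale (Sum.elim (fun i => t ^ w i) (fun i => t ^ (2 - w i)))

/-- The polynomials invariant under a subgroup `H` of the torus. -/
def invariants (B : Matrix ι (Fin m) ℤ) (H : Subgroup (Fin m → ℂˣ)) :
    Subalgebra ℂ (MvPolynomial (ι ⊕ ι) ℂ) where
  carrier := {p | ∀ c ∈ H, torusAct B c p = p}
  mul_mem' hp hq c hc := by rw [map_mul, hp c hc, hq c hc]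
  add_mem' hp hq c hc := by rw [map_add, hp c hc, hq c hc]
  algebraMap_mem' r c _ := AlgHom.commutes _ r

/-- The Lie algebra, inside `ℂ^m`, of a closed subgroup `H` of the torus: the common kernel of the
differentials of the characters of the torus that are trivial on `H`. -/
def lieAlg (H : Subgroup (Fin m → ℂˣ)) : Submodule ℂ (Fin m → ℂ) where
  carrier := {ξ | ∀ χ : Fin m → ℤ, (∀ c ∈ H, character χ c = 1) → ∑ j, (χ j : ℂ) * ξ j = 0}
  add_mem' hξ hη χ h := by simp [mul_add, Finset.sum_add_distrib, hξ χ h, hη χ h]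
  zero_mem' := by simp
  smul_mem' r ξ hξ χ h := by
    simp only [Pi.smul_apply, smul_eq_mul, mul_left_comm, ← Finset.mul_sum, hξ χ h, mul_zero]

theorem polyBracket_skew (p q : MvPolynomial (ι ⊕ ι) ℂ) :
    polyBracket ι p q = -polyBracket ι q p := by
  classical
  have h1 : ∀ i, polyBracket ι (MvPolynomial.X i) q = -polyBracket ι q (MvPolynomial.X i) := by
    intro i
    let D : Derivation ℂ (MvPolynomial (ι ⊕ ι) ℂ) (MvPolynomial (ι ⊕ ι) ℂ) :=
      Derivation.mk' (LinearMap.mk (AddHom.mk (fun q => -polyBracket ι q (MvPolynomial.X i))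
        (by intros; simp [add_comm])) (by intros; simp))
        (by intros; simp [add_comm])
    have : polyBracket ι (MvPolynomial.X i) = D := by
      apply MvPolynomial.derivation_ext
      intro j
      change _ = -polyBracket ι (MvPolynomial.X j) (MvPolynomial.X i)
      rcases i with i | i <;> rcases j with j | j <;>
        simp [polyBracket, MvPolynomial.mkDerivation_X, MvPolynomial.pderiv_X,
          Pi.single_apply, eq_comm]
    exact congrArg (fun E => E q) this
  let D : Derivation ℂ (MvPolynomial (ι ⊕ ι) ℂ) (MvPolynomial (ι ⊕ ι) ℂ) :=
    Derivation.mk' (LinearMap.mk (AddHom.mk (fun p => polyBracket ι p q)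
      (by intros; simp)) (by intros; simp))
      (by intros; simp)
  have : D = -polyBracket ι q := by
    apply MvPolynomial.derivation_ext
    intro j
    exact h1 j
  exact congrArg (fun E => E p) this

theorem polyBracket_torusAct (B : Matrix ι (Fin m) ℤ) (c : Fin m → ℂˣ)
    (p q : MvPolynomial (ι ⊕ ι) ℂ) :
    polyBracket ι (torusAct B c p) (torusAct B c q) = torusAct B c (polyBracket ι p q) := by
  classical
  have hX : ∀ i, torusAct B c (MvPolynomial.X i) =
      ((Sum.elim (fun i => character (B i) c) (fun i => (character (B i) c)⁻¹) i : ℂˣ) : ℂ) •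
        MvPolynomial.X i := fun i => by simp [torusAct, scale]
  have hC : ∀ a, torusAct B c (MvPolynomial.C a) = MvPolynomial.C a := fun a =>
    (torusAct B c).commutes a
  have hbC : ∀ a, polyBracket ι (MvPolynomial.C a) = 0 := fun a =>
    (polyBracket ι).map_algebraMap a
  induction p using MvPolynomial.induction_on with
  | C a => simp [hC, hbC]
  | add p p' hp hp' => simp [hp, hp']
  | mul_X p i hp =>
    have h1 : polyBracket ι (torusAct B c (MvPolynomial.X i)) (torusAct B c q) =
        torusAct B c (polyBracket ι (MvPolynomial.X i) q) := by
      clear hp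
      induction q using MvPolynomial.induction_on with
      | C a => rw [hC, polyBracket_skew, hbC, polyBracket_skew _ (MvPolynomial.C a), hbC]; simp
      | add p p' hp hp' => simp [hp, hp']
      | mul_X q j hq =>
        have h2 : polyBracket ι (torusAct B c (MvPolynomial.X i))
            (torusAct B c (MvPolynomial.X j)) =
            torusAct B c (polyBracket ι (MvPolynomial.X i) (MvPolynomial.X j)) := by
          rw [hX, hX]
          rcases i with i | i <;> rcases j with j | j <;>
            simp [polyBracket, MvPolynomial.mkDerivation_X, MvPolynomial.pderiv_X,
              Pi.single_apply]
          · split_ifs with h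
            · subst h; simp [MvPolynomial.smul_eq_C_mul, ← map_mul]
            · simp
          · split_ifs with h
            · subst h; simp [MvPolynomial.smul_eq_C_mul, ← map_mul]
            · simp
        rw [map_mul, Derivation.leibniz, Derivation.leibniz, hq, h2]
        simp
    rw [map_mul, Derivation.leibniz, Derivation.leibniz, Derivation.add_apply,
      Derivation.add_apply, Derivation.smul_apply, Derivation.smul_apply, Derivation.smul_apply,
      Derivation.smul_apply, hp, h1]
    simp

theorem bracket_mem_invariants (B : Matrix ι (Fin m) ℤ) (H : Subgroup (Fin m → ℂˣ)) :
    ∀ p ∈ invariants B H, ∀ q ∈ invariants B H, polyBracket ι p q ∈ invariants B H := by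
  intro p hp q hq c hc
  rw [← polyBracket_torusAct, hp c hc, hq c hc]

variable [Fintype ι]

/-- The component along `ξ` of the moment map: `∑ i, (∑ j, B_ij ξ_j) x_i y_i`. -/
def moment (B : Matrix ι (Fin m) ℤ) (ξ : Fin m → ℂ) : MvPolynomial (ι ⊕ ι) ℂ :=
  ∑ i, (∑ j, (B i j : ℂ) * ξ j) • (MvPolynomial.X (Sum.inl i) * MvPolynomial.X (Sum.inr i))

/-- The ideal of the zero fibre of the moment map of `H`. -/
def momentIdeal (B : Matrix ι (Fin m) ℤ) (H : Subgroup (Fin m → ℂˣ)) :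
    Ideal (MvPolynomial (ι ⊕ ι) ℂ) :=
  Ideal.span {p | ∃ ξ ∈ lieAlg H, p = moment B ξ}

/-- The invariant polynomials in the ideal of the zero fibre of the moment map. -/
def redIdeal (B : Matrix ι (Fin m) ℤ) (H : Subgroup (Fin m → ℂˣ)) : Ideal (invariants B H) :=
  (momentIdeal B H).comap (invariants B H).val

/-- Invariant polynomials Poisson-commute with the moment map. -/
theorem polyBracket_moment (B : Matrix ι (Fin m) ℤ) (H : Subgroup (Fin m → ℂˣ)) {ξ : Fin m → ℂ}
    (hξ : ξ ∈ lieAlg H) {p : MvPolynomial (ι ⊕ ι) ℂ} (hp : p ∈ invariants B H) :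
    polyBracket ι p (moment B ξ) = 0 := by
  classical
  rw [polyBracket_skew, neg_eq_zero]
  set β : ι → ℂ := fun i => ∑ j, (B i j : ℂ) * ξ j with hβ
  set γ : ι ⊕ ι → ℂ := Sum.elim (fun i => -β i) β with hγ
  -- the Hamiltonian vector field of the moment map acts diagonally
  have hE : polyBracket ι (moment B ξ) =
      MvPolynomial.mkDerivation ℂ fun i => MvPolynomial.C (γ i) * MvPolynomial.X i := by
    apply MvPolynomial.derivation_ext
    intro i
    rw [MvPolynomial.mkDerivation_X, polyBracket_skew]
    rcases i with i | i <;>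
      simp [polyBracket, MvPolynomial.mkDerivation_X, moment, MvPolynomial.pderiv_X,
        Pi.single_apply, hγ, hβ, MvPolynomial.smul_eq_C_mul]
  have hmon : ∀ (s : ι ⊕ ι →₀ ℕ) (a : ℂ), polyBracket ι (moment B ξ) (MvPolynomial.monomial s a) =
      MvPolynomial.monomial s ((∑ i, (s i : ℂ) * γ i) * a) := fun s a => by
    rw [hE, MvPolynomial.mkDerivation_monomial, Finsupp.sum_fintype _ _ (by simp),
      Finset.smul_sum, Finset.sum_mul, map_sum]
    refine Finset.sum_congr rfl fun i _ => ?_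
    by_cases hi : s i = 0
    · simp [hi]
    · have hle : Finsupp.single i 1 ≤ s := by
        simpa [Finsupp.single_le_iff] using Nat.one_le_iff_ne_zero.2 hi
      rw [MvPolynomial.C_mul_X_eq_monomial, smul_eq_mul, MvPolynomial.monomial_mul,
        tsub_add_cancel_of_le hle, MvPolynomial.smul_monomial, smul_eq_mul, mul_comm a]
  rw [p.as_sum, map_sum]
  refine Finset.sum_eq_zero fun s hs => ?_
  rw [hmon]
  have h0 : ∑ i, (s i : ℂ) * γ i = 0 := by
    have := hξ (fun j => ∑ i, ((s (Sum.inr i) : ℤ) - s (Sum.inl i)) * B i j) (fun c hc => ?_)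
    · rw [← this, Fintype.sum_sum_type]
      simp only [hγ, hβ, Sum.elim_inl, Sum.elim_inr, ← Finset.sum_add_distrib]
      push_cast
      simp only [Finset.sum_mul]
      rw [Finset.sum_comm]
      refine Finset.sum_congr rfl fun i _ => ?_
      rw [← sub_eq_zero]
      simp only [Finset.mul_sum, mul_neg, mul_assoc, sub_mul, Finset.sum_sub_distrib]
      ring
    · have h1 := congrArg (MvPolynomial.coeff s) (hp c hc)
      rw [torusAct, coeff_scale] at h1
      have h2 := mul_right_cancel₀ (MvPolynomial.mem_support_iff.1 hs) (h1.trans (one_mul _).symm)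
      rw [Units.val_eq_one, Finsupp.prod_fintype _ _ (by simp), Fintype.prod_sum_type,
        ← Finset.prod_mul_distrib] at h2
      have h3 : character (fun j => ∑ i, ((s (Sum.inr i) : ℤ) - s (Sum.inl i)) * B i j) c =
          ∏ i, character (B i) c ^ ((s (Sum.inr i) : ℤ) - s (Sum.inl i)) := by
        simp only [character, MonoidHom.coe_mk, OneHom.coe_mk, ← Finset.prod_zpow, ← zpow_mul]
        rw [Finset.prod_comm]
        refine Finset.prod_congr rfl fun j _ => ?_
        have hz : ∀ (x : ℂˣ) (f : ι → ℤ) (S : Finset ι), x ^ (∑ i ∈ S, f i) = ∏ i ∈ S, x ^ f i := by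
          classical
          intro x f S
          induction S using Finset.induction_on with
          | empty => simp
          | insert a S ha ih => rw [Finset.sum_insert ha, Finset.prod_insert ha, zpow_add, ih]
        rw [hz]
        exact Finset.prod_congr rfl fun i _ => by rw [mul_comm]
      rw [h3, ← inv_inj, inv_one, ← h2, ← Finset.prod_inv_distrib]
      refine Finset.prod_congr rfl fun i _ => ?_
      rw [Sum.elim_inl, Sum.elim_inr, ← zpow_natCast, ← zpow_natCast, inv_zpow', ← zpow_add,
        ← zpow_neg]
      congr 1
      ring
  rw [h0, zero_mul, map_zero]

theorem bracket_mem_redIdeal (B : Matrix ι (Fin m) ℤ) (H : Subgroup (Fin m → ℂˣ))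
    (p : invariants B H) : ∀ q ∈ redIdeal B H,
    subBracket (polyBracket ι) _ (bracket_mem_invariants B H) p q ∈ redIdeal B H := by
  rintro ⟨q, hqV⟩ hq
  change q ∈ momentIdeal B H at hq
  change polyBracket ι p q ∈ momentIdeal B H
  clear hqV
  induction hq using Submodule.span_induction with
  | mem q h =>
    obtain ⟨ξ, hξ, rfl⟩ := h
    rw [polyBracket_moment B H hξ p.2]
    exact Ideal.zero_mem _
  | zero => rw [map_zero]; exact Ideal.zero_mem _
  | add q q' _ _ h h' => rw [map_add]; exact Ideal.add_mem _ h h'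
  | smul r q hq h =>
    rw [smul_eq_mul, Derivation.leibniz]
    exact Ideal.add_mem _ (Ideal.mul_mem_left _ _ h) (Ideal.mul_mem_right _ _ hq)

theorem bracket_mem_redIdeal' (B : Matrix ι (Fin m) ℤ) (H : Subgroup (Fin m → ℂˣ)) :
    ∀ p ∈ redIdeal B H, ∀ q,
    subBracket (polyBracket ι) _ (bracket_mem_invariants B H) p q ∈ redIdeal B H := by
  intro p hp q
  have h := (redIdeal B H).neg_mem (bracket_mem_redIdeal B H q p hp)
  convert h using 1
  exact Subtype.ext (polyBracket_skew _ _)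

/-- The coordinate ring of the Hamiltonian reduction `T^*𝔸^ι //// H = μ⁻¹(0) // H`: the invariant
polynomials modulo those in the ideal of the zero fibre of the moment map.  As `H` is
diagonalizable, this is the ring of invariants of the coordinate ring of that fibre. -/
abbrev Red (B : Matrix ι (Fin m) ℤ) (H : Subgroup (Fin m → ℂˣ)) : Type :=
  invariants B H ⧸ redIdeal B H

/-- The Poisson bracket of the Hamiltonian reduction. -/
def redBracket (B : Matrix ι (Fin m) ℤ) (H : Subgroup (Fin m → ℂˣ)) : Biderivation (Red B H) :=
  quotBracket (subBracket (polyBracket ι) (invariants B H) (bracket_mem_invariants B H))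
    (redIdeal B H) (bracket_mem_redIdeal B H) (bracket_mem_redIdeal' B H)

theorem weightAct_moment (B : Matrix ι (Fin m) ℤ) (w : ι → ℤ) (t : ℂˣ) (ξ : Fin m → ℂ) :
    weightAct w t (moment B ξ) = ((t : ℂ) ^ 2) • moment B ξ := by
  have h : ∀ i, ((t : ℂ) ^ w i) * (t : ℂ) ^ (2 - w i) = (t : ℂ) ^ 2 := fun i => by
    rw [← zpow_add₀ t.ne_zero, add_sub_cancel]
    norm_cast
  simp only [weightAct, moment, map_sum, map_smul, map_mul, scale, MvPolynomial.aeval_X,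
    Finset.smul_sum, Sum.elim_inl, Sum.elim_inr, Units.val_zpow_eq_zpow_val, smul_mul_smul_comm, h]
  exact Finset.sum_congr rfl fun i _ => smul_comm _ _ _

/-- The action of `ℂˣ` on the reduction induced by `weightAct w`. -/
def redAct (B : Matrix ι (Fin m) ℤ) (H : Subgroup (Fin m → ℂˣ)) (w : ι → ℤ) (t : ℂˣ) :
    Red B H →ₐ[ℂ] Red B H :=
  Ideal.quotientMapₐ (redIdeal B H)
    (((weightAct w t).comp (invariants B H).val).codRestrict (invariants B H) fun p c hc => by
      change torusAct B c (weightAct w t p) = weightAct w t p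
      rw [torusAct, weightAct, scale_comm]
      exact congrArg _ (p.2 c hc))
    (by
      rintro ⟨q, hqV⟩ hq
      change q ∈ momentIdeal B H at hq
      change weightAct w t q ∈ momentIdeal B H
      clear hqV
      induction hq using Submodule.span_induction with
      | mem q h =>
        obtain ⟨ξ, hξ, rfl⟩ := h
        rw [weightAct_moment, MvPolynomial.smul_eq_C_mul]
        exact Ideal.mul_mem_left _ _ (Ideal.subset_span ⟨ξ, hξ, rfl⟩)
      | zero => rw [map_zero]; exact Ideal.zero_mem _
      | add q q' _ _ h h' => rw [map_add]; exact Ideal.add_mem _ h h'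
      | smul r q _ h => rw [smul_eq_mul, map_mul]; exact Ideal.mul_mem_left _ _ h)

/-- The zero fibre of the moment map of `H`, as a set of points of `T^*𝔸^ι`. -/
def zeroFibre (B : Matrix ι (Fin m) ℤ) (H : Subgroup (Fin m → ℂˣ)) : Set (ι ⊕ ι → ℂ) :=
  {v | ∀ ξ ∈ lieAlg H, MvPolynomial.eval v (moment B ξ) = 0}

/-- The projection from the zero fibre of the moment map to the reduction. -/
def pr (B : Matrix ι (Fin m) ℤ) (H : Subgroup (Fin m → ℂˣ)) (v : zeroFibre B H) :
    Pts (Red B H) :=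
  Ideal.Quotient.liftₐ (redIdeal B H)
    ((MvPolynomial.aeval (v : ι ⊕ ι → ℂ)).comp (invariants B H).val) (by
      rintro ⟨q, hqV⟩ hq
      change q ∈ momentIdeal B H at hq
      change MvPolynomial.aeval (v : ι ⊕ ι → ℂ) q = 0
      clear hqV
      induction hq using Submodule.span_induction with
      | mem q h =>
        obtain ⟨ξ, hξ, rfl⟩ := h
        exact v.2 ξ hξ
      | zero => rw [map_zero]
      | add q q' _ _ h h' => rw [map_add, h, h', add_zero]
      | smul r q _ h => rw [smul_eq_mul, map_mul, h, mul_zero])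

/-- The vertex of the reduction: the image of the origin of `T^*𝔸^ι`. -/
def vertex (B : Matrix ι (Fin m) ℤ) (H : Subgroup (Fin m → ℂˣ)) : Pts (Red B H) :=
  pr B H ⟨0, fun ξ _ => by simp [moment]⟩

end reduction

/-! ### Hypertoric cones -/

section cone

variable {n m : ℕ}

/-- The action of `(ℂˣ)^m` on `𝔸^n` with weights `B` is faithful. -/
def IsFaithful (B : Matrix (Fin n) (Fin m) ℤ) : Prop :=
  ∀ c : Fin m → ℂˣ, (∀ i, character (B i) c = 1) → c = 1

/-- All nonzero `m × m` minors of the weight matrix are `±1`. -/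
def IsUnimodular (B : Matrix (Fin n) (Fin m) ℤ) : Prop :=
  ∀ r : Fin m → Fin n, (B.submatrix r id).det = 0 ∨ (B.submatrix r id).det = 1 ∨
    (B.submatrix r id).det = -1

/-- The coordinate ring of the hypertoric cone `X = T^*𝔸^n //// (ℂˣ)^m`. -/
abbrev Cone (B : Matrix (Fin n) (Fin m) ℤ) : Type := Red B ⊤

/-- A subgroup of the torus is parabolic if it is the stabilizer of some `v ∈ 𝔸^n`. -/
def IsParabolic (B : Matrix (Fin n) (Fin m) ℤ) (H : Subgroup (Fin m → ℂˣ)) : Prop :=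
  ∃ v : Fin n → ℂ, ∀ c, c ∈ H ↔ ∀ i, (character (B i) c : ℂ) * v i = v i

open scoped Classical in
/-- The set `F` of the coordinates of `𝔸^n` on which `H` acts nontrivially. -/
def movedCoords (B : Matrix (Fin n) (Fin m) ℤ) (H : Subgroup (Fin m → ℂˣ)) : Finset (Fin n) :=
  {i | ∃ c ∈ H, character (B i) c ≠ 1}

/-- The image in `X` of the points of `μ⁻¹(0)` that lie in `T^*𝔸^{Fᶜ}`, for `F` the set of
coordinates on which `H` acts nontrivially. -/
def stratumClosure (B : Matrix (Fin n) (Fin m) ℤ) (H : Subgroup (Fin m → ℂˣ)) :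
    Set (Pts (Cone B)) :=
  {z | ∃ v : zeroFibre B ⊤, (∀ i ∈ movedCoords B H, v.1 (Sum.inl i) = 0 ∧ v.1 (Sum.inr i) = 0) ∧
    pr B ⊤ v = z}

/-- `H` is the maximal parabolic subgroup attached to `Z`, that is, the largest among the parabolic
subgroups `H` for which the closure of `Z` is the image of `μ⁻¹(0) ∩ T^*𝔸^{Fᶜ}`. -/
def IsMaximalParabolicOf (B : Matrix (Fin n) (Fin m) ℤ) (Z : Set (Pts (Cone B)))
    (H : Subgroup (Fin m → ℂˣ)) : Prop :=
  IsGreatest {H | IsParabolic B H ∧ closure Z = stratumClosure B H} H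

/-- The weights of the torus on `𝔸^F`, for `F` the set of coordinates on which `H` acts
nontrivially. -/
abbrev sliceWeights (B : Matrix (Fin n) (Fin m) ℤ) (H : Subgroup (Fin m → ℂˣ)) :
    Matrix (movedCoords B H) (Fin m) ℤ :=
  B.submatrix Subtype.val id

/-- The coordinate ring of the hypertoric cone `S = T^*𝔸^F //// H` of the slice. -/
abbrev SliceCone (B : Matrix (Fin n) (Fin m) ℤ) (H : Subgroup (Fin m → ℂˣ)) : Type :=
  Red (sliceWeights B H) H

end cone

end

end Hypertoric

/-! The product decomposition comes from gauge fixing. Call a coordinate active at `z` if it occurs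
in an invariant monomial that does not vanish at `z`; the rational span of the weights of the active
coordinates determines a set of indices `flat z`. By faithfulness and unimodularity the character
lattice has a basis of rows of `B`, indexed by `I ∪ J`, such that `I` consists of active indices and
spans this flat (`exists_weightBasis`). The moment map forbids coloops among the active indices
(`WeightBasis.exists_active_ne`). Hence there is an invariant monomial `f`, nonzero at `z`, that
contains exactly one of `x_i`, `y_i` for every `i ∈ I`, the pivot of index `i` (`exists_chartData`).

Where `f ≠ 0`, the torus can be used to make all pivots equal to `1`. This leaves the subgroup `H`
on which the characters indexed by `I` are trivial, and the component of the moment map dual to `i ∈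
I` expresses the partner of the pivot through the other coordinates. There remain the coordinates
whose index lies in the flat but not in `I`; they are free, apart from the invertibility of those
that occur in `f`, and they become the coordinates of the leaf. The coordinates with index outside
the flat are those moved by `H`; on them the components of the moment map dual to `J` restrict to
the moment map of `H` (`ChartData.sub_moment`), so they give the slice. The resulting homomorphism
is an isomorphism: monomials lift after multiplication by a power of `f`
(`ChartData.chart_surjective`), and any solution of the moment equations with invertible pivots can
be brought into the fixed gauge without changing the invariants (`ChartData.exists_factor`).

Substitution of the fixed gauge does not preserve the bracket of polynomials. The error is a sum of
products in which one factor is the derivative along a torus direction, so it vanishes on invariants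
(`ChartData.sub_bracket`, `ChartData.defect_of_mem`). Similarly, dilation does not preserve the
condition that pivots equal `1`, but dilation combined with a one-parameter subgroup of the torus
does, and the two agree on invariants (`ChartData.exists_twist`); this is the origin of the degrees
other than one.

It remains to see that the leaf through `z` is the locus where the flat is constant. In the chart
this locus is the leaf factor times the vertex of the slice (`ChartData.flat_ofAway_iff`), so it
carries symplectic coordinates. An arbitrary symplectic piece is compared with it near a common
point: the vanishing ideal of the piece is stable under Hamiltonian vector fields, hence restricts
to zero on a chart of the leaf, because a proper ideal stable under all partial derivatives is zero;
and, as the piece has no tangent vectors transverse to the leaf, Nakayama's lemma puts it inside the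
leaf (`LeafChart.exists_nhds_subset`). Connectedness makes this global. Finally, deforming points of
the zero fibre along hyperbolas shows that the closure of the leaf is the stratum of `H`, and a
point with all coordinates of the flat nonzero shows that `H` is the largest parabolic subgroup with
this stratum. -/

namespace Hypertoric

noncomputable section

/-! ### Derivations along an algebra homomorphism -/

section DerAlong

variable {S T : Type} [CommRing S] [Algebra ℂ S] [CommRing T] [Algebra ℂ T]

/-- `D` is a derivation from `S` to `T`, regarded as an `S`-module through `φ`. -/
def IsDerAlong (φ : S →ₐ[ℂ] T) (D : S →ₗ[ℂ] T) : Prop :=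
  ∀ a b, D (a * b) = φ a * D b + φ b * D a

namespace IsDerAlong

variable {φ : S →ₐ[ℂ] T} {D E : S →ₗ[ℂ] T}

theorem map_one (h : IsDerAlong φ D) : D 1 = 0 := by
  have := h 1 1
  simpa using this

theorem map_algebraMap (h : IsDerAlong φ D) (r : ℂ) : D (algebraMap ℂ S r) = 0 := by
  rw [Algebra.algebraMap_eq_smul_one, map_smul, h.map_one, smul_zero]

theorem sub (h : IsDerAlong φ D) (h' : IsDerAlong φ E) : IsDerAlong φ (D - E) := fun a b => by
  simp only [LinearMap.sub_apply, h a b, h' a b]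
  ring

theorem add (h : IsDerAlong φ D) (h' : IsDerAlong φ E) : IsDerAlong φ (D + E) := fun a b => by
  simp only [LinearMap.add_apply, h a b, h' a b]
  ring

theorem zero : IsDerAlong φ (0 : S →ₗ[ℂ] T) := fun a b => by simp

/-- Applying `D` to an equation `x * s = a` leaves `φ s * D x = 0`, and `φ s` is a unit. -/
theorem eq_zero_of_away {A : Type} [CommRing A] [Algebra ℂ A] {f : A}
    {φ : Localization.Away f →ₐ[ℂ] T} {D : Localization.Away f →ₗ[ℂ] T} (h : IsDerAlong φ D)
    (h0 : ∀ a, D (algebraMap A _ a) = 0) : D = 0 := by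
  ext x
  obtain ⟨⟨a, s⟩, hs⟩ := IsLocalization.surj (Submonoid.powers f) x
  have hu : IsUnit (φ (algebraMap A (Localization.Away f) s)) :=
    (IsLocalization.map_units _ s).map φ
  have h1 := congrArg D hs
  rw [h, h0, h0, mul_zero, zero_add] at h1
  simpa using (hu.mul_right_eq_zero).1 h1

theorem ext_away {A : Type} [CommRing A] [Algebra ℂ A] {f : A}
    {φ : Localization.Away f →ₐ[ℂ] T} {D E : Localization.Away f →ₗ[ℂ] T} (h : IsDerAlong φ D)
    (h' : IsDerAlong φ E) (h0 : ∀ a, D (algebraMap A _ a) = E (algebraMap A _ a)) : D = E :=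
  sub_eq_zero.1 ((h.sub h').eq_zero_of_away fun a => by simp [h0 a])

theorem eq_zero_of_X {σ : Type} {φ : MvPolynomial σ ℂ →ₐ[ℂ] T} {D : MvPolynomial σ ℂ →ₗ[ℂ] T}
    (h : IsDerAlong φ D) (h0 : ∀ i, D (MvPolynomial.X i) = 0) : D = 0 := by
  refine LinearMap.ext fun p => ?_
  rw [LinearMap.zero_apply]
  induction p using MvPolynomial.induction_on with
  | C a => exact h.map_algebraMap a
  | add p q hp hq => rw [map_add, hp, hq, add_zero]
  | mul_X p i hp => rw [h, hp, h0, mul_zero, mul_zero, add_zero]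

theorem ext_X {σ : Type} {φ : MvPolynomial σ ℂ →ₐ[ℂ] T} {D E : MvPolynomial σ ℂ →ₗ[ℂ] T}
    (h : IsDerAlong φ D) (h' : IsDerAlong φ E)
    (h0 : ∀ i, D (MvPolynomial.X i) = E (MvPolynomial.X i)) : D = E :=
  sub_eq_zero.1 ((h.sub h').eq_zero_of_X fun a => by simp [h0 a])

end IsDerAlong

theorem _root_.Derivation.sum_apply {κ : Type} (s : Finset κ) (D : κ → Derivation ℂ S S) (a : S) :
    (∑ i ∈ s, D i) a = ∑ i ∈ s, D i a :=
  map_sum (⟨⟨fun D => D a, rfl⟩, fun _ _ => rfl⟩ : Derivation ℂ S S →+ S) D s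

theorem _root_.Derivation.isDerAlong (D : Derivation ℂ S S) :
    IsDerAlong (AlgHom.id ℂ S) (D : S →ₗ[ℂ] S) := fun a b => by simp

end DerAlong

/-! ### The Zariski topology on closed points -/

section Topology

variable {A : Type} [CommRing A] [Algebra ℂ A]

theorem Pts.ext {z z' : Pts A} (h : ∀ a, z.val a = z'.val a) : z = z' :=
  AlgHom.ext h

theorem Pts.isOpen_ne (f : A) : IsOpen {z : Pts A | z.val f ≠ 0} := by
  refine isOpen_induced_iff.2 ⟨PrimeSpectrum.basicOpen f, (PrimeSpectrum.basicOpen f).2, ?_⟩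
  ext z
  rfl

theorem Pts.isClosed_eq (f : A) : IsClosed {z : Pts A | z.val f = 0} := by
  have := (Pts.isOpen_ne f).isClosed_compl
  simpa [Set.compl_ofPred] using this

theorem Pts.exists_ne_subset {U : Set (Pts A)} (hU : IsOpen U) {z : Pts A} (hz : z ∈ U) :
    ∃ f : A, z.val f ≠ 0 ∧ {z' : Pts A | z'.val f ≠ 0} ⊆ U := by
  obtain ⟨V, hV, rfl⟩ := isOpen_induced_iff.1 hU
  obtain ⟨_, ⟨f, rfl⟩, hf, hfV⟩ :=
    PrimeSpectrum.isTopologicalBasis_basic_opens.exists_subset_of_mem_open hz hV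
  exact ⟨f, hf, fun z' hz' => hfV hz'⟩

/-- Principal open sets form a basis, so a point outside the closure is separated from `S` by a
single function. -/
theorem Pts.mem_closure_iff {S : Set (Pts A)} {z : Pts A} :
    z ∈ closure S ↔ ∀ f : A, (∀ z' ∈ S, z'.val f = 0) → z.val f = 0 := by
  constructor
  · intro hz f hf
    exact closure_minimal (t := {z : Pts A | z.val f = 0}) (fun z' hz' => hf z' hz')
      (Pts.isClosed_eq f) hz
  · intro h
    rw [_root_.mem_closure_iff]
    intro U hU hzU
    obtain ⟨f, hf, hfU⟩ := Pts.exists_ne_subset hU hzU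
    by_contra hne
    refine hf (h f fun z' hz' => ?_)
    by_contra hz0
    exact hne ⟨z', hfU hz0, hz'⟩

/-- The map of closed points induced by an algebra homomorphism. -/
def Pts.comap {A' : Type} [CommRing A'] [Algebra ℂ A'] (φ : A →ₐ[ℂ] A') (z : Pts A') : Pts A :=
  z.val.comp φ

theorem Pts.comap_val {A' : Type} [CommRing A'] [Algebra ℂ A'] (φ : A →ₐ[ℂ] A') (z : Pts A')
    (a : A) : (z.comap φ).val a = z.val (φ a) := rfl

theorem Pts.continuous_comap {A' : Type} [CommRing A'] [Algebra ℂ A'] (φ : A →ₐ[ℂ] A') :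
    Continuous (Pts.comap φ) := by
  refine continuous_def.2 fun U hU => isOpen_iff_mem_nhds.2 fun z hz => ?_
  obtain ⟨f, hf, hfU⟩ := Pts.exists_ne_subset hU hz
  exact mem_nhds_iff.2 ⟨_, fun z' hz' => hfU hz', Pts.isOpen_ne (φ f), hf⟩

/-- The point of a principal open subset lying over a point where the function does not vanish. -/
def Pts.toAway {f : A} (z : Pts A) (hz : z.val f ≠ 0) : Pts (Localization.Away f) :=
  IsLocalization.Away.liftAlgHom f (f := z.val) (isUnit_iff_ne_zero.2 hz)

theorem Pts.toAway_algebraMap {f : A} (z : Pts A) (hz : z.val f ≠ 0) (a : A) :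
    (z.toAway hz).val (algebraMap A _ a) = z.val a :=
  IsLocalization.Away.lift_eq f (isUnit_iff_ne_zero.2 hz) a

theorem Pts.ofAway_toAway {f : A} (z : Pts A) (hz : z.val f ≠ 0) : (z.toAway hz).ofAway = z :=
  Pts.ext fun a => z.toAway_algebraMap hz a

theorem Pts.val_algebraMap_ne {f : A} (p : Pts (Localization.Away f)) :
    p.val (algebraMap A _ f) ≠ 0 :=
  ((IsLocalization.Away.algebraMap_isUnit f).map p.val).ne_zero

theorem Pts.toAway_ofAway {f : A} (p : Pts (Localization.Away f)) :
    p.ofAway.toAway (f := f) p.val_algebraMap_ne = p := by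
  have : (p.ofAway.toAway (f := f) p.val_algebraMap_ne).val = p.val :=
    IsLocalization.algHom_ext (Submonoid.powers f) (AlgHom.ext fun a => Pts.toAway_algebraMap p.ofAway p.val_algebraMap_ne a)
  exact this

end Topology

/-! ### Localized polynomial rings with their standard bracket -/

section Poly

variable {σ : Type}

/-- A nonzero polynomial over an infinite field has a nonzero value. This is applied to the
numerator of `u` times `g`, which keeps the point in the open set. -/
theorem Pts.exists_poly_away_ne {g : MvPolynomial σ ℂ} (hg : g ≠ 0) {u : Localization.Away g}
    (hu : u ≠ 0) : ∃ p : Pts (Localization.Away g), p.val u ≠ 0 := by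
  obtain ⟨⟨q, s⟩, hs⟩ := IsLocalization.surj (Submonoid.powers g) u
  have hq : q ≠ 0 := by
    rintro rfl
    rw [map_zero] at hs
    exact hu (((IsLocalization.map_units _ s).mul_left_eq_zero).1 hs)
  have : ∃ x, MvPolynomial.eval x (q * g) ≠ 0 := by
    by_contra! h
    exact mul_ne_zero hq hg (MvPolynomial.funext fun x => by rw [h x, map_zero])
  obtain ⟨x, hx⟩ := this
  rw [map_mul] at hx
  let z : Pts (MvPolynomial σ ℂ) := (MvPolynomial.aeval x : MvPolynomial σ ℂ →ₐ[ℂ] ℂ)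
  have hz : ∀ q, z.val q = MvPolynomial.eval x q := fun q => by
    rw [← MvPolynomial.coe_aeval_eq_eval]; rfl
  refine ⟨z.toAway (f := g) (by rw [hz]; exact right_ne_zero_of_mul hx), fun h0 => ?_⟩
  have := congrArg (z.toAway (f := g) (by rw [hz]; exact right_ne_zero_of_mul hx)).val hs
  rw [map_mul, h0, zero_mul, Pts.toAway_algebraMap, hz] at this
  exact left_ne_zero_of_mul hx this.symm

/-- The space is even irreducible: the product of two nonzero functions is nonzero in a domain, so
it is nonzero at some point. -/
theorem Pts.isPreconnected_poly_away (g : MvPolynomial σ ℂ) (hg : g ≠ 0) :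
    IsPreconnected (Set.univ : Set (Pts (Localization.Away g))) := by
  refine IsPreirreducible.isPreconnected fun U V hU hV ⟨x, _, hx⟩ ⟨y, _, hy⟩ => ?_
  obtain ⟨f, hf, hfU⟩ := Pts.exists_ne_subset hU hx
  obtain ⟨h, hh, hhV⟩ := Pts.exists_ne_subset hV hy
  have hdom : IsDomain (Localization.Away g) :=
    IsLocalization.isDomain_localization (powers_le_nonZeroDivisors_of_noZeroDivisors hg)
  have hf0 : f ≠ 0 := by rintro rfl; simp at hf
  have hh0 : h ≠ 0 := by rintro rfl; simp at hh
  obtain ⟨p, hp⟩ := Pts.exists_poly_away_ne hg (mul_ne_zero hf0 hh0)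
  rw [map_mul] at hp
  exact ⟨p, trivial, hfU (left_ne_zero_of_mul hp), hhV (right_ne_zero_of_mul hp)⟩

/-- In characteristic zero, differentiation by a variable of a nonconstant monomial of `q` does not
kill that monomial. -/
theorem exists_pderiv_ne_zero {q : MvPolynomial σ ℂ} (hq : ∀ r, q ≠ MvPolynomial.C r) :
    ∃ i, MvPolynomial.pderiv i q ≠ 0 ∧
      (MvPolynomial.pderiv i q).totalDegree < q.totalDegree := by
  classical
  have hs : ∃ s ∈ q.support, s ≠ 0 := by
    by_contra! h
    refine hq (q.coeff 0) (MvPolynomial.ext _ _ fun s => ?_)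
    rw [MvPolynomial.coeff_C]
    split_ifs with h0
    · rw [h0]
    · by_contra hne
      exact h0 (h s (MvPolynomial.mem_support_iff.2 hne)).symm
  obtain ⟨s, hs, hs0⟩ := hs
  obtain ⟨i, hi⟩ := Finsupp.ne_iff.1 hs0
  have hle : Finsupp.single i 1 ≤ s := by
    simpa [Finsupp.single_le_iff] using Nat.one_le_iff_ne_zero.2 hi
  have hne : MvPolynomial.pderiv i q ≠ 0 := by
    intro h0
    have := congrArg (MvPolynomial.coeff (s - Finsupp.single i 1)) h0
    rw [MvPolynomial.coeff_pderiv, tsub_add_cancel_of_le hle, MvPolynomial.coeff_zero] at this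
    rcases mul_eq_zero.1 this with h | h
    · exact MvPolynomial.mem_support_iff.1 hs h
    · exact Nat.cast_add_one_ne_zero _ h
  refine ⟨i, hne, ?_⟩
  obtain ⟨t, ht, htd⟩ := Finset.exists_mem_eq_sup (MvPolynomial.pderiv i q).support
    (by simpa using hne) (fun s => s.sum fun _ e => e)
  rw [MvPolynomial.totalDegree, htd]
  have htq : t + Finsupp.single i 1 ∈ q.support := by
    rw [MvPolynomial.mem_support_iff, MvPolynomial.coeff_pderiv] at *
    exact left_ne_zero_of_mul ht
  have := MvPolynomial.le_totalDegree htq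
  rw [Finsupp.sum_add_index' (by simp) (by simp)] at this
  simp only [Finsupp.sum_single_index] at this
  omega

/-- A nonzero element could be differentiated until it becomes a nonzero constant, which is a unit.
-/
theorem ideal_eq_bot_of_pderiv (J : Ideal (MvPolynomial σ ℂ)) (hJ : J ≠ ⊤)
    (h : ∀ q ∈ J, ∀ i, MvPolynomial.pderiv i q ∈ J) : J = ⊥ := by
  have key : ∀ n, ∀ q ∈ J, q.totalDegree = n → q = 0 := by
    intro n
    induction n using Nat.strong_induction_on with
    | _ n ih =>
      intro q hq hn
      by_contra h0
      by_cases hC : ∀ r, q ≠ MvPolynomial.C r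
      · obtain ⟨i, hi, hlt⟩ := exists_pderiv_ne_zero hC
        exact hi (ih _ (hn ▸ hlt) _ (h q hq i) rfl)
      · push Not at hC
        obtain ⟨r, rfl⟩ := hC
        have hr : r ≠ 0 := by rintro rfl; simp at h0
        exact hJ (Ideal.eq_top_of_isUnit_mem _ hq ((isUnit_iff_ne_zero.2 hr).map MvPolynomial.C))
  exact (Submodule.eq_bot_iff _).2 fun q hq => key _ q hq rfl

theorem polyBracket_inl {ι : Type} (i : ι) (q : MvPolynomial (ι ⊕ ι) ℂ) :
    polyBracket ι (MvPolynomial.X (Sum.inl i)) q = MvPolynomial.pderiv (Sum.inr i) q := by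
  simp [polyBracket, MvPolynomial.mkDerivation_X]

theorem polyBracket_inr {ι : Type} (i : ι) (q : MvPolynomial (ι ⊕ ι) ℂ) :
    polyBracket ι (MvPolynomial.X (Sum.inr i)) q = -MvPolynomial.pderiv (Sum.inl i) q := by
  simp [polyBracket, MvPolynomial.mkDerivation_X]

/-- A proper ideal of a localized polynomial ring which is stable under Hamiltonian vector fields
is zero. -/
theorem ideal_eq_bot_of_bracket {ι : Type} (g : MvPolynomial (ι ⊕ ι) ℂ)
    (J : Ideal (Localization.Away g)) (hJ : J ≠ ⊤)
    (h : ∀ u, ∀ v ∈ J, awayBracket (polyBracket ι) g u v ∈ J) : J = ⊥ := by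
  -- Up to sign, the partial derivatives are the Hamiltonian vector fields of the coordinates, so
  -- the contraction of `J` is stable under them.
  have h1 : J.comap (algebraMap (MvPolynomial (ι ⊕ ι) ℂ) (Localization.Away g)) = ⊥ := by
    refine ideal_eq_bot_of_pderiv _ ?_ ?_
    · rw [Ne, Ideal.comap_eq_top_iff]
      exact hJ
    · intro q hq i
      rw [Ideal.mem_comap] at hq ⊢
      rcases i with i | i
      · have := h (algebraMap (MvPolynomial (ι ⊕ ι) ℂ) _ (MvPolynomial.X (Sum.inr i))) _ hq
        rw [awayBracket_algebraMap, polyBracket_inr, map_neg] at this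
        exact (neg_mem_iff).1 this
      · have := h (algebraMap (MvPolynomial (ι ⊕ ι) ℂ) _ (MvPolynomial.X (Sum.inl i))) _ hq
        rwa [awayBracket_algebraMap, polyBracket_inl] at this
  refine (Submodule.eq_bot_iff _).2 fun u hu => ?_
  obtain ⟨⟨q, s⟩, hs⟩ := IsLocalization.surj (Submonoid.powers g) u
  have hq : q ∈ J.comap (algebraMap (MvPolynomial (ι ⊕ ι) ℂ) (Localization.Away g)) := by
    rw [Ideal.mem_comap, ← hs]
    exact J.mul_mem_right _ hu
  rw [h1, Ideal.mem_bot] at hq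
  simp only [hq, map_zero] at hs
  exact ((IsLocalization.map_units _ s).mul_left_eq_zero).1 hs

/-- Every tangent vector of a principal open subset of `𝔸^{2d}` is the value of a Hamiltonian
vector field. -/
theorem exists_hamiltonian {ι : Type} [Fintype ι] (g : MvPolynomial (ι ⊕ ι) ℂ)
    (p : Pts (Localization.Away g)) (w : Localization.Away g →ₗ[ℂ] ℂ) (hw : IsDerAlong p.val w) :
    ∃ h, ∀ u, w u = p.val (awayBracket (polyBracket ι) g h u) := by
  classical
  let y : ι ⊕ ι → Localization.Away g := fun i => algebraMap (MvPolynomial (ι ⊕ ι) ℂ) _ (MvPolynomial.X i)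
  -- The linear function whose Hamiltonian vector field has the components of `w`: bracketing with
  -- `x_i` is `∂/∂y_i`, and with `y_i` it is `-∂/∂x_i`.
  let h := ∑ i, (w (y (Sum.inr i)) • y (Sum.inl i) - w (y (Sum.inl i)) • y (Sum.inr i))
  let E : Localization.Away g →ₗ[ℂ] ℂ :=
    p.val.toLinearMap ∘ₗ (awayBracket (polyBracket ι) g h : _ →ₗ[ℂ] _)
  have hE : IsDerAlong p.val E := fun a b => by
    simp [E]
  refine ⟨h, fun u => ?_⟩
  have hwE : w = E := by
    refine hw.ext_away hE fun a => ?_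
    have h1 : IsDerAlong (p.val.comp (Algebra.algHom ℂ (MvPolynomial (ι ⊕ ι) ℂ) _))
        (w ∘ₗ (Algebra.algHom ℂ (MvPolynomial (ι ⊕ ι) ℂ) (Localization.Away g)).toLinearMap) :=
      fun a b => by simp [hw _ _]
    have h2 : IsDerAlong (p.val.comp (Algebra.algHom ℂ (MvPolynomial (ι ⊕ ι) ℂ) _))
        (E ∘ₗ (Algebra.algHom ℂ (MvPolynomial (ι ⊕ ι) ℂ) (Localization.Away g)).toLinearMap) :=
      fun a b => by simp [hE _ _]
    refine LinearMap.congr_fun (h1.ext_X h2 fun i => ?_) a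
    change w (y i) = p.val (awayBracket (polyBracket ι) g h (y i))
    have hb : ∀ j k, awayBracket (polyBracket ι) g (y j) (y k) =
        algebraMap _ _ (polyBracket ι (MvPolynomial.X j) (MvPolynomial.X k)) := fun j k =>
      awayBracket_algebraMap _ _ _ _
    simp only [h, map_sum, Derivation.sum_apply, map_sub, Derivation.sub_apply, Derivation.map_smul,
      Derivation.smul_apply, hb, polyBracket_inl, polyBracket_inr, map_smul]
    rcases i with i | i <;>
    simp [MvPolynomial.pderiv_X, Pi.single_apply, apply_ite]
  exact LinearMap.congr_fun hwE u

end Poly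

/-! ### Symplectic leaves from local charts -/

section Leaf

variable {A : Type} [CommRing A] [Algebra ℂ A]

/-- A retraction `ρ` of a principal neighbourhood `{f ≠ 0}` of `z` onto its intersection with `L`,
which is identified with a principal open subset of a symplectic vector space. -/
structure LeafChart (b : Biderivation A) (L : Set (Pts A)) (z : Pts A) where
  f : A
  val_ne : z.val f ≠ 0
  d : ℕ
  g : MvPolynomial (Fin d ⊕ Fin d) ℂ
  g_ne : g ≠ 0
  ρ : Localization.Away f →ₐ[ℂ] Localization.Away g
  sec : Localization.Away g →ₐ[ℂ] Localization.Away f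
  ρ_sec : ∀ u, ρ (sec u) = u
  fg : (RingHom.ker ρ).FG
  poisson : ∀ a a' : A, ρ (algebraMap A _ (b a a')) =
    awayBracket (polyBracket (Fin d)) g (ρ (algebraMap A _ a)) (ρ (algebraMap A _ a'))
  mem_iff : ∀ p : Pts (Localization.Away f), p.ofAway ∈ L ↔ ∀ u ∈ RingHom.ker ρ, p.val u = 0

/-! ### Geometry of a set with local symplectic charts -/

namespace LeafChart

variable {b : Biderivation A} {L : Set (Pts A)} {z : Pts A} (C : LeafChart b L z)

/-- The retraction on functions defined on all of `Spec A`. -/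
def res : A →ₐ[ℂ] Localization.Away C.g :=
  C.ρ.comp (Algebra.algHom ℂ A (Localization.Away C.f))

theorem res_apply (a : A) : C.res a = C.ρ (algebraMap A _ a) := rfl

theorem poisson' (a a' : A) :
    C.res (b a a') = awayBracket (polyBracket (Fin C.d)) C.g (C.res a) (C.res a') :=
  C.poisson a a'

theorem isUnit_res : IsUnit (C.res C.f) :=
  (IsLocalization.Away.algebraMap_isUnit C.f).map C.ρ

/-- The section provides a preimage of `u` over the open set `f ≠ 0`; clearing its denominator gives
a global function. -/
theorem exists_res (u : Localization.Away C.g) : ∃ a n, C.res a = C.res C.f ^ n * u := by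
  obtain ⟨⟨a, s, n, rfl⟩, hs⟩ := IsLocalization.surj (Submonoid.powers C.f) (C.sec u)
  refine ⟨a, n, ?_⟩
  have := congrArg C.ρ hs
  rw [map_mul, C.ρ_sec] at this
  rw [res_apply, ← this, mul_comm]
  simp [res_apply]

/-- The point of the leaf with given coordinates. -/
def point (p : Pts (Localization.Away C.g)) : Pts A := (p.comap C.ρ).ofAway

theorem point_val (p : Pts (Localization.Away C.g)) (a : A) :
    (C.point p).val a = p.val (C.res a) := rfl

theorem point_mem (p : Pts (Localization.Away C.g)) : C.point p ∈ L :=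
  (C.mem_iff _).2 fun u hu => by
    rw [Pts.comap_val, (RingHom.mem_ker).1 hu, map_zero]

theorem exists_point {z' : Pts A} (hz' : z'.val C.f ≠ 0) (hL : z' ∈ L) :
    ∃ p, C.point p = z' := by
  refine ⟨(z'.toAway hz').comap C.sec, Pts.ext fun a => ?_⟩
  rw [← z'.ofAway_toAway hz', C.mem_iff] at hL
  have := hL (C.sec (C.res a) - algebraMap A _ a) (by
    rw [RingHom.mem_ker, map_sub, C.ρ_sec, res_apply, sub_self])
  rw [map_sub, Pts.toAway_algebraMap, sub_eq_zero] at this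
  exact this

theorem res_eq_zero {a : A} (h : ∀ z' ∈ L, z'.val a = 0) : C.res a = 0 := by
  by_contra hne
  obtain ⟨p, hp⟩ := Pts.exists_poly_away_ne C.g_ne hne
  exact hp (h _ (C.point_mem p))

/-- The chart controls `a` only where `f ≠ 0`; the factor `f` takes care of the other points of `L`.
-/
theorem mul_vanishes {a : A} (h : C.res a = 0) : ∀ z' ∈ L, z'.val (C.f * a) = 0 := by
  intro z' hz'
  rw [map_mul]
  by_cases h0 : z'.val C.f = 0
  · rw [h0, zero_mul]
  · obtain ⟨p, rfl⟩ := C.exists_point h0 hz'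
    rw [C.point_val p a, h, map_zero, mul_zero]

/-- Inside the chart, `L` is cut out by the kernel of `ρ`. The numerators of its elements,
multiplied by `f`, vanish on `L` and therefore on its closure, so the closure of `L` adds no points
there. -/
theorem isLocallyClosed (h : ∀ z ∈ L, Nonempty (LeafChart b L z)) : IsLocallyClosed L := by
  refine ((isLocallyClosed_tfae L).out 0 3).2 fun z hz => ?_
  obtain ⟨C⟩ := h z hz
  refine ⟨_, C.val_ne, Pts.isOpen_ne C.f, ?_⟩
  rintro z' ⟨hz', hcl⟩
  have hz'f : z'.val C.f ≠ 0 := hz'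
  rw [← z'.ofAway_toAway hz'f, C.mem_iff]
  intro u hu
  obtain ⟨⟨a, s⟩, hs⟩ := IsLocalization.surj (Submonoid.powers C.f) u
  have ha : C.res a = 0 := by
    rw [res_apply, ← hs, map_mul, (RingHom.mem_ker).1 hu, zero_mul]
  have h1 := Pts.mem_closure_iff.1 hcl _ (C.mul_vanishes ha)
  rw [map_mul] at h1
  have h2 := congrArg (z'.toAway hz'f).val hs
  rw [map_mul, z'.toAway_algebraMap hz'f a, (mul_eq_zero.1 h1).resolve_left hz'f] at h2
  have h3 : (z'.toAway hz'f).val (algebraMap A _ s) ≠ 0 :=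
    ((IsLocalization.map_units _ s).map (z'.toAway hz'f).val).ne_zero
  exact (mul_eq_zero.1 h2).resolve_right h3

/-- `L` is a union of images of irreducible spaces, all of which contain `z₀`. -/
theorem isPreconnected {z₀ : Pts A} (h : ∀ z ∈ L, ∃ C : LeafChart b L z, z₀.val C.f ≠ 0)
    (h₀ : z₀ ∈ L) : IsPreconnected L := by
  choose C hC using h
  have hL : L = ⋃₀ {s | ∃ z, ∃ hz : z ∈ L, s = Set.range (C z hz).point} := by
    ext z
    constructor
    · intro hz
      obtain ⟨p, hp⟩ := (C z hz).exists_point (C z hz).val_ne hz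
      exact ⟨_, ⟨z, hz, rfl⟩, p, hp⟩
    · rintro ⟨_, ⟨z', hz', rfl⟩, p, rfl⟩
      exact (C z' hz').point_mem p
  rw [hL]
  refine isPreconnected_sUnion z₀ _ ?_ ?_
  · rintro _ ⟨z', hz', rfl⟩
    exact (C z' hz').exists_point (hC z' hz') h₀
  · rintro _ ⟨z', hz', rfl⟩
    rw [← Set.image_univ]
    exact (Pts.isPreconnected_poly_away _ (C z' hz').g_ne).image _
      (Pts.continuous_comap (C z' hz').res).continuousOn

/-- A derivation at `z` that kills the functions vanishing on the leaf is the value of a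
Hamiltonian vector field. -/
theorem exists_hamiltonian (C : LeafChart b L z) (hz : z ∈ L) (v : A →ₗ[ℂ] ℂ) (hv : IsDerAlong z.val v)
    (hL : ∀ a, (∀ z' ∈ L, z'.val a = 0) → v a = 0) : ∃ h, ∀ a, v a = z.val (b h a) := by
  obtain ⟨p, hp⟩ := C.exists_point C.val_ne hz
  have hpz : ∀ a, p.val (C.res a) = z.val a := fun a => by rw [← C.point_val, hp]
  have hker : ∀ a, C.res a = 0 → v a = 0 := fun a ha => by
    have h1 := hL _ (C.mul_vanishes ha)
    rw [hv, ← hpz a, ha, map_zero, zero_mul, add_zero] at h1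
    exact (mul_eq_zero.1 h1).resolve_left C.val_ne
  -- extend `v` to the localization by means of dual numbers
  let θ : A →ₐ[ℂ] TrivSqZeroExt ℂ ℂ :=
    { toFun := fun a => TrivSqZeroExt.inl (z.val a) + TrivSqZeroExt.inr (v a)
      map_one' := by ext <;> simp [hv.map_one]
      map_zero' := by simp
      map_mul' := fun a a' => by
        ext
        · simp
        · simp [hv a a', mul_comm]
      map_add' := fun a a' => by ext <;> simp
      commutes' := fun r => by
        ext <;> simp [hv.map_algebraMap, TrivSqZeroExt.algebraMap_eq_inl] }
  have hθ1 : ∀ a, (θ a).fst = z.val a := fun a => by simp [θ]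
  have hθ2 : ∀ a, (θ a).snd = v a := fun a => by simp [θ]
  have hu : IsUnit (θ C.f) := by
    rw [TrivSqZeroExt.isUnit_iff_isUnit_fst, hθ1]
    exact isUnit_iff_ne_zero.2 C.val_ne
  let Θ : Localization.Away C.f →ₐ[ℂ] TrivSqZeroExt ℂ ℂ :=
    IsLocalization.Away.liftAlgHom C.f (f := θ) hu
  have hΘ : ∀ a, Θ (algebraMap A _ a) = θ a := fun a => IsLocalization.Away.lift_eq C.f hu a
  have hΘker : ∀ u, C.ρ u = 0 → Θ u = 0 := fun u hu' => by
    obtain ⟨⟨a, s⟩, hs⟩ := IsLocalization.surj (Submonoid.powers C.f) u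
    have ha : C.res a = 0 := by rw [res_apply, ← hs, map_mul, hu', zero_mul]
    have h1 := congrArg Θ hs
    rw [map_mul, hΘ a] at h1
    have h2 : θ a = 0 := by
      ext
      · rw [hθ1, ← hpz, ha, map_zero]; rfl
      · rw [hθ2, hker a ha]; rfl
    rw [h2] at h1
    exact ((IsLocalization.map_units (Localization.Away C.f) s).map Θ).mul_left_eq_zero.1 h1
  let Ξ : Localization.Away C.g →ₐ[ℂ] TrivSqZeroExt ℂ ℂ := Θ.comp C.sec
  have hΞ : ∀ u, Ξ (C.ρ u) = Θ u := fun u => by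
    have := hΘker (C.sec (C.ρ u) - u) (by rw [map_sub, C.ρ_sec, sub_self])
    rwa [map_sub, sub_eq_zero] at this
  have hΞ1 : ∀ u, (Ξ u).fst = p.val u := fun u => by
    obtain ⟨a, n, hn⟩ := C.exists_res u
    have h1 := congrArg (fun x => (Ξ x).fst) hn
    simp only [map_mul, map_pow, res_apply, hΞ, hΘ, TrivSqZeroExt.fst_mul, TrivSqZeroExt.fst_pow,
      hθ1] at h1
    have h2 := congrArg p.val hn
    rw [hpz, map_mul, map_pow, hpz] at h2
    exact mul_left_cancel₀ (pow_ne_zero n C.val_ne) (h1.symm.trans h2)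
  let w : Localization.Away C.g →ₗ[ℂ] ℂ := (TrivSqZeroExt.sndHom ℂ ℂ).restrictScalars ℂ ∘ₗ Ξ.toLinearMap
  have hwΞ : ∀ u, w u = (Ξ u).snd := fun u => rfl
  have hw : IsDerAlong p.val w := fun u u' => by
    rw [hwΞ, hwΞ, hwΞ, map_mul, TrivSqZeroExt.snd_mul, hΞ1, hΞ1]
    simp [mul_comm]
  have hwv : ∀ a, w (C.res a) = v a := fun a => by
    rw [hwΞ, res_apply, hΞ, hΘ, hθ2]
  obtain ⟨h, hh⟩ := Hypertoric.exists_hamiltonian C.g p w hw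
  obtain ⟨a, n, hn⟩ := C.exists_res h
  -- The Hamiltonian `h` found on the chart need not come from `A`; only `f ^ n * h` is known to be
  -- the restriction of some `a`.
  let β := awayBracket (polyBracket (Fin C.d)) C.g
  have key : ∀ a', z.val (b a a') =
      z.val C.f ^ n * v a' + p.val h * p.val (β (C.res (C.f ^ n)) (C.res a')) := fun a' => by
    have h3 := C.poisson' a a'
    rw [hn, ← map_pow] at h3
    have h4 := congrArg p.val h3
    rw [hpz] at h4
    rw [h4, Derivation.leibniz, Derivation.add_apply, Derivation.smul_apply, Derivation.smul_apply,
      map_add, smul_eq_mul, smul_eq_mul, map_mul, map_mul, ← hh, hwv, hpz, map_pow]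
  have hfn : z.val C.f ^ n ≠ 0 := pow_ne_zero n C.val_ne
  -- Subtracting the constant `h(p)` times `f ^ n` removes the term of the Leibniz rule in which `f
  -- ^ n` is differentiated.
  refine ⟨(z.val C.f ^ n)⁻¹ • (a - p.val h • C.f ^ n), fun a' => ?_⟩
  rw [Derivation.map_smul, Derivation.smul_apply, map_sub, Derivation.sub_apply,
    Derivation.map_smul, Derivation.smul_apply, map_smul, map_sub, map_smul, key, ← hpz (b (C.f ^ n) a'), C.poisson']
  simp only [smul_eq_mul, β]
  field_simp
  ring

/-- Hamiltonian vectors are tangent because `res` is a Poisson map and kills the functions vanishing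
on `L`; the other inclusion is nondegeneracy of the bracket on the chart. -/
theorem tangent_eq (C : LeafChart b L z) (hz : z ∈ L) : tangentSpace L z = hamiltonianSpace b z := by
  obtain ⟨p, hp⟩ := C.exists_point C.val_ne hz
  refine le_antisymm (fun v hv => C.exists_hamiltonian hz v hv.1 hv.2) ?_
  rintro v ⟨h, hv⟩
  refine ⟨fun a a' => ?_, fun a ha => ?_⟩
  · rw [hv, hv, hv, Derivation.leibniz, map_add, smul_eq_mul, smul_eq_mul, map_mul, map_mul]
  · rw [hv, ← hp, C.point_val, C.poisson', C.res_eq_zero ha, map_zero, map_zero]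

end LeafChart

theorem isSymplecticPiece_of_charts {b : Biderivation A} {L : Set (Pts A)} {z₀ : Pts A}
    (h : ∀ z ∈ L, ∃ C : LeafChart b L z, z₀.val C.f ≠ 0) (h₀ : z₀ ∈ L) :
    IsSymplecticPiece b L where
  isConnected := ⟨⟨z₀, h₀⟩, LeafChart.isPreconnected h h₀⟩
  isLocallyClosed := LeafChart.isLocallyClosed fun z hz => let ⟨C, _⟩ := h z hz; ⟨C⟩
  tangent_eq z hz := let ⟨C, _⟩ := h z hz; C.tangent_eq hz

/-- The ideal of functions vanishing on a set of closed points. -/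
def vanishing (Z : Set (Pts A)) : Ideal A where
  carrier := {a | ∀ z ∈ Z, z.val a = 0}
  add_mem' ha hb z hz := by rw [map_add, ha z hz, hb z hz, add_zero]
  zero_mem' z _ := map_zero _
  smul_mem' c a ha z hz := by rw [smul_eq_mul, map_mul, ha z hz, mul_zero]

/-- Hamiltonian vectors at points of `Z` are tangent to `Z`. So the vanishing ideal is stable under
Hamiltonian vector fields, which makes it comparable with ideals in a chart. -/
theorem IsSymplecticPiece.bracket_mem {b : Biderivation A} {Z : Set (Pts A)}
    (hZ : IsSymplecticPiece b Z) (h : A) {a : A} (ha : a ∈ vanishing Z) :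
    b h a ∈ vanishing Z := by
  intro z hz
  let v : A →ₗ[ℂ] ℂ := z.val.toLinearMap ∘ₗ (b h : A →ₗ[ℂ] A)
  have hv : v ∈ hamiltonianSpace b z := ⟨h, fun _ => rfl⟩
  rw [← hZ.tangent_eq z hz] at hv
  exact hv.2 a ha

/-! ### Comparison of a symplectic piece with a leaf through one of its points -/

namespace LeafChart

variable {b : Biderivation A} {L : Set (Pts A)} {z : Pts A} (C : LeafChart b L z)

/-- A symplectic piece through `z` contains the leaf in its closure. -/
theorem res_vanishing (C : LeafChart b L z) {Z : Set (Pts A)} (hZ : IsSymplecticPiece b Z) (hzZ : z ∈ Z) (hz : z ∈ L)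
    {a : A} (ha : a ∈ vanishing Z) : C.res a = 0 := by
  obtain ⟨p, hp⟩ := C.exists_point C.val_ne hz
  let β := awayBracket (polyBracket (Fin C.d)) C.g
  -- The extended ideal is proper, as its elements vanish at the coordinates `p` of `z`; it is
  -- stable under brackets; so it is zero.
  have hbot : (vanishing Z).map C.res = ⊥ := by
    refine ideal_eq_bot_of_bracket C.g _ ?_ ?_
    · intro htop
      have hle : (vanishing Z).map C.res ≤ RingHom.ker p.val :=
        Ideal.map_le_iff_le_comap.2 fun a ha => by
          rw [Ideal.mem_comap, RingHom.mem_ker, ← C.point_val, hp]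
          exact ha z hzZ
      rw [htop, top_le_iff] at hle
      exact RingHom.ker_ne_top _ hle
    · intro u v hv
      have hgen : ∀ a ∈ vanishing Z, β u (C.res a) ∈ (vanishing Z).map C.res := fun a ha => by
        obtain ⟨h, n, hn⟩ := C.exists_res u
        have h1 : ∀ h, β (C.res h) (C.res a) ∈ (vanishing Z).map C.res := fun h => by
          rw [← C.poisson']
          exact Ideal.mem_map_of_mem _ (hZ.bracket_mem h ha)
        have h2 := h1 h
        rw [hn, Derivation.leibniz, Derivation.add_apply, Derivation.smul_apply,
          Derivation.smul_apply, ← map_pow] at h2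
        -- The Leibniz rule for `f ^ n * u` isolates the bracket with `u`, up to the unit `f ^ n`.
        have h3 := (Ideal.add_mem_iff_left _ (Ideal.mul_mem_left _ u (h1 (C.f ^ n)))).1 h2
        rw [map_pow] at h3
        exact (Ideal.unit_mul_mem_iff_mem _ (C.isUnit_res.pow n)).1 h3
      induction hv using Submodule.span_induction with
      | mem v hv =>
        obtain ⟨a, ha, rfl⟩ := hv
        exact hgen a ha
      | zero => rw [map_zero]; exact Ideal.zero_mem _
      | add v v' _ _ h h' => rw [map_add]; exact Ideal.add_mem _ h h'
      | smul r v hv h =>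
        rw [smul_eq_mul, Derivation.leibniz]
        exact Ideal.add_mem _ (Ideal.mul_mem_left _ _ h) (Ideal.mul_mem_right _ _ hv)
  have := Ideal.mem_map_of_mem C.res ha
  rwa [hbot, Ideal.mem_bot] at this

/-- Near each of its points on `L`, a symplectic piece is contained in `L`. -/
theorem exists_nhds_subset (C : LeafChart b L z) {Z : Set (Pts A)} (hZ : IsSymplecticPiece b Z) (hzZ : z ∈ Z)
    (hz : z ∈ L) : ∃ U : Set (Pts A), IsOpen U ∧ z ∈ U ∧ Z ∩ U ⊆ L := by
  obtain ⟨p, hp⟩ := C.exists_point C.val_ne hz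
  set zf := z.toAway C.val_ne with hzf
  set N := RingHom.ker C.ρ with hN
  set J := (vanishing Z).map (algebraMap A (Localization.Away C.f)) with hJ
  set m := RingHom.ker zf.val with hm
  have hpz : ∀ u, p.val (C.ρ u) = zf.val u := by
    have h1 : p.comap C.ρ = zf := by
      rw [hzf, ← (p.comap C.ρ).toAway_ofAway]
      congr 1
    intro u
    rw [← h1, Pts.comap_val]
  have hJN : J ≤ N := Ideal.map_le_iff_le_comap.2 fun a ha => C.res_vanishing hZ hzZ hz ha
  have hNm : N ≤ m := fun u hu => by
    rw [hm, RingHom.mem_ker, ← hpz, (RingHom.mem_ker).1 hu, map_zero]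
  -- Otherwise a linear form on `N` that vanishes on `J + m N` would give a vector at `z` tangent to
  -- `Z` but transverse to `L`, while Hamiltonian vectors are tangent to `L`.
  have hle : N ≤ J ⊔ m * N := by
    intro u hu
    by_contra hnot
    obtain ⟨lam, hlam, hbot⟩ := Submodule.exists_le_ker_of_notMem
      (p := (J ⊔ m * N).restrictScalars ℂ) hnot
    have hmN : ∀ x ∈ m, ∀ y ∈ N, lam (x * y) = 0 := fun x hx y hy =>
      hbot (show x * y ∈ J ⊔ m * N from Ideal.mem_sup_right (Ideal.mul_mem_mul hx hy))
    have hJ0 : ∀ x ∈ J, lam x = 0 := fun x hx =>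
      hbot (show x ∈ J ⊔ m * N from Ideal.mem_sup_left hx)
    -- The projection onto the kernel of `ρ` along the section turns the linear form into a
    -- derivation at `z`, because the form vanishes on `m N`.
    let v : Localization.Away C.f →ₗ[ℂ] ℂ :=
      lam ∘ₗ (LinearMap.id - C.sec.toLinearMap ∘ₗ C.ρ.toLinearMap)
    have hvdef : ∀ x, v x = lam (x - C.sec (C.ρ x)) := fun x => rfl
    have hmem : ∀ x, x - C.sec (C.ρ x) ∈ N := fun x => by
      rw [hN, RingHom.mem_ker, map_sub, C.ρ_sec, sub_self]
    have hlin : ∀ x, ∀ y ∈ N, lam (x * y) = zf.val x * lam y := fun x y hy => by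
      have h1 := hmN (x - algebraMap ℂ _ (zf.val x)) (by
        rw [hm, RingHom.mem_ker, map_sub, AlgHom.commutes]; simp) y hy
      rw [sub_mul, map_sub, ← Algebra.smul_def, map_smul, sub_eq_zero] at h1
      exact h1
    have hsec : ∀ x, zf.val (C.sec (C.ρ x)) = zf.val x := fun x => by
      rw [← hpz, C.ρ_sec, hpz]
    have hv : IsDerAlong zf.val v := fun x y => by
      rw [hvdef, hvdef, hvdef, ← hlin x _ (hmem y), ← hsec y, ← hlin _ _ (hmem x), ← map_add]
      congr 1
      rw [map_mul, map_mul]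
      ring
    let v' : A →ₗ[ℂ] ℂ := v ∘ₗ (Algebra.algHom ℂ A (Localization.Away C.f)).toLinearMap
    have hv'def : ∀ a, v' a = v (algebraMap A _ a) := fun a => rfl
    have hv' : v' ∈ tangentSpace Z z := by
      refine ⟨fun a a' => ?_, fun a ha => ?_⟩
      · rw [hv'def, map_mul, hv, Pts.toAway_algebraMap, Pts.toAway_algebraMap]
        rfl
      · have h1 : algebraMap A (Localization.Away C.f) a ∈ J := Ideal.mem_map_of_mem _ ha
        have h2 := hJN h1
        rw [hv'def, hvdef, (RingHom.mem_ker).1 h2, map_zero, sub_zero]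
        exact hJ0 _ h1
    rw [hZ.tangent_eq z hzZ] at hv'
    obtain ⟨h, hh⟩ := hv'
    obtain ⟨⟨a, s⟩, hs⟩ := IsLocalization.surj (Submonoid.powers C.f) u
    have ha : C.res a = 0 := by
      rw [res_apply, ← hs, map_mul, (RingHom.mem_ker).1 hu, zero_mul]
    have h1 := hh a
    rw [← hp, C.point_val, C.poisson', ha, map_zero, map_zero, hv'def, ← hs, hv,
      (RingHom.mem_ker).1 (hNm hu), zero_mul, zero_add, hvdef, (RingHom.mem_ker).1 hu, map_zero,
      sub_zero] at h1
    have h2 : zf.val (algebraMap A _ s) ≠ 0 :=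
      ((IsLocalization.map_units _ s).map zf.val).ne_zero
    exact hlam ((mul_eq_zero.1 h1).resolve_left h2)
  -- Nakayama's lemma for the image of `N` modulo `J`; here the finite generation of the kernel is
  -- needed. Where `r` does not vanish, the functions in `N` vanish on `Z`.
  obtain ⟨r, hr1, hr⟩ := Submodule.exists_sub_one_mem_and_smul_eq_zero_of_fg_of_le_smul m
    (Submodule.map (Submodule.mkQ J) N) (Submodule.FG.map _ C.fg) (by
      rw [← Submodule.map_smul'']
      rintro _ ⟨x, hx, rfl⟩
      obtain ⟨j, hj, y, hy, rfl⟩ := Submodule.mem_sup.1 (hle hx)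
      refine ⟨y, hy, ?_⟩
      have hj0 : Submodule.mkQ J j = 0 := (Submodule.Quotient.mk_eq_zero J).2 hj
      rw [map_add, hj0, zero_add])
  have hrJ : ∀ u ∈ N, r * u ∈ J := fun u hu => by
    have := hr _ ⟨u, hu, rfl⟩
    rw [← map_smul] at this
    exact (Submodule.Quotient.mk_eq_zero J).1 this
  have hzr : zf.val r = 1 := by
    rw [hm, RingHom.mem_ker, map_sub, map_one, sub_eq_zero] at hr1
    exact hr1
  obtain ⟨⟨a, s⟩, hs⟩ := IsLocalization.surj (Submonoid.powers C.f) r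
  refine ⟨{z' | z'.val C.f ≠ 0} ∩ {z' | z'.val a ≠ 0},
    (Pts.isOpen_ne _).inter (Pts.isOpen_ne _), ⟨C.val_ne, ?_⟩, ?_⟩
  · have h1 := congrArg zf.val hs
    rw [map_mul, hzr, one_mul] at h1
    have h2 : zf.val (algebraMap A _ s) ≠ 0 :=
      ((IsLocalization.map_units _ s).map zf.val).ne_zero
    rwa [h1, hzf, Pts.toAway_algebraMap] at h2
  · rintro z' ⟨hz'Z, hz'f, hz'a⟩
    have hz'f : z'.val C.f ≠ 0 := hz'f
    rw [← z'.ofAway_toAway hz'f, C.mem_iff]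
    intro u hu
    have hJz : J ≤ RingHom.ker (z'.toAway hz'f).val :=
      Ideal.map_le_iff_le_comap.2 fun x hx => by
        rw [Ideal.mem_comap, RingHom.mem_ker, Pts.toAway_algebraMap]
        exact hx z' hz'Z
    have h1 := (RingHom.mem_ker).1 (hJz (hrJ u hu))
    rw [map_mul] at h1
    refine (mul_eq_zero.1 h1).resolve_left fun h2 => ?_
    have h3 := congrArg (z'.toAway hz'f).val hs
    rw [map_mul, h2, zero_mul, Pts.toAway_algebraMap] at h3
    exact hz'a h3.symm

end LeafChart

/-- If `Spec A` is partitioned into sets `L i` with charts, each symplectic piece is contained in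
one of them. -/
theorem IsSymplecticPiece.subset_of_charts {b : Biderivation A} {κ : Type} (e : Pts A → κ)
    (h : ∀ z, Nonempty (LeafChart b {z' | e z' = e z} z)) {Z : Set (Pts A)}
    (hZ : IsSymplecticPiece b Z) {z : Pts A} (hz : z ∈ Z) : Z ⊆ {z' | e z' = e z} := by
  have hopen : ∀ z ∈ Z, ∃ U : Set (Pts A), IsOpen U ∧ z ∈ U ∧ Z ∩ U ⊆ {z' | e z' = e z} :=
    fun z hz => by
      obtain ⟨C⟩ := h z
      exact C.exists_nhds_subset hZ hz rfl
  choose! U hUo hzU hUL using hopen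
  -- Two unions of the neighbourhoods, for the value `e z` and for all other values, would separate
  -- `Z`.
  by_contra hnot
  obtain ⟨z₁, hz₁, hne⟩ := Set.not_subset.1 hnot
  obtain ⟨z₂, hz₂, hz₂1, hz₂2⟩ := hZ.isConnected.isPreconnected
    (⋃ z' ∈ {z' | z' ∈ Z ∧ e z' = e z}, U z') (⋃ z' ∈ {z' | z' ∈ Z ∧ e z' ≠ e z}, U z')
    (isOpen_biUnion fun z' hz' => hUo z' hz'.1) (isOpen_biUnion fun z' hz' => hUo z' hz'.1)
    (fun z' hz' => by
      by_cases h' : e z' = e z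
      · exact Or.inl (Set.mem_biUnion (show z' ∈ {z' | z' ∈ Z ∧ e z' = e z} from ⟨hz', h'⟩)
          (hzU z' hz'))
      · exact Or.inr (Set.mem_biUnion (show z' ∈ {z' | z' ∈ Z ∧ e z' ≠ e z} from ⟨hz', h'⟩)
          (hzU z' hz')))
    ⟨z, hz, Set.mem_biUnion (show z ∈ {z' | z' ∈ Z ∧ e z' = e z} from ⟨hz, rfl⟩) (hzU z hz)⟩
    ⟨z₁, hz₁, Set.mem_biUnion (show z₁ ∈ {z' | z' ∈ Z ∧ e z' ≠ e z} from ⟨hz₁, hne⟩)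
      (hzU z₁ hz₁)⟩
  obtain ⟨z₃, ⟨hz₃, he₃⟩, hU₃⟩ := Set.mem_iUnion₂.1 hz₂1
  obtain ⟨z₄, ⟨hz₄, he₄⟩, hU₄⟩ := Set.mem_iUnion₂.1 hz₂2
  have h3 : e z₂ = e z₃ := hUL z₃ hz₃ ⟨hz₂, hU₃⟩
  have h4 : e z₂ = e z₄ := hUL z₄ hz₄ ⟨hz₂, hU₄⟩
  exact he₄ (h4.symm.trans (h3.trans he₃))

end Leaf

/-! ### Weights of monomials -/

section Weights

variable {m : ℕ}

theorem character_add (χ χ' : Fin m → ℤ) (c : Fin m → ℂˣ) :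
    character (χ + χ') c = character χ c * character χ' c := by
  simp [character, zpow_add, Finset.prod_mul_distrib]

theorem character_zero (c : Fin m → ℂˣ) : character 0 c = 1 := by
  simp [character]

theorem character_zsmul (d : ℤ) (χ : Fin m → ℤ) (c : Fin m → ℂˣ) :
    character (d • χ) c = character χ c ^ d := by
  simp [character, ← Finset.prod_zpow, ← zpow_mul, mul_comm]

theorem character_sum {κ : Type} (s : Finset κ) (χ : κ → Fin m → ℤ) (c : Fin m → ℂˣ) :
    character (∑ i ∈ s, χ i) c = ∏ i ∈ s, character (χ i) c := by
  classical
  induction s using Finset.induction_on with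
  | empty => simp [character_zero]
  | insert a s ha ih => rw [Finset.sum_insert ha, Finset.prod_insert ha, character_add, ih]

/-- Evaluation at the point with `j`-th coordinate `2` and the others `1` gives `2 ^ χ j = 1`;
absolute values then give `χ j = 0`. -/
theorem character_eq_zero {χ : Fin m → ℤ} (h : ∀ c, character χ c = 1) : χ = 0 := by
  ext j
  have h2 : (2 : ℂ) ≠ 0 := two_ne_zero
  have := h (Function.update 1 j (Units.mk0 2 h2))
  have h3 : character χ (Function.update 1 j (Units.mk0 2 h2)) = Units.mk0 2 h2 ^ χ j := by
    simp only [character, MonoidHom.coe_mk, OneHom.coe_mk]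
    rw [Finset.prod_eq_single j]
    · simp
    · intro i _ hi
      simp [Function.update_of_ne hi]
    · simp
  rw [h3] at this
  have h4 := congrArg (fun u : ℂˣ => ‖(u : ℂ)‖) this
  simp only [Units.val_zpow_eq_zpow_val, Units.val_mk0, norm_zpow, Complex.norm_ofNat,
    Units.val_one, norm_one] at h4
  exact (zpow_eq_one_iff_right₀ (by norm_num) (by norm_num)).1 h4

theorem lieAlg_top : lieAlg (⊤ : Subgroup (Fin m → ℂˣ)) = ⊤ :=
  eq_top_iff.2 fun ξ _ χ hχ => by
    rw [character_eq_zero fun c => hχ c trivial]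
    simp

variable {ι : Type}

/-- The index of the symplectic plane to which a coordinate belongs. -/
def idx (v : ι ⊕ ι) : ι := Sum.elim id id v

/-- The sign of the weight of a coordinate: `1` for `x_i` and `-1` for `y_i`. -/
def sgn (v : ι ⊕ ι) : ℤ := Sum.elim (fun _ => 1) (fun _ => -1) v

@[simp] theorem idx_inl (i : ι) : idx (Sum.inl i) = i := rfl
@[simp] theorem idx_inr (i : ι) : idx (Sum.inr i) = i := rfl
@[simp] theorem sgn_inl (i : ι) : sgn (Sum.inl i) = 1 := rfl
@[simp] theorem sgn_inr (i : ι) : sgn (Sum.inr i) = -1 := rfl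

theorem sum_elim_eq_zpow (u : ι → ℂˣ) (v : ι ⊕ ι) :
    Sum.elim u (fun i => (u i)⁻¹) v = u (idx v) ^ sgn v := by
  rcases v with i | i <;> simp

variable [Fintype ι]

/-- The weight of a monomial under the torus. -/
def wt (B : Matrix ι (Fin m) ℤ) (s : ι ⊕ ι →₀ ℕ) : Fin m → ℤ :=
  ∑ v, (sgn v * s v) • B (idx v)

theorem wt_add (B : Matrix ι (Fin m) ℤ) (s t : ι ⊕ ι →₀ ℕ) : wt B (s + t) = wt B s + wt B t := by
  simp [wt, mul_add, add_smul, Finset.sum_add_distrib]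

theorem wt_zero (B : Matrix ι (Fin m) ℤ) : wt B 0 = 0 := by
  simp [wt]

theorem wt_single (B : Matrix ι (Fin m) ℤ) (v : ι ⊕ ι) (k : ℕ) :
    wt B (Finsupp.single v k) = (sgn v * k) • B (idx v) := by
  classical
  rw [wt, Finset.sum_eq_single v]
  · simp
  · intro w _ hw
    simp [Finsupp.single_eq_of_ne hw]
  · simp

theorem prod_eq_character (B : Matrix ι (Fin m) ℤ) (s : ι ⊕ ι →₀ ℕ) (c : Fin m → ℂˣ) :
    (s.prod fun v k =>
      Sum.elim (fun i => character (B i) c) (fun i => (character (B i) c)⁻¹) v ^ k : ℂˣ) =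
    character (wt B s) c := by
  rw [Finsupp.prod_fintype _ _ (by simp), wt, character_sum]
  refine Finset.prod_congr rfl fun v _ => ?_
  rw [sum_elim_eq_zpow (fun i => character (B i) c), character_zsmul, zpow_mul, zpow_natCast]

theorem coeff_torusAct (B : Matrix ι (Fin m) ℤ) (c : Fin m → ℂˣ) (p : MvPolynomial (ι ⊕ ι) ℂ)
    (s : ι ⊕ ι →₀ ℕ) : (torusAct B c p).coeff s = (character (wt B s) c : ℂ) * p.coeff s := by
  rw [torusAct, coeff_scale, prod_eq_character]

/-- The monomial with exponents `s` is invariant under `H`. -/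
def IsInv (B : Matrix ι (Fin m) ℤ) (H : Subgroup (Fin m → ℂˣ)) (s : ι ⊕ ι →₀ ℕ) : Prop :=
  ∀ c ∈ H, character (wt B s) c = 1

variable {B : Matrix ι (Fin m) ℤ} {H : Subgroup (Fin m → ℂˣ)} {s t : ι ⊕ ι →₀ ℕ}

/-- The torus acts diagonally in the basis of monomials, so invariance may be tested on each
monomial separately. -/
theorem mem_invariants_iff {p : MvPolynomial (ι ⊕ ι) ℂ} :
    p ∈ invariants B H ↔ ∀ s ∈ p.support, IsInv B H s := by
  constructor
  · intro hp s hs c hc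
    have h1 := congrArg (MvPolynomial.coeff s) (hp c hc)
    rw [coeff_torusAct] at h1
    have h2 := mul_right_cancel₀ (MvPolynomial.mem_support_iff.1 hs) (h1.trans (one_mul _).symm)
    exact Units.val_eq_one.1 h2
  · intro h c hc
    ext s
    rw [coeff_torusAct]
    by_cases hs : p.coeff s = 0
    · rw [hs, mul_zero]
    · rw [h s (MvPolynomial.mem_support_iff.2 hs) c hc, Units.val_one, one_mul]

theorem IsInv.monomial_mem (hs : IsInv B H s) (a : ℂ) :
    MvPolynomial.monomial s a ∈ invariants B H :=
  mem_invariants_iff.2 fun t ht => by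
    classical
    rw [MvPolynomial.mem_support_iff, MvPolynomial.coeff_monomial] at ht
    split_ifs at ht with h
    · exact h ▸ hs
    · exact absurd rfl ht

theorem isInv_zero : IsInv B H 0 := fun c _ => by rw [wt_zero, character_zero]

theorem IsInv.add_iff (hs : IsInv B H s) : IsInv B H (s + t) ↔ IsInv B H t := by
  refine forall₂_congr fun c hc => ?_
  rw [wt_add, character_add, hs c hc, one_mul]

theorem IsInv.of_wt_eq_zero (hs : wt B s = 0) : IsInv B H s := fun c _ => by
  rw [hs, character_zero]

theorem isInv_top_iff : IsInv B ⊤ s ↔ wt B s = 0 :=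
  ⟨fun h => character_eq_zero fun c => h c trivial, IsInv.of_wt_eq_zero⟩

open scoped Classical in
/-- The class in the reduction of an invariant monomial, and `0` for monomials that are not
invariant. -/
def redMon (B : Matrix ι (Fin m) ℤ) (H : Subgroup (Fin m → ℂˣ)) (s : ι ⊕ ι →₀ ℕ) : Red B H :=
  if h : IsInv B H s then
    Ideal.Quotient.mkₐ ℂ (redIdeal B H) ⟨MvPolynomial.monomial s 1, h.monomial_mem 1⟩ else 0

theorem redMon_of_isInv (h : IsInv B H s) : redMon B H s =
    Ideal.Quotient.mkₐ ℂ (redIdeal B H) ⟨MvPolynomial.monomial s 1, h.monomial_mem 1⟩ :=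
  dif_pos h

theorem redMon_of_not (h : ¬ IsInv B H s) : redMon B H s = 0 :=
  dif_neg h

/-- Invariance of one factor suffices: the product is then invariant exactly when the other factor
is, and otherwise both sides are zero by convention. -/
theorem IsInv.redMon_add (hs : IsInv B H s) (t : ι ⊕ ι →₀ ℕ) :
    redMon B H (s + t) = redMon B H s * redMon B H t := by
  by_cases ht : IsInv B H t
  · rw [redMon_of_isInv hs, redMon_of_isInv ht, redMon_of_isInv (hs.add_iff.2 ht), ← map_mul]
    congr 1
    exact Subtype.ext (by simp [MvPolynomial.monomial_mul])
  · rw [redMon_of_not ht, redMon_of_not (mt hs.add_iff.1 ht), mul_zero]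

theorem redMon_zero : redMon B H 0 = 1 := by
  rw [redMon_of_isInv isInv_zero, ← map_one (Ideal.Quotient.mkₐ ℂ (redIdeal B H))]
  congr 1

theorem IsInv.redMon_nsmul (hs : IsInv B H s) (n : ℕ) :
    redMon B H (n • s) = redMon B H s ^ n := by
  induction n with
  | zero => rw [zero_nsmul, redMon_zero, pow_zero]
  | succ n ih => rw [succ_nsmul', hs.redMon_add, ih, pow_succ']

/-- Invariant polynomials are combinations of invariant monomials. -/
theorem invariants_induction {P : invariants B H → Prop}
    (mon : ∀ s (h : IsInv B H s) (a : ℂ), P ⟨MvPolynomial.monomial s a, h.monomial_mem a⟩)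
    (add : ∀ p q, P p → P q → P (p + q)) (p : invariants B H) : P p := by
  classical
  have key : ∀ S : Finset (ι ⊕ ι →₀ ℕ), (∀ s ∈ S, IsInv B H s) → ∀ f : (ι ⊕ ι →₀ ℕ) → ℂ,
      ∃ h, P ⟨∑ s ∈ S, MvPolynomial.monomial s (f s), h⟩ := by
    intro S hS f
    induction S using Finset.induction_on with
    | empty =>
      refine ⟨by simp, ?_⟩
      have := mon 0 isInv_zero 0
      simpa using this
    | insert a S ha ih =>
      obtain ⟨h, hP⟩ := ih fun s hs => hS s (Finset.mem_insert_of_mem hs)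
      have ha' := hS a (Finset.mem_insert_self _ _)
      refine ⟨?_, ?_⟩
      · rw [Finset.sum_insert ha]
        exact add_mem (ha'.monomial_mem _) h
      · have := add _ _ (mon a ha' (f a)) hP
        convert this using 1
        exact Subtype.ext (by simp [Finset.sum_insert ha])
  obtain ⟨h, hP⟩ := key p.1.support (mem_invariants_iff.1 p.2) p.1.coeff
  convert hP using 1
  exact Subtype.ext (MvPolynomial.as_sum p.1)

theorem red_induction {P : Red B H → Prop} (mon : ∀ s, IsInv B H s → ∀ a : ℂ, P (a • redMon B H s))
    (add : ∀ p q, P p → P q → P (p + q)) (p : Red B H) : P p := by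
  obtain ⟨q, rfl⟩ := Ideal.Quotient.mkₐ_surjective ℂ (redIdeal B H) p
  refine invariants_induction (P := fun q => P (Ideal.Quotient.mkₐ ℂ (redIdeal B H) q))
    (fun s h a => ?_) (fun p q hp hq => ?_) q
  · have := mon s h a
    rw [redMon_of_isInv h, ← map_smul] at this
    convert this using 2
    exact Subtype.ext (by simp [MvPolynomial.smul_monomial])
  · rw [map_add]
    exact add _ _ hp hq

theorem vertex_mk (p : invariants B H) :
    (vertex B H).val (Ideal.Quotient.mkₐ ℂ (redIdeal B H) p) =
      MvPolynomial.constantCoeff (p : MvPolynomial (ι ⊕ ι) ℂ) := by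
  rw [← MvPolynomial.eval_zero, ← MvPolynomial.coe_aeval_eq_eval]
  rfl

theorem vertex_redMon (hs : s ≠ 0) : (vertex B H).val (redMon B H s) = 0 := by
  classical
  by_cases h : IsInv B H s
  · rw [redMon_of_isInv h, vertex_mk]
    simp [MvPolynomial.constantCoeff_monomial, hs]
  · rw [redMon_of_not h, map_zero]

/-- The maximal ideal of the vertex is spanned by the nonconstant invariant monomials. -/
theorem sub_vertex_mem_span (p : Red B H) :
    p - algebraMap ℂ _ ((vertex B H).val p) ∈
      Submodule.span ℂ {q | ∃ s, s ≠ 0 ∧ IsInv B H s ∧ q = redMon B H s} := by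
  refine red_induction (P := fun p => p - algebraMap ℂ _ ((vertex B H).val p) ∈
      Submodule.span ℂ {q | ∃ s, s ≠ 0 ∧ IsInv B H s ∧ q = redMon B H s})
    (fun s hs a => ?_) (fun p q hp hq => ?_) p
  · by_cases h0 : s = 0
    · rw [h0, redMon_zero, map_smul, map_one, Algebra.algebraMap_eq_smul_one, smul_eq_mul, mul_one,
        sub_self]
      exact zero_mem _
    · rw [map_smul, vertex_redMon h0, smul_zero, map_zero, sub_zero]
      exact Submodule.smul_mem _ _ (Submodule.subset_span ⟨s, h0, hs, rfl⟩)
  · have := add_mem hp hq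
    convert this using 1
    rw [map_add, map_add]
    ring

/-- By Dickson's lemma, the nonzero exponents of invariant monomials have finitely many minimal
elements. -/
theorem fg_ker_vertex : (RingHom.ker (vertex B H).val).FG := by
  classical
  let T : Set (ι ⊕ ι →₀ ℕ) := {s | s ≠ 0 ∧ IsInv B H s}
  let M : Set (ι ⊕ ι →₀ ℕ) := {s | Minimal (· ∈ T) s}
  have hpwo : T.IsPWO := Set.isPWO_of_wellQuasiOrderedLE T
  have hM : M.Finite := (setOfPred_minimal_antichain _).finite_of_partiallyWellOrderedOn
    (hpwo.mono fun s hs => hs.prop)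
  refine ⟨hM.toFinset.image (redMon B H), le_antisymm ?_ ?_⟩
  · rw [Submodule.span_le]
    intro q hq
    simp only [Finset.coe_image, Set.Finite.coe_toFinset] at hq
    obtain ⟨s, hs, rfl⟩ := hq
    exact (RingHom.mem_ker).2 (vertex_redMon hs.prop.1)
  · intro p hp
    have h1 := sub_vertex_mem_span p
    rw [(RingHom.mem_ker).1 hp, map_zero, sub_zero] at h1
    refine (Submodule.span_le (p := (Submodule.span (Red B H)
      (hM.toFinset.image (redMon B H) : Set (Red B H))).restrictScalars ℂ)).2 ?_ h1
    rintro q ⟨s, hs0, hs, rfl⟩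
    obtain ⟨t, hts, ht⟩ := hpwo.exists_le_minimal (⟨hs0, hs⟩ : s ∈ T)
    obtain ⟨r, rfl⟩ := exists_add_of_le hts
    -- The complementary factor of an invariant monomial in an invariant monomial is again
    -- invariant.
    rw [add_comm, (ht.prop.2.add_iff.1 hs).redMon_add]
    have hmem : redMon B H t ∈ Ideal.span (hM.toFinset.image (redMon B H) : Set (Red B H)) :=
      Ideal.subset_span (by
        simp only [Finset.coe_image, Set.Finite.coe_toFinset]
        exact ⟨t, ht, rfl⟩)
    exact Ideal.mul_mem_left _ (redMon B H r) hmem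

/-- If no coordinate is invariant, the Poisson bracket vanishes at the vertex. -/
theorem vertex_redBracket (h : ∀ v : ι ⊕ ι, ¬ IsInv B H (Finsupp.single v 1)) (p q : Red B H) :
    (vertex B H).val (redBracket B H p q) = 0 := by
  obtain ⟨p, rfl⟩ := Ideal.Quotient.mkₐ_surjective ℂ (redIdeal B H) p
  obtain ⟨q, rfl⟩ := Ideal.Quotient.mkₐ_surjective ℂ (redIdeal B H) q
  rw [redBracket, quotBracket_mk, vertex_mk, subBracket_apply]
  generalize polyBracket ι p = D
  refine invariants_induction (P := fun q => MvPolynomial.constantCoeff (D q) = 0)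
    (fun s hs a => ?_) (fun p q hp hq => ?_) q
  · by_cases h0 : s = 0
    · subst h0
      simp
    · obtain ⟨v, hv⟩ := Finsupp.ne_iff.1 h0
      have hle : Finsupp.single v 1 ≤ s := by
        simpa [Finsupp.single_le_iff] using Nat.one_le_iff_ne_zero.2 hv
      obtain ⟨t, rfl⟩ := exists_add_of_le hle
      -- As no coordinate is invariant, a nonconstant invariant monomial has degree at least two, so
      -- its derivatives vanish at the origin.
      have ht : t ≠ 0 := by
        rintro rfl
        exact h v (by simpa using hs)
      have h1 : MvPolynomial.monomial (Finsupp.single v 1 + t) a =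
          MvPolynomial.X v * MvPolynomial.monomial t a := by
        rw [MvPolynomial.X, MvPolynomial.monomial_mul, one_mul]
      have h2 : MvPolynomial.constantCoeff (MvPolynomial.monomial t a) = 0 := by
        classical rw [MvPolynomial.constantCoeff_monomial, if_neg ht]
      simp only [h1, Derivation.leibniz, smul_eq_mul, map_add, map_mul,
        MvPolynomial.constantCoeff_X, h2, zero_mul, add_zero]
  · simp [hp, hq]

/-! ### The Reynolds operator -/

open scoped Classical in
/-- The projection onto the span of the invariant monomials. -/
def reynolds (B : Matrix ι (Fin m) ℤ) (H : Subgroup (Fin m → ℂˣ)) :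
    MvPolynomial (ι ⊕ ι) ℂ →ₗ[ℂ] MvPolynomial (ι ⊕ ι) ℂ :=
  (MvPolynomial.basisMonomials (ι ⊕ ι) ℂ).constr ℂ fun s =>
    if IsInv B H s then MvPolynomial.monomial s 1 else 0

open scoped Classical in
theorem reynolds_monomial (s : ι ⊕ ι →₀ ℕ) (a : ℂ) : reynolds B H (MvPolynomial.monomial s a) =
    if IsInv B H s then MvPolynomial.monomial s a else 0 := by
  have h1 : MvPolynomial.monomial s a = a • MvPolynomial.basisMonomials (ι ⊕ ι) ℂ s := by
    simp [MvPolynomial.smul_monomial]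
  rw [h1, map_smul, reynolds, Module.Basis.constr_basis]
  split_ifs <;> simp [MvPolynomial.smul_monomial]

theorem reynolds_mem (p : MvPolynomial (ι ⊕ ι) ℂ) : reynolds B H p ∈ invariants B H := by
  classical
  induction p using MvPolynomial.induction_on' with
  | add p p' hp hp' => rw [map_add]; exact add_mem hp hp'
  | monomial s a =>
    rw [reynolds_monomial]
    split_ifs with h
    · exact h.monomial_mem a
    · exact zero_mem _

/-- Multiplication by an invariant monomial neither creates nor destroys invariance. -/
theorem reynolds_mul (p : MvPolynomial (ι ⊕ ι) ℂ) {q : MvPolynomial (ι ⊕ ι) ℂ}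
    (hq : q ∈ invariants B H) : reynolds B H (p * q) = reynolds B H p * q := by
  classical
  induction p using MvPolynomial.induction_on' with
  | add p p' hp hp' => rw [add_mul, map_add, map_add, add_mul, hp, hp']
  | monomial s a =>
    rw [q.as_sum, Finset.mul_sum, Finset.mul_sum, map_sum]
    refine Finset.sum_congr rfl fun t ht => ?_
    have ht := mem_invariants_iff.1 hq t ht
    rw [MvPolynomial.monomial_mul, reynolds_monomial, reynolds_monomial, add_comm s t]
    simp only [ht.add_iff]
    split_ifs
    · rw [MvPolynomial.monomial_mul, add_comm]
    · rw [zero_mul]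

theorem reynolds_of_mem {q : MvPolynomial (ι ⊕ ι) ℂ} (hq : q ∈ invariants B H) :
    reynolds B H q = q := by
  classical
  have h1 : reynolds B H (1 : MvPolynomial (ι ⊕ ι) ℂ) = 1 := by
    have := reynolds_monomial (B := B) (H := H) 0 1
    rwa [if_pos isInv_zero] at this
  rw [← one_mul q, reynolds_mul _ hq, h1]

theorem moment_eq_sum_monomial (B : Matrix ι (Fin m) ℤ) (ξ : Fin m → ℂ) :
    moment B ξ = ∑ i, MvPolynomial.monomial
      (Finsupp.single (Sum.inl i) 1 + Finsupp.single (Sum.inr i) 1) (∑ j, (B i j : ℂ) * ξ j) := by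
  refine Finset.sum_congr rfl fun i _ => ?_
  rw [MvPolynomial.X, MvPolynomial.X, MvPolynomial.monomial_mul, MvPolynomial.smul_monomial]
  simp

theorem wt_pair (B : Matrix ι (Fin m) ℤ) (i : ι) :
    wt B (Finsupp.single (Sum.inl i) 1 + Finsupp.single (Sum.inr i) 1) = 0 := by
  rw [wt_add, wt_single, wt_single]
  simp

theorem moment_mem_invariants (ξ : Fin m → ℂ) : moment B ξ ∈ invariants B H := by
  rw [moment_eq_sum_monomial]
  exact sum_mem fun i _ => (IsInv.of_wt_eq_zero (wt_pair B i)).monomial_mem _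

/-- The moment components are themselves invariant, so applying the Reynolds operator to a
combination of them replaces its coefficients by invariant ones. Homomorphisms from the reduction
can therefore be checked on these generators. -/
theorem redIdeal_eq_span : redIdeal B H =
    Ideal.span {q | ∃ ξ ∈ lieAlg H, q = ⟨moment B ξ, moment_mem_invariants ξ⟩} := by
  apply le_antisymm
  · intro q hq
    -- The extra factor `r` is what lets the induction pass through multiplication by arbitrary
    -- polynomials.
    have key : ∀ p ∈ momentIdeal B H, ∀ r,
        (⟨reynolds B H (r * p), reynolds_mem _⟩ : invariants B H) ∈
        Ideal.span {q | ∃ ξ ∈ lieAlg H, q = ⟨moment B ξ, moment_mem_invariants ξ⟩} := by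
      intro p hp
      induction hp using Submodule.span_induction with
      | mem p hp =>
        obtain ⟨ξ, hξ, rfl⟩ := hp
        intro r
        have h1 : (⟨reynolds B H (r * moment B ξ), reynolds_mem _⟩ : invariants B H) =
            ⟨reynolds B H r, reynolds_mem _⟩ * ⟨moment B ξ, moment_mem_invariants ξ⟩ :=
          Subtype.ext (reynolds_mul r (moment_mem_invariants ξ))
        rw [h1]
        exact Ideal.mul_mem_left _ _ (Ideal.subset_span ⟨ξ, hξ, rfl⟩)
      | zero =>
        intro r
        convert Ideal.zero_mem _ using 1
        exact Subtype.ext (by simp)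
      | add p p' _ _ h h' =>
        intro r
        convert add_mem (h r) (h' r) using 1
        exact Subtype.ext (by simp [mul_add])
      | smul a p _ h =>
        intro r
        convert h (r * a) using 1
        exact Subtype.ext (by simp [mul_assoc])
    convert key q hq 1 using 1
    refine Subtype.ext ?_
    change q.1 = reynolds B H (1 * q.1)
    rw [one_mul, reynolds_of_mem q.2]
  · rw [Ideal.span_le]
    rintro _ ⟨ξ, hξ, rfl⟩
    exact Ideal.subset_span ⟨ξ, hξ, rfl⟩

end Weights

/-! ### Bases of weights -/

section Basis

variable {n m : ℕ}

/-- The rows of `B` with indices in `I ∪ J` form a basis of the character lattice, and `c k i` are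
the coordinates of the row `k`. -/
structure WeightBasis (B : Matrix (Fin n) (Fin m) ℤ) (I J : Finset (Fin n))
    (c : Fin n → Fin n → ℤ) : Prop where
  disj : Disjoint I J
  row : ∀ k, B k = ∑ i ∈ I ∪ J, c k i • B i
  delta : ∀ i ∈ I ∪ J, ∀ k ∈ I ∪ J, c k i = if k = i then 1 else 0
  coord : ∀ χ : Fin m → ℤ, ∃ d : Fin n → ℤ, χ = ∑ i ∈ I ∪ J, d i • B i
  torus : ∀ t : Fin n → ℂˣ, ∃ τ, ∀ i ∈ I ∪ J, character (B i) τ = t i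
  dual : ∀ i ∈ I ∪ J, ∃ ξ : Fin m → ℤ, ∀ k, ∑ j, B k j * ξ j = c k i

theorem zpow_sum {κ : Type} (x : ℂˣ) (s : Finset κ) (f : κ → ℤ) :
    x ^ (∑ i ∈ s, f i) = ∏ i ∈ s, x ^ f i := by
  classical
  induction s using Finset.induction_on with
  | empty => simp
  | insert a s ha ih => rw [Finset.sum_insert ha, Finset.prod_insert ha, zpow_add, ih]

/-- The chosen rows form a matrix `M` invertible over the integers. Coordinates are the entries of
`B M⁻¹`, the dual cocharacters are the columns of `M⁻¹`, and torus elements with prescribed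
character values have the entries of `M⁻¹` as exponents. -/
theorem exists_weightBasis_of_equiv (B : Matrix (Fin n) (Fin m) ℤ) (K : Finset (Fin n))
    (κ : Fin m ≃ K) (hdet : IsUnit (B.submatrix (fun l => (κ l : Fin n)) id).det) :
    ∃ c, ∀ I J, Disjoint I J → I ∪ J = K → WeightBasis B I J c := by
  classical
  set M := B.submatrix (fun l => (κ l : Fin n)) id with hM
  have hMU : M * M⁻¹ = 1 := Matrix.mul_nonsing_inv M hdet
  have hUM : M⁻¹ * M = 1 := Matrix.nonsing_inv_mul M hdet
  set U := M⁻¹ with hU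
  have hsum : ∀ (V : Type) [AddCommMonoid V] (g : Fin n → V),
      ∑ i ∈ K, g i = ∑ l, g (κ l) := fun V _ g => by
    rw [← Finset.sum_coe_sort K, ← κ.sum_comp]
  let c : Fin n → Fin n → ℤ := fun k i =>
    if h : i ∈ K then ∑ j, B k j * U j (κ.symm ⟨i, h⟩) else 0
  have hc : ∀ k l, c k (κ l) = (B * U) k l := fun k l => by
    simp [c, Matrix.mul_apply]
  have hMB : ∀ l l', M l l' = B (κ l) l' := fun l l' => rfl
  refine ⟨c, fun I J hIJ hK => ⟨hIJ, fun k => ?_, ?_, fun χ => ?_, fun t => ?_, ?_⟩⟩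
  · rw [hK, hsum]
    ext j
    have h1 : B k j = (B * U * M) k j := by rw [Matrix.mul_assoc, hUM, Matrix.mul_one]
    rw [h1, Matrix.mul_apply]
    simp [hc, hMB]
  · rw [hK]
    intro i hi k hk
    obtain ⟨l, hl⟩ := κ.surjective ⟨i, hi⟩
    obtain ⟨l', hl'⟩ := κ.surjective ⟨k, hk⟩
    have h1 : c (κ l') (κ l) = (M * U) l' l := by
      rw [hc, Matrix.mul_apply, Matrix.mul_apply]
      rfl
    rw [hl, hl', hMU, Matrix.one_apply] at h1
    rw [h1]
    congr 1
    rw [← κ.injective.eq_iff, hl, hl', Subtype.mk.injEq]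
  · refine ⟨fun i => if h : i ∈ K then ∑ j, χ j * U j (κ.symm ⟨i, h⟩) else 0, ?_⟩
    rw [hK, hsum]
    ext j
    have h1 : χ j = Matrix.vecMul (Matrix.vecMul χ U) M j := by
      rw [Matrix.vecMul_vecMul, hUM, Matrix.vecMul_one]
    rw [h1]
    simp [Matrix.vecMul, dotProduct, hMB]
  · refine ⟨fun j => ∏ l, t (κ l) ^ U j l, ?_⟩
    rw [hK]
    intro i hi
    obtain ⟨l', hl'⟩ := κ.surjective ⟨i, hi⟩
    have hi' : i = κ l' := by rw [hl']
    rw [hi']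
    have h1 : character (B (κ l')) (fun j => ∏ l, t (κ l) ^ U j l) =
        ∏ l, t (κ l) ^ ((M * U) l' l) := by
      simp only [character, MonoidHom.coe_mk, OneHom.coe_mk, ← Finset.prod_zpow, ← zpow_mul,
        Matrix.mul_apply, zpow_sum]
      rw [Finset.prod_comm]
      simp only [hMB, mul_comm]
    rw [h1, hMU, Finset.prod_eq_single l']
    · simp
    · intro l _ hl
      simp [Matrix.one_apply_ne hl.symm]
    · simp
  · rw [hK]
    intro i hi
    refine ⟨fun j => U j (κ.symm ⟨i, hi⟩), fun k => ?_⟩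
    simp [c, hi]

/-- A row of `B` as a rational vector. -/
def rowQ (B : Matrix (Fin n) (Fin m) ℤ) (k : Fin n) : Fin m → ℚ := fun j => B k j

/-- A rational linear form killing all rows gives, after clearing denominators, a cocharacter acting
trivially; its value at `2` is then `1` by faithfulness, so the form is zero. -/
theorem span_rowQ (B : Matrix (Fin n) (Fin m) ℤ) (hB : IsFaithful B) :
    Submodule.span ℚ (Set.range (rowQ B)) = ⊤ := by
  classical
  by_contra hne
  obtain ⟨φ, hφ, hle⟩ := Submodule.exists_le_ker_of_lt_top _ (lt_top_iff_ne_top.2 hne)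
  obtain ⟨N, hN⟩ := IsLocalization.exist_integer_multiples (nonZeroDivisors ℤ) Finset.univ
    fun j : Fin m => φ (Pi.single j 1)
  choose! lam hlam using fun j => hN j (Finset.mem_univ _)
  have hlam' : ∀ j, (lam j : ℚ) = (N : ℤ) * φ (Pi.single j 1) := fun j => by
    have := hlam j
    simpa [Algebra.smul_def] using this
  have hφv : ∀ v, φ v = ∑ j, v j * φ (Pi.single j 1) := fun v => by
    conv_lhs => rw [pi_eq_sum_univ' v]
    simp [map_sum]
  have hrel : ∀ k, ∑ j, B k j * lam j = 0 := fun k => by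
    have h1 : φ (rowQ B k) = 0 := hle (Submodule.subset_span ⟨k, rfl⟩)
    rw [hφv] at h1
    have h2 : ((∑ j, B k j * lam j : ℤ) : ℚ) = (N : ℤ) * ∑ j, rowQ B k j * φ (Pi.single j 1) := by
      push_cast
      rw [Finset.mul_sum]
      refine Finset.sum_congr rfl fun j _ => ?_
      rw [hlam', rowQ]
      ring
    rw [h1, mul_zero] at h2
    exact_mod_cast h2
  have h2 : (2 : ℂ) ≠ 0 := two_ne_zero
  have h1 := hB (fun j => Units.mk0 2 h2 ^ lam j) fun k => by
    simp only [character, MonoidHom.coe_mk, OneHom.coe_mk, ← zpow_mul]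
    rw [← zpow_sum, Finset.sum_congr rfl fun j _ => mul_comm (lam j) (B k j), hrel, zpow_zero]
  have hlam0 : ∀ j, lam j = 0 := fun j => by
    have h3 := congrArg (fun u : ℂˣ => ‖(u : ℂ)‖) (congrFun h1 j)
    simp only [Units.val_zpow_eq_zpow_val, Units.val_mk0, norm_zpow, Complex.norm_ofNat,
      Pi.one_apply, Units.val_one, norm_one] at h3
    exact (zpow_eq_one_iff_right₀ (by norm_num) (by norm_num)).1 h3
  refine hφ (LinearMap.ext fun v => ?_)
  rw [hφv, LinearMap.zero_apply]
  refine Finset.sum_eq_zero fun j _ => ?_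
  have h4 := hlam' j
  rw [hlam0, Int.cast_zero, eq_comm, mul_eq_zero] at h4
  have hN0 : ((N : ℤ) : ℚ) ≠ 0 := Int.cast_ne_zero.2 (nonZeroDivisors.coe_ne_zero N)
  rw [h4.resolve_left hN0, mul_zero]

/-- The indices of the rows in the rational span of the rows with indices in `D`. -/
def hull (B : Matrix (Fin n) (Fin m) ℤ) (D : Set (Fin n)) : Set (Fin n) :=
  {k | rowQ B k ∈ Submodule.span ℚ (rowQ B '' D)}

theorem mem_hull {B : Matrix (Fin n) (Fin m) ℤ} {D : Set (Fin n)} {k : Fin n} :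
    k ∈ hull B D ↔ rowQ B k ∈ Submodule.span ℚ (rowQ B '' D) := Iff.rfl

theorem subset_hull (B : Matrix (Fin n) (Fin m) ℤ) (D : Set (Fin n)) : D ⊆ hull B D :=
  fun k hk => Submodule.subset_span ⟨k, hk, rfl⟩

theorem hull_subset_hull {B : Matrix (Fin n) (Fin m) ℤ} {D D' : Set (Fin n)} (h : D ⊆ hull B D') :
    hull B D ⊆ hull B D' := fun _ hk =>
  mem_hull.2 (Submodule.span_le.2 (by rintro _ ⟨i, hi, rfl⟩; exact mem_hull.1 (h hi))
    (mem_hull.1 hk))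

/-- A maximal independent set of rows in `D` is extended to a rational basis; by unimodularity its
determinant is `±1`, so it is a basis of the lattice. -/
theorem exists_weightBasis (B : Matrix (Fin n) (Fin m) ℤ) (hB : IsFaithful B)
    (hu : IsUnimodular B) (D : Set (Fin n)) :
    ∃ I J c, WeightBasis B I J c ∧ (∀ i ∈ I, i ∈ D) ∧ ∀ k ∈ D, ∀ j ∈ J, c k j = 0 := by
  classical
  obtain ⟨I, hID, -, hIspan, hIli⟩ := exists_linearIndepOn_extension
    (linearIndepOn_empty ℚ (rowQ B)) (Set.empty_subset D)
  obtain ⟨K, -, hIK, hKspan, hKli⟩ := exists_linearIndepOn_extension hIli (Set.subset_univ I)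
  have htop : ⊤ ≤ Submodule.span ℚ (Set.range fun k : K => rowQ B k) := by
    rw [← span_rowQ B hB, Submodule.span_le, ← Set.image_univ]
    refine hKspan.trans ?_
    rw [Set.image_eq_range]
  let b : Module.Basis K ℚ (Fin m → ℚ) := Module.Basis.mk hKli htop
  have hcard : Fintype.card K.toFinset = m := by
    have := Module.finrank_eq_card_basis b
    rw [Module.finrank_fin_fun] at this
    simp [this]
  let κ : Fin m ≃ K.toFinset := (Fintype.equivFinOfCardEq hcard).symm
  have hdet : IsUnit (B.submatrix (fun l => (κ l : Fin n)) id).det := by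
    have hne : (B.submatrix (fun l => (κ l : Fin n)) id).det ≠ 0 := by
      let e : Fin m ≃ K := κ.trans (Equiv.subtypeEquivRight fun x => by simp)
      have hli : LinearIndependent ℚ
          (((B.submatrix (fun l => (κ l : Fin n)) id).map ((↑) : ℤ → ℚ)).row) := by
        have := hKli.comp e e.injective
        exact this
      rw [Matrix.linearIndependent_rows_iff_isUnit, Matrix.isUnit_iff_isUnit_det,
        isUnit_iff_ne_zero] at hli
      intro h0
      apply hli
      have := congrArg (Int.castRingHom ℚ) h0
      rw [RingHom.map_det, map_zero] at this
      exact this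
    rcases hu fun l => (κ l : Fin n) with h | h | h
    · exact absurd h hne
    · rw [h]; exact isUnit_one
    · rw [h]; exact isUnit_one.neg
  obtain ⟨c, hc⟩ := exists_weightBasis_of_equiv B K.toFinset κ hdet
  have hIK' : I.toFinset ⊆ K.toFinset := by simpa using hIK
  have hwb := hc I.toFinset (K.toFinset \ I.toFinset) Finset.disjoint_sdiff
    (Finset.union_sdiff_of_subset hIK')
  refine ⟨_, _, c, hwb, fun i hi => hID (Set.mem_toFinset.1 hi), fun k hk j hj => ?_⟩
  obtain ⟨ξ, hξ⟩ := hwb.dual j (Finset.mem_union_right _ hj)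
  let φ : (Fin m → ℚ) →ₗ[ℚ] ℚ := Fintype.linearCombination ℚ fun j => (ξ j : ℚ)
  have hφ : ∀ k, φ (rowQ B k) = c k j := fun k => by
    rw [← hξ k]
    simp [φ, Fintype.linearCombination_apply, rowQ]
  -- The cocharacter dual to `j` kills the rows in `I`, and these span the rows in `D`.
  have h1 : rowQ B k ∈ LinearMap.ker φ := by
    refine Submodule.span_le.2 ?_ (hIspan ⟨k, hk, rfl⟩)
    rintro _ ⟨i, hi, rfl⟩
    have hi' : i ∈ I.toFinset := Set.mem_toFinset.2 hi
    have hij : i ≠ j := by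
      rintro rfl
      exact (Finset.mem_sdiff.1 hj).2 hi'
    rw [SetLike.mem_coe, LinearMap.mem_ker, hφ, hwb.delta j (Finset.mem_union_right _ hj) i
      (Finset.mem_union_left _ hi'), if_neg hij, Int.cast_zero]
  rw [LinearMap.mem_ker, hφ] at h1
  exact_mod_cast h1

/-! ### Flats and relations in terms of a basis of weights -/

namespace WeightBasis

variable {B : Matrix (Fin n) (Fin m) ℤ} {I J : Finset (Fin n)} {c : Fin n → Fin n → ℤ}

theorem mem_hull_iff (hb : WeightBasis B I J c) {D : Set (Fin n)} (hI : ∀ i ∈ I, i ∈ D)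
    (hD : ∀ k ∈ D, ∀ j ∈ J, c k j = 0) {k : Fin n} : k ∈ hull B D ↔ ∀ j ∈ J, c k j = 0 := by
  constructor
  · intro hk j hj
    obtain ⟨ξ, hξ⟩ := hb.dual j (Finset.mem_union_right _ hj)
    let φ : (Fin m → ℚ) →ₗ[ℚ] ℚ := Fintype.linearCombination ℚ fun j => (ξ j : ℚ)
    have hφ : ∀ k, φ (rowQ B k) = c k j := fun k => by
      rw [← hξ k]
      simp [φ, Fintype.linearCombination_apply, rowQ]
    have h1 : rowQ B k ∈ LinearMap.ker φ := by
      refine Submodule.span_le.2 ?_ (mem_hull.1 hk)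
      rintro _ ⟨i, hi, rfl⟩
      rw [SetLike.mem_coe, LinearMap.mem_ker, hφ, hD i hi j hj, Int.cast_zero]
    rw [LinearMap.mem_ker, hφ] at h1
    exact_mod_cast h1
  · intro hk
    have h1 : rowQ B k = ∑ i ∈ I, (c k i : ℚ) • rowQ B i := by
      ext l
      have h2 := congrFun (hb.row k) l
      rw [Finset.sum_union hb.disj, Finset.sum_eq_zero (s := J) fun j hj => by rw [hk j hj, zero_smul],
        add_zero] at h2
      simp only [rowQ, h2, Finset.sum_apply, Pi.smul_apply, smul_eq_mul]
      push_cast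
      rfl
    rw [mem_hull, h1]
    exact Submodule.sum_mem _ fun i hi =>
      Submodule.smul_mem _ _ (Submodule.subset_span ⟨i, hI i hi, rfl⟩)

theorem coord_eq (hb : WeightBasis B I J c) {d d' : Fin n → ℤ}
    (h : ∑ k, d k • B k = ∑ k, d' k • B k) {i : Fin n} (hi : i ∈ I ∪ J) :
    ∑ k, d k * c k i = ∑ k, d' k * c k i := by
  obtain ⟨ξ, hξ⟩ := hb.dual i hi
  have key : ∀ d : Fin n → ℤ, ∑ k, d k * c k i = ∑ j, (∑ k, d k • B k) j * ξ j := fun d => by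
    simp only [← hξ, Finset.sum_apply, Pi.smul_apply, smul_eq_mul, Finset.sum_mul, Finset.mul_sum]
    rw [Finset.sum_comm]
    simp only [mul_assoc]
  rw [key, key, h]

theorem rel_coord (hb : WeightBasis B I J c) {d : Fin n → ℤ} (h : ∑ k, d k • B k = 0) {i : Fin n}
    (hi : i ∈ I ∪ J) : ∑ k, d k * c k i = 0 := by
  have := hb.coord_eq (d := d) (d' := 0) (by simpa using h) hi
  simpa using this

/-- A generic relation among the rows in `D`. -/
theorem exists_relation (hb : WeightBasis B I J c) {D : Set (Fin n)} (hI : ∀ i ∈ I, i ∈ D)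
    (hD : ∀ k ∈ D, ∀ j ∈ J, c k j = 0) (hcol : ∀ i ∈ I, ∃ k ∈ D, k ∉ I ∧ c k i ≠ 0) :
    ∃ η : Fin n → ℤ, ∑ k, η k • B k = 0 ∧ ∀ k, η k ≠ 0 ↔ k ∈ D := by
  classical
  let D' : Finset (Fin n) := Finset.univ.filter fun k => k ∈ D ∧ k ∉ I
  -- The relation is given the coefficients `q ^ (k + 1)` outside `I` and solved for the
  -- coefficients on `I`. The latter are, up to sign, the values at `q` of these polynomials, whose
  -- terms have distinct degrees, so they are nonzero as soon as one `c k i` is.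
  let p : Fin n → Polynomial ℤ := fun i =>
    ∑ k ∈ D', Polynomial.monomial (k.val + 1) (c k i)
  have hp : ∀ i ∈ I, p i ≠ 0 := fun i hi h0 => by
    obtain ⟨k, hkD, hkI, hk⟩ := hcol i hi
    have h1 := congrArg (fun q => Polynomial.coeff q (k.val + 1)) h0
    simp only [p, Polynomial.finsetSum_coeff, Polynomial.coeff_monomial, Polynomial.coeff_zero]
      at h1
    rw [Finset.sum_eq_single k] at h1
    · exact hk (by simpa using h1)
    · intro l _ hl
      rw [if_neg]
      intro h
      exact hl (Fin.ext (by omega))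
    · intro h
      exact absurd (Finset.mem_filter.2 ⟨Finset.mem_univ _, hkD, hkI⟩) h
  -- The factor `X` ensures that `q` itself is nonzero.
  have hprod : Polynomial.X * ∏ i ∈ I, p i ≠ 0 :=
    mul_ne_zero Polynomial.X_ne_zero (Finset.prod_ne_zero_iff.2 hp)
  obtain ⟨q, hq⟩ : ∃ q : ℤ, Polynomial.eval q (Polynomial.X * ∏ i ∈ I, p i) ≠ 0 := by
    by_contra! h
    exact hprod (Polynomial.funext fun q => by rw [h q, Polynomial.eval_zero])
  rw [Polynomial.eval_mul, Polynomial.eval_X, Polynomial.eval_prod] at hq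
  have hq0 := left_ne_zero_of_mul hq
  have hqI : ∀ i ∈ I, ∑ k ∈ D', q ^ (k.val + 1) * c k i ≠ 0 := fun i hi => by
    have := Finset.prod_ne_zero_iff.1 (right_ne_zero_of_mul hq) i hi
    simpa [p, Polynomial.eval_finsetSum, Polynomial.eval_monomial, mul_comm] using this
  let η : Fin n → ℤ := fun k => if k ∈ I then -∑ l ∈ D', q ^ (l.val + 1) * c l k else
    if k ∈ D then q ^ (k.val + 1) else 0
  refine ⟨η, ?_, fun k => ?_⟩
  · have h1 : ∑ k, η k • B k = ∑ k ∈ I, η k • B k + ∑ k ∈ D', η k • B k := by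
      rw [← Finset.sum_union]
      · symm
        refine Finset.sum_subset (Finset.subset_univ _) fun k _ hk => ?_
        simp only [Finset.mem_union, D', Finset.mem_filter, Finset.mem_univ, true_and, not_or,
          not_and, not_not] at hk
        have hkD : k ∉ D := fun h => hk.1 (hk.2 h)
        simp [η, hk.1, hkD]
      · refine Finset.disjoint_left.2 fun k hk hk' => ?_
        exact (Finset.mem_filter.1 hk').2.2 hk
    have h2 : ∑ k ∈ D', η k • B k = ∑ i ∈ I, (∑ k ∈ D', q ^ (k.val + 1) * c k i) • B i := by
      simp only [Finset.sum_smul]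
      rw [Finset.sum_comm]
      refine Finset.sum_congr rfl fun k hk => ?_
      obtain ⟨-, hkD, hkI⟩ := Finset.mem_filter.1 hk
      rw [hb.row k, Finset.sum_union hb.disj,
        Finset.sum_eq_zero (s := J) fun j hj => by rw [hD k hkD j hj, zero_smul], add_zero,
        Finset.smul_sum]
      refine Finset.sum_congr rfl fun i _ => ?_
      simp [η, hkI, hkD, mul_smul]
    rw [h1, h2, ← Finset.sum_add_distrib]
    refine Finset.sum_eq_zero fun i hi => ?_
    simp [η, hi]
  · by_cases hk : k ∈ I
    · simp only [η, if_pos hk, neg_ne_zero]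
      exact iff_of_true (hqI k hk) (hI k hk)
    · by_cases hkD : k ∈ D
      · simp [η, hk, hkD, hq0]
      · simp [η, hk, hkD]

end WeightBasis

end Basis

/-! ### The monomials that do not vanish at a point of a hypertoric cone -/

section Active

variable {n m : ℕ} {B : Matrix (Fin n) (Fin m) ℤ}

/-- The coordinates that occur in an invariant monomial which does not vanish at `z`. -/
def active (z : Pts (Cone B)) : Set (Fin n ⊕ Fin n) :=
  {v | ∃ s, wt B s = 0 ∧ s v ≠ 0 ∧ z.val (redMon B ⊤ s) ≠ 0}

/-- The indices of the active coordinates. -/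
def activeIdx (z : Pts (Cone B)) : Set (Fin n) := idx '' active z

/-- The flat of indices spanned by the active coordinates; it determines the symplectic leaf. -/
def flat (z : Pts (Cone B)) : Set (Fin n) := hull B (activeIdx z)

theorem val_redMon_add (z : Pts (Cone B)) {s t : Fin n ⊕ Fin n →₀ ℕ} (hs : wt B s = 0) :
    z.val (redMon B ⊤ (s + t)) = z.val (redMon B ⊤ s) * z.val (redMon B ⊤ t) := by
  rw [(IsInv.of_wt_eq_zero hs).redMon_add, map_mul]

/-- The product of one witness for each active coordinate has nonzero value at `z`. -/
theorem exists_full_monomial (z : Pts (Cone B)) :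
    ∃ s, wt B s = 0 ∧ z.val (redMon B ⊤ s) ≠ 0 ∧ ∀ v, s v ≠ 0 ↔ v ∈ active z := by
  classical
  have key : ∀ S : Finset (Fin n ⊕ Fin n), (∀ v ∈ S, v ∈ active z) →
      ∃ s, wt B s = 0 ∧ z.val (redMon B ⊤ s) ≠ 0 ∧ ∀ v ∈ S, s v ≠ 0 := by
    intro S
    induction S using Finset.induction_on with
    | empty => exact fun _ => ⟨0, wt_zero B, by rw [redMon_zero, map_one]; exact one_ne_zero,
        by simp⟩
    | insert a S ha ih =>
      intro hS
      obtain ⟨s, hs, hz, hsS⟩ := ih fun v hv => hS v (Finset.mem_insert_of_mem hv)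
      obtain ⟨t, ht, hta, htz⟩ := hS a (Finset.mem_insert_self _ _)
      refine ⟨s + t, by rw [wt_add, hs, ht, add_zero], ?_, fun v hv => ?_⟩
      · rw [val_redMon_add z hs]
        exact mul_ne_zero hz htz
      · rw [Finsupp.add_apply]
        rcases Finset.mem_insert.1 hv with rfl | hv
        · omega
        · have := hsS v hv
          omega
  obtain ⟨s, hs, hz, hsS⟩ := key (Finset.univ.filter (· ∈ active z)) (by simp)
  exact ⟨s, hs, hz, fun v => ⟨fun h => ⟨s, hs, h, hz⟩, fun h => hsS v (by simpa using h)⟩⟩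

/-- Such a monomial divides a power of the full monomial of `exists_full_monomial`, whose value at
`z` is nonzero. -/
theorem val_redMon_ne_zero (z : Pts (Cone B)) {s : Fin n ⊕ Fin n →₀ ℕ} (hs : wt B s = 0)
    (h : ∀ v, s v ≠ 0 → v ∈ active z) : z.val (redMon B ⊤ s) ≠ 0 := by
  obtain ⟨t, ht, hz, htv⟩ := exists_full_monomial z
  have hle : s ≤ (∑ v, s v) • t := fun v => by
    by_cases hv : s v = 0
    · omega
    · have h1 : 1 ≤ t v := Nat.one_le_iff_ne_zero.2 ((htv v).2 (h v hv))
      have h2 : s v ≤ ∑ v, s v := Finset.single_le_sum (fun _ _ => Nat.zero_le _)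
        (Finset.mem_univ v)
      rw [Finsupp.smul_apply, smul_eq_mul]
      nlinarith
  obtain ⟨r, hr⟩ := exists_add_of_le hle
  intro h0
  have h1 := val_redMon_add z hs (t := r)
  rw [← hr, (IsInv.of_wt_eq_zero ht).redMon_nsmul, map_pow, h0, zero_mul] at h1
  exact pow_ne_zero _ hz h1

/-- The exponents of `x_i y_i`. -/
def pairExp (i : Fin n) : Fin n ⊕ Fin n →₀ ℕ :=
  Finsupp.single (Sum.inl i) 1 + Finsupp.single (Sum.inr i) 1

theorem pairExp_apply (i : Fin n) (v : Fin n ⊕ Fin n) :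
    pairExp i v = if idx v = i then 1 else 0 := by
  classical
  rcases v with k | k <;> simp [pairExp, Finsupp.single_apply, eq_comm]

theorem wt_pairExp (i : Fin n) : wt B (pairExp i) = 0 := wt_pair B i

theorem val_pair_eq_zero (z : Pts (Cone B)) {i : Fin n} (hi : i ∉ activeIdx z) :
    z.val (redMon B ⊤ (pairExp i)) = 0 := by
  by_contra h
  exact hi ⟨Sum.inl i, ⟨pairExp i, wt_pairExp i, by simp [pairExp_apply], h⟩, rfl⟩

theorem mk_moment (H : Subgroup (Fin m → ℂˣ)) {ξ : Fin m → ℂ} (hξ : ξ ∈ lieAlg H) :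
    ∑ i, (∑ j, (B i j : ℂ) * ξ j) • redMon B H (pairExp i) = 0 := by
  have h1 : Ideal.Quotient.mkₐ ℂ (redIdeal B H) ⟨moment B ξ, moment_mem_invariants ξ⟩ = 0 :=
    Ideal.Quotient.eq_zero_iff_mem.2 (Ideal.subset_span ⟨ξ, hξ, rfl⟩)
  rw [← h1]
  simp only [redMon_of_isInv (IsInv.of_wt_eq_zero (wt_pairExp _)), ← map_smul, ← map_sum]
  congr 1
  refine Subtype.ext ?_
  simp [moment_eq_sum_monomial, pairExp, MvPolynomial.smul_monomial]

/-- The moment map relation at a point, in coordinates. -/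
theorem WeightBasis.sum_val_pair {I J : Finset (Fin n)} {c : Fin n → Fin n → ℤ}
    (hb : WeightBasis B I J c) (z : Pts (Cone B)) {i : Fin n} (hi : i ∈ I ∪ J) :
    ∑ k, (c k i : ℂ) * z.val (redMon B ⊤ (pairExp k)) = 0 := by
  obtain ⟨ξ, hξ⟩ := hb.dual i hi
  have h1 := congrArg z.val (mk_moment (B := B) ⊤ (ξ := fun j => (ξ j : ℂ))
    (by rw [lieAlg_top]; trivial))
  rw [map_sum, map_zero] at h1
  rw [← h1]
  refine Finset.sum_congr rfl fun k _ => ?_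
  rw [map_smul, smul_eq_mul, ← hξ k]
  push_cast
  rfl

theorem wt_eq_sum (s : Fin n ⊕ Fin n →₀ ℕ) :
    wt B s = ∑ k, ((s (Sum.inl k) : ℤ) - s (Sum.inr k)) • B k := by
  rw [wt, Fintype.sum_sum_type, ← Finset.sum_add_distrib]
  refine Finset.sum_congr rfl fun k _ => ?_
  ext j
  simp only [idx_inl, idx_inr, sgn_inl, sgn_inr, Pi.add_apply, Pi.smul_apply, smul_eq_mul]
  ring

/-- The moment map excludes coloops among the active indices. -/
theorem WeightBasis.exists_active_ne {I J : Finset (Fin n)} {c : Fin n → Fin n → ℤ}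
    (hb : WeightBasis B I J c) {z : Pts (Cone B)} (hI : ∀ i ∈ I, i ∈ activeIdx z) {i : Fin n}
    (hi : i ∈ I) : ∃ k ∈ activeIdx z, k ∉ I ∧ c k i ≠ 0 := by
  classical
  by_contra! hnot
  have hiK : i ∈ I ∪ J := Finset.mem_union_left _ hi
  have hzero : ∀ k ∈ activeIdx z, k ≠ i → c k i = 0 := fun k hk hki => by
    by_cases hkI : k ∈ I
    · rw [hb.delta i hiK k (Finset.mem_union_left _ hkI), if_neg hki]
    · exact hnot k hk hkI
  have hii : c i i = 1 := by rw [hb.delta i hiK i hiK, if_pos rfl]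
  obtain ⟨s, hs, hz, hsv⟩ := exists_full_monomial z
  have hs0 : ∀ k, k ∉ activeIdx z → s (Sum.inl k) = 0 ∧ s (Sum.inr k) = 0 := fun k hk =>
    ⟨by_contra fun h => hk ⟨_, (hsv _).1 h, rfl⟩, by_contra fun h => hk ⟨_, (hsv _).1 h, rfl⟩⟩
  -- If `i` were a coloop, the weight of the full monomial would have as its component along `B i`
  -- just the difference of the exponents of `x_i` and `y_i`. So these exponents agree, and both
  -- coordinates are active.
  have h1 := hb.rel_coord ((wt_eq_sum s).symm.trans hs) hiK
  rw [Finset.sum_eq_single i] at h1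
  · rw [hii, mul_one, sub_eq_zero] at h1
    have h2 : s (Sum.inl i) = s (Sum.inr i) := by exact_mod_cast h1
    obtain ⟨v, hv, hvi⟩ := hI i hi
    have h3 := (hsv v).2 hv
    have hact : ∀ w, idx w = i → w ∈ active z := fun w hw => (hsv w).1 (by
      rcases v with k | k <;> rcases w with l | l <;> simp only [idx_inl, idx_inr] at hvi hw <;>
        subst hvi <;> subst hw <;> omega)
    have h4 : z.val (redMon B ⊤ (pairExp i)) ≠ 0 :=
      val_redMon_ne_zero z (wt_pairExp i) fun w hw => hact w (by
        rw [pairExp_apply] at hw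
        exact by_contra fun h => hw (if_neg h))
    -- On the other hand the moment component dual to `i` reduces at `z` to `x_i y_i`, which must
    -- vanish.
    have h5 := hb.sum_val_pair z hiK
    rw [Finset.sum_eq_single i] at h5
    · rw [hii, Int.cast_one, one_mul] at h5
      exact h4 h5
    · intro k _ hki
      by_cases hk : k ∈ activeIdx z
      · rw [hzero k hk hki, Int.cast_zero, zero_mul]
      · rw [val_pair_eq_zero z hk, mul_zero]
    · simp
  · intro k _ hki
    by_cases hk : k ∈ activeIdx z
    · rw [hzero k hk hki, mul_zero]
    · rw [(hs0 k hk).1, (hs0 k hk).2]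
      simp
  · simp

/-- The data of a chart: a basis `I ∪ J` of the weights of which `I` spans a flat without coloops,
and a relation `γ` among the weights of the flat that involves all of `I`. -/
structure ChartData (B : Matrix (Fin n) (Fin m) ℤ) where
  I : Finset (Fin n)
  J : Finset (Fin n)
  c : Fin n → Fin n → ℤ
  basis : WeightBasis B I J c
  γ : Fin n → ℤ
  rel : ∑ k, γ k • B k = 0
  flat_of_ne : ∀ k, γ k ≠ 0 → ∀ j ∈ J, c k j = 0
  ne_of_mem : ∀ i ∈ I, γ i ≠ 0
  noncoloop : ∀ i ∈ I, ∃ k, (∀ j ∈ J, c k j = 0) ∧ k ∉ I ∧ c k i ≠ 0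

namespace ChartData

variable (𝒟 : ChartData B)

/-- The flat spanned by `I`. -/
def E : Set (Fin n) := {k | ∀ j ∈ 𝒟.J, 𝒟.c k j = 0}

theorem I_sub_E {i : Fin n} (hi : i ∈ 𝒟.I) : i ∈ 𝒟.E := fun j hj => by
  rw [𝒟.basis.delta j (Finset.mem_union_right _ hj) i (Finset.mem_union_left _ hi), if_neg]
  rintro rfl
  exact Finset.disjoint_left.1 𝒟.basis.disj hi hj

/-- The exponents of the monomial `∏ x_k ^ γ_k`, where `x_k ^ (-1)` is replaced by `y_k`. -/
def mon : Fin n ⊕ Fin n →₀ ℕ :=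
  Finsupp.equivFunOnFinite.symm
    (Sum.elim (fun k => (𝒟.γ k).toNat) (fun k => (-𝒟.γ k).toNat))

theorem mon_inl (k : Fin n) : 𝒟.mon (Sum.inl k) = (𝒟.γ k).toNat := rfl
theorem mon_inr (k : Fin n) : 𝒟.mon (Sum.inr k) = (-𝒟.γ k).toNat := rfl

theorem γ_ne {v : Fin n ⊕ Fin n} (hv : 𝒟.mon v ≠ 0) : 𝒟.γ (idx v) ≠ 0 := by
  rcases v with k | k
  · rw [mon_inl] at hv
    simp only [idx_inl]
    omega
  · rw [mon_inr] at hv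
    simp only [idx_inr]
    omega

theorem wt_mon : wt B 𝒟.mon = 0 := by
  rw [wt_eq_sum, ← 𝒟.rel]
  refine Finset.sum_congr rfl fun k _ => ?_
  congr 1
  rw [mon_inl, mon_inr]
  omega

end ChartData

/-- The exponent `γ = N δ + η` combines the weight relation `δ` of the full monomial, whose signs
point to active coordinates, with a relation `η` that is nonzero at every active index. Where `δ k =
0` and `k` is active, both `x_k` and `y_k` are active, so the sign of `η k` is harmless. -/
theorem exists_chartData (hB : IsFaithful B) (hu : IsUnimodular B) (z : Pts (Cone B)) :
    ∃ 𝒟 : ChartData B, z.val (redMon B ⊤ 𝒟.mon) ≠ 0 ∧ flat z = 𝒟.E := by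
  classical
  obtain ⟨I, J, c, hb, hI, hD⟩ := exists_weightBasis B hB hu (activeIdx z)
  obtain ⟨s, hs, hz, hsv⟩ := exists_full_monomial z
  obtain ⟨η, hη, hηD⟩ := hb.exists_relation hI hD fun i hi => hb.exists_active_ne hI hi
  set δ : Fin n → ℤ := fun k => (s (Sum.inl k) : ℤ) - s (Sum.inr k) with hδ
  -- Larger than every `|η k|`, so that `δ` decides the sign of `γ` wherever it is nonzero and no
  -- cancellation occurs.
  set N : ℤ := 1 + ∑ k, |η k| with hN
  have hNη : ∀ k, |η k| < N := fun k => by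
    have := Finset.single_le_sum (f := fun k => |η k|) (fun _ _ => abs_nonneg _)
      (Finset.mem_univ k)
    omega
  have hs0 : ∀ k, k ∉ activeIdx z → s (Sum.inl k) = 0 ∧ s (Sum.inr k) = 0 := fun k hk =>
    ⟨by_contra fun h => hk ⟨_, (hsv _).1 h, rfl⟩, by_contra fun h => hk ⟨_, (hsv _).1 h, rfl⟩⟩
  have hact : ∀ k, k ∈ activeIdx z → δ k = 0 → s (Sum.inl k) ≠ 0 ∧ s (Sum.inr k) ≠ 0 := by
    rintro k ⟨v, hv, rfl⟩ h0
    have h1 := (hsv v).2 hv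
    rcases v with k | k <;> simp only [hδ, idx_inl, idx_inr] at h0 ⊢ <;> omega
  set γ : Fin n → ℤ := fun k => N * δ k + η k with hγ
  have hpos : ∀ k, 0 < γ k → Sum.inl k ∈ active z := fun k hk => by
    rw [← hsv]
    have h1 := abs_lt.1 (hNη k)
    rcases lt_trichotomy (δ k) 0 with h | h | h
    · simp only [hγ] at hk
      nlinarith
    · by_cases hkD : k ∈ activeIdx z
      · exact (hact k hkD h).1
      · have := mt (hηD k).1 hkD
        simp only [hγ, h] at hk
        omega
    · simp only [hδ] at h
      omega
  have hneg : ∀ k, γ k < 0 → Sum.inr k ∈ active z := fun k hk => by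
    rw [← hsv]
    have h1 := abs_lt.1 (hNη k)
    rcases lt_trichotomy (δ k) 0 with h | h | h
    · simp only [hδ] at h
      omega
    · by_cases hkD : k ∈ activeIdx z
      · exact (hact k hkD h).2
      · have := mt (hηD k).1 hkD
        simp only [hγ, h] at hk
        omega
    · simp only [hγ] at hk
      nlinarith
  have hne : ∀ k, γ k ≠ 0 → k ∈ activeIdx z := fun k hk => by
    rcases lt_or_gt_of_ne hk with h | h
    · exact ⟨_, hneg k h, rfl⟩
    · exact ⟨_, hpos k h, rfl⟩
  have hrel : ∑ k, γ k • B k = 0 := by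
    have h1 : ∑ k, γ k • B k = N • ∑ k, δ k • B k + ∑ k, η k • B k := by
      rw [Finset.smul_sum, ← Finset.sum_add_distrib]
      refine Finset.sum_congr rfl fun k _ => ?_
      rw [hγ, add_smul, mul_smul]
    rw [h1, hη, ← wt_eq_sum, hs, smul_zero, add_zero]
  have hγI : ∀ i ∈ I, γ i ≠ 0 := fun i hi h0 => by
    have h1 := abs_lt.1 (hNη i)
    have h2 := (hηD i).2 (hI i hi)
    simp only [hγ] at h0
    rcases lt_trichotomy (δ i) 0 with h | h | h
    · nlinarith
    · rw [h] at h0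
      omega
    · nlinarith
  let 𝒟 : ChartData B :=
    { I := I, J := J, c := c, basis := hb, γ := γ, rel := hrel
      flat_of_ne := fun k hk => hD k (hne k hk)
      ne_of_mem := hγI
      noncoloop := fun i hi => by
        obtain ⟨k, hk, h⟩ := hb.exists_active_ne hI hi
        exact ⟨k, hD k hk, h⟩ }
  refine ⟨𝒟, val_redMon_ne_zero z 𝒟.wt_mon fun v hv => ?_, ?_⟩
  · rcases v with k | k
    · refine hpos k ?_
      rw [ChartData.mon_inl] at hv
      change 0 < 𝒟.γ k
      omega
    · refine hneg k ?_
      rw [ChartData.mon_inr] at hv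
      change 𝒟.γ k < 0
      omega
  · ext k
    exact hb.mem_hull_iff hI hD

end Active

/-! ### The parabolic subgroup of a chart -/

section Parabolic

variable {n m : ℕ} {B : Matrix (Fin n) (Fin m) ℤ}

theorem WeightBasis.character_row {I J : Finset (Fin n)} {c : Fin n → Fin n → ℤ}
    (hb : WeightBasis B I J c) (k : Fin n) (τ : Fin m → ℂˣ) :
    character (B k) τ = ∏ i ∈ I ∪ J, character (B i) τ ^ c k i := by
  conv_lhs => rw [hb.row k]
  rw [character_sum]
  exact Finset.prod_congr rfl fun i _ => character_zsmul _ _ _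

theorem two_zpow_eq_one {a : ℤ} (h : (Units.mk0 (2 : ℂ) two_ne_zero) ^ a = 1) : a = 0 := by
  have h3 := congrArg (fun u : ℂˣ => ‖(u : ℂ)‖) h
  simp only [Units.val_zpow_eq_zpow_val, Units.val_mk0, norm_zpow, Complex.norm_ofNat,
    Units.val_one, norm_one] at h3
  exact (zpow_eq_one_iff_right₀ (by norm_num) (by norm_num)).1 h3

namespace ChartData

variable (𝒟 : ChartData B)

/-- The subgroup of the torus on which the characters with indices in `I` are trivial. -/
def H : Subgroup (Fin m → ℂˣ) where
  carrier := {τ | ∀ i ∈ 𝒟.I, character (B i) τ = 1}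
  mul_mem' ha hb i hi := by rw [map_mul, ha i hi, hb i hi, one_mul]
  one_mem' i _ := map_one _
  inv_mem' ha i hi := by rw [map_inv, ha i hi, inv_one]

theorem mem_H {τ : Fin m → ℂˣ} : τ ∈ 𝒟.H ↔ ∀ i ∈ 𝒟.I, character (B i) τ = 1 := Iff.rfl

/-- The characters that are trivial on `H` are the combinations of those with indices in `I`. -/
theorem exists_of_trivial {χ : Fin m → ℤ} (h : ∀ τ ∈ 𝒟.H, character χ τ = 1) :
    ∃ d : Fin n → ℤ, χ = ∑ i ∈ 𝒟.I, d i • B i := by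
  classical
  obtain ⟨d, hd⟩ := 𝒟.basis.coord χ
  refine ⟨d, ?_⟩
  rw [Finset.sum_union 𝒟.basis.disj] at hd
  rw [hd, add_eq_left]
  refine Finset.sum_eq_zero fun j hj => ?_
  -- An element of `H` that detects the coefficient of `B j`.
  obtain ⟨τ, hτ⟩ := 𝒟.basis.torus (Function.update 1 j (Units.mk0 (2 : ℂ) two_ne_zero))
  have hτI : ∀ i ∈ 𝒟.I ∪ 𝒟.J, i ≠ j → character (B i) τ = 1 := fun i hi hij => by
    rw [hτ i hi, Function.update_of_ne hij, Pi.one_apply]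
  have hτH : τ ∈ 𝒟.H := fun i hi => hτI i (Finset.mem_union_left _ hi) (by
    rintro rfl
    exact Finset.disjoint_left.1 𝒟.basis.disj hi hj)
  have h1 := h τ hτH
  rw [hd, character_add, character_sum, character_sum, Finset.prod_eq_one, one_mul,
    Finset.prod_eq_single j, character_zsmul, hτ j (Finset.mem_union_right _ hj),
    Function.update_self] at h1
  · rw [two_zpow_eq_one h1, zero_smul]
  · intro i hi hij
    rw [character_zsmul, hτI i (Finset.mem_union_right _ hi) hij, one_zpow]
  · exact fun h => absurd hj h
  · intro i hi
    rw [character_zsmul, hτH i hi, one_zpow]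

theorem trivial_of_mem_E {k : Fin n} (hk : k ∈ 𝒟.E) {τ : Fin m → ℂˣ} (hτ : τ ∈ 𝒟.H) :
    character (B k) τ = 1 := by
  rw [𝒟.basis.character_row]
  refine Finset.prod_eq_one fun i hi => ?_
  rcases Finset.mem_union.1 hi with hi | hi
  · rw [hτ i hi, one_zpow]
  · rw [hk i hi, zpow_zero]

/-- A character trivial on `H` is a combination of the rows in `I`, hence pairs to zero with the
cocharacters dual to `J`, and these pairings are the numbers `c k j`. -/
theorem mem_moved {k : Fin n} : k ∈ movedCoords B 𝒟.H ↔ k ∉ 𝒟.E := by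
  classical
  rw [movedCoords, Finset.mem_filter]
  simp only [Finset.mem_univ, true_and]
  constructor
  · rintro ⟨τ, hτ, hk⟩ hE
    exact hk (𝒟.trivial_of_mem_E hE hτ)
  · intro hk
    by_contra! h
    obtain ⟨d, hd⟩ := 𝒟.exists_of_trivial h
    apply hk
    intro j hj
    obtain ⟨ξ, hξ⟩ := 𝒟.basis.dual j (Finset.mem_union_right _ hj)
    rw [← hξ k, hd]
    simp only [Finset.sum_apply, Pi.smul_apply, smul_eq_mul, Finset.sum_mul]
    rw [Finset.sum_comm]
    refine Finset.sum_eq_zero fun i hi => ?_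
    simp only [mul_assoc, ← Finset.mul_sum]
    rw [hξ i, 𝒟.I_sub_E hi j hj, mul_zero]

/-- The coordinates of the slice. -/
abbrev F : Finset (Fin n) := movedCoords B 𝒟.H

theorem exists_of_mem_F {k : Fin n} (hk : k ∈ 𝒟.F) : ∃ τ ∈ 𝒟.H, character (B k) τ ≠ 1 := by
  classical
  exact (Finset.mem_filter.1 hk).2

theorem mem_E_of_not_mem_F {k : Fin n} (hk : k ∉ 𝒟.F) : k ∈ 𝒟.E :=
  not_not.1 (mt 𝒟.mem_moved.2 hk)

theorem not_mem_F {k : Fin n} (hk : k ∈ 𝒟.E) : k ∉ 𝒟.F := fun h => 𝒟.mem_moved.1 h hk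

theorem not_mem_F_of_mem_I {k : Fin n} (hk : k ∈ 𝒟.I) : k ∉ 𝒟.F := 𝒟.not_mem_F (𝒟.I_sub_E hk)

/-- It is the stabilizer of the indicator vector of `I`. -/
theorem isParabolic_H : IsParabolic B 𝒟.H := by
  classical
  refine ⟨fun i => if i ∈ 𝒟.I then 1 else 0, fun τ => ?_⟩
  rw [mem_H]
  refine forall_congr' fun i => ?_
  by_cases hi : i ∈ 𝒟.I <;> simp [hi]

theorem lieAlg_pairing {ξ : Fin m → ℂ} (hξ : ξ ∈ lieAlg 𝒟.H) {k : Fin n} (hk : k ∈ 𝒟.E) :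
    ∑ j, (B k j : ℂ) * ξ j = 0 :=
  hξ (B k) fun _ hτ => 𝒟.trivial_of_mem_E hk hτ

/-- The characters trivial on `H` are combinations of rows in `I`, which pair to zero with the
cocharacter dual to `j`. -/
theorem dual_mem_lieAlg {j : Fin n} (hj : j ∈ 𝒟.J) {ξ : Fin m → ℤ}
    (hξ : ∀ k, ∑ l, B k l * ξ l = 𝒟.c k j) : (fun l => (ξ l : ℂ)) ∈ lieAlg 𝒟.H := by
  intro χ hχ
  obtain ⟨d, rfl⟩ := 𝒟.exists_of_trivial hχ
  have h1 : ∑ l, (∑ i ∈ 𝒟.I, d i • B i) l * ξ l = 0 := by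
    simp only [Finset.sum_apply, Pi.smul_apply, smul_eq_mul, Finset.sum_mul]
    rw [Finset.sum_comm]
    refine Finset.sum_eq_zero fun i hi => ?_
    simp only [mul_assoc, ← Finset.mul_sum]
    rw [hξ i, 𝒟.I_sub_E hi j hj, mul_zero]
  have h2 := congrArg (Int.cast : ℤ → ℂ) h1
  push_cast at h2
  exact h2

/-- The inclusion of the coordinates of the slice. -/
def emb (u : 𝒟.F ⊕ 𝒟.F) : Fin n ⊕ Fin n := Sum.map Subtype.val Subtype.val u

@[simp] theorem sgn_emb (u : 𝒟.F ⊕ 𝒟.F) : sgn (𝒟.emb u) = sgn u := by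
  rcases u with u | u <;> rfl

@[simp] theorem idx_emb (u : 𝒟.F ⊕ 𝒟.F) : idx (𝒟.emb u) = ((idx u : 𝒟.F) : Fin n) := by
  rcases u with u | u <;> rfl

theorem emb_injective : Function.Injective 𝒟.emb :=
  Sum.map_injective.2 ⟨Subtype.val_injective, Subtype.val_injective⟩

theorem exists_emb {v : Fin n ⊕ Fin n} (hv : idx v ∈ 𝒟.F) : ∃ u, 𝒟.emb u = v := by
  rcases v with k | k
  · exact ⟨Sum.inl ⟨k, hv⟩, rfl⟩
  · exact ⟨Sum.inr ⟨k, hv⟩, rfl⟩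

theorem prod_emb {M : Type} [CommMonoid M] (g : Fin n ⊕ Fin n → M)
    (hg : ∀ v, idx v ∉ 𝒟.F → g v = 1) : ∏ v, g v = ∏ u, g (𝒟.emb u) := by
  classical
  rw [Fintype.prod_sum_type, Fintype.prod_sum_type]
  congr 1
  · rw [← Finset.prod_subset (Finset.subset_univ 𝒟.F) fun k _ hk => hg (Sum.inl k) hk,
      ← Finset.prod_coe_sort]
    rfl
  · rw [← Finset.prod_subset (Finset.subset_univ 𝒟.F) fun k _ hk => hg (Sum.inr k) hk,
      ← Finset.prod_coe_sort]
    rfl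

theorem sum_moved {M : Type} [AddCommMonoid M] (g : Fin n → M) (hg : ∀ k, k ∉ 𝒟.F → g k = 0) :
    ∑ k, g k = ∑ k : 𝒟.F, g k := by
  classical
  rw [← Finset.sum_subset (Finset.subset_univ 𝒟.F) fun k _ hk => hg k hk,
    ← Finset.sum_coe_sort]

/-- The part of a monomial in the coordinates of the slice. -/
def restrict (s : Fin n ⊕ Fin n →₀ ℕ) : 𝒟.F ⊕ 𝒟.F →₀ ℕ :=
  Finsupp.equivFunOnFinite.symm fun u => s (𝒟.emb u)

theorem restrict_apply (s : Fin n ⊕ Fin n →₀ ℕ) (u : 𝒟.F ⊕ 𝒟.F) :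
    𝒟.restrict s u = s (𝒟.emb u) := rfl

theorem character_wt (B' : Matrix (Fin n) (Fin m) ℤ) (s : Fin n ⊕ Fin n →₀ ℕ)
    (τ : Fin m → ℂˣ) :
    character (wt B' s) τ = ∏ v, character (B' (idx v)) τ ^ (sgn v * s v : ℤ) := by
  rw [wt, character_sum]
  exact Finset.prod_congr rfl fun v _ => character_zsmul _ _ _

theorem character_wt_restrict (s : Fin n ⊕ Fin n →₀ ℕ) {τ : Fin m → ℂˣ} (hτ : τ ∈ 𝒟.H) :
    character (wt B s) τ = character (wt (sliceWeights B 𝒟.H) (𝒟.restrict s)) τ := by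
  rw [character_wt, 𝒟.prod_emb, wt, character_sum]
  · refine Finset.prod_congr rfl fun u _ => ?_
    rw [character_zsmul, idx_emb, sgn_emb, restrict_apply]
    rfl
  · intro v hv
    rw [𝒟.trivial_of_mem_E (𝒟.mem_E_of_not_mem_F hv) hτ, one_zpow]

/-- Only the coordinates with index in `F` contribute to the `H`-weight, so invariance of the slice
part means that the full weight is trivial on `H`. -/
theorem isInv_restrict_iff (s : Fin n ⊕ Fin n →₀ ℕ) :
    IsInv (sliceWeights B 𝒟.H) 𝒟.H (𝒟.restrict s) ↔
      ∃ d : Fin n → ℤ, wt B s = ∑ i ∈ 𝒟.I, d i • B i := by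
  constructor
  · intro h
    exact 𝒟.exists_of_trivial fun τ hτ => by rw [𝒟.character_wt_restrict s hτ, h τ hτ]
  · rintro ⟨d, hd⟩ τ hτ
    rw [← 𝒟.character_wt_restrict s hτ, hd, character_sum]
    refine Finset.prod_eq_one fun i hi => ?_
    rw [character_zsmul, hτ i hi, one_zpow]

theorem isInv_restrict {s : Fin n ⊕ Fin n →₀ ℕ} (hs : wt B s = 0) :
    IsInv (sliceWeights B 𝒟.H) 𝒟.H (𝒟.restrict s) :=
  (𝒟.isInv_restrict_iff s).2 ⟨0, by simp [hs]⟩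

/-- The extension by zero of the exponents of a monomial on the slice. -/
def extend (t : 𝒟.F ⊕ 𝒟.F →₀ ℕ) : Fin n ⊕ Fin n →₀ ℕ :=
  t.mapDomain 𝒟.emb

theorem restrict_extend (t : 𝒟.F ⊕ 𝒟.F →₀ ℕ) : 𝒟.restrict (𝒟.extend t) = t := by
  ext u
  rw [restrict_apply, extend, Finsupp.mapDomain_apply 𝒟.emb_injective]

theorem extend_apply_of_not_mem (t : 𝒟.F ⊕ 𝒟.F →₀ ℕ) {v : Fin n ⊕ Fin n} (hv : idx v ∉ 𝒟.F) :
    𝒟.extend t v = 0 := by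
  refine Finsupp.mapDomain_of_notMem_range _ _ ?_
  rintro ⟨u, rfl⟩
  rw [idx_emb] at hv
  exact hv (idx u).2

theorem not_isInv_single (u : 𝒟.F ⊕ 𝒟.F) :
    ¬ IsInv (sliceWeights B 𝒟.H) 𝒟.H (Finsupp.single u 1) := by
  intro h
  obtain ⟨τ, hτ, hne⟩ := 𝒟.exists_of_mem_F (idx u : 𝒟.F).2
  apply hne
  have h3 := h τ hτ
  rw [wt_single, character_zsmul] at h3
  rcases u with u | u
  · rw [sgn_inl, Nat.cast_one, mul_one, zpow_one] at h3
    exact h3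
  · rw [sgn_inr, Nat.cast_one, mul_one, zpow_neg_one, inv_eq_one] at h3
    exact h3

end ChartData

end Parabolic

/-! ### The restriction to the slice -/

section Slice

variable {n m : ℕ} {B : Matrix (Fin n) (Fin m) ℤ}

/-- The coordinate of the same kind as `v` with another index. -/
def place {κ α : Type} (v : κ ⊕ κ) (a : α) : α ⊕ α :=
  Sum.elim (fun _ => Sum.inl a) (fun _ => Sum.inr a) v

namespace ChartData

variable (𝒟 : ChartData B) {P : Type} [CommRing P] [Algebra ℂ P] (x : Fin n ⊕ Fin n → P)

/-- The images of the coordinates with indices outside `I` on the slice: `x` describes the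
coordinates along the leaf, and the coordinates with indices in `F` are kept. -/
def base (v : Fin n ⊕ Fin n) : P ⊗[ℂ] MvPolynomial (𝒟.F ⊕ 𝒟.F) ℂ :=
  if hF : idx v ∈ 𝒟.F then 1 ⊗ₜ MvPolynomial.X (place v ⟨idx v, hF⟩)
  else if idx v ∈ 𝒟.I then 0 else x v ⊗ₜ 1

theorem base_emb (u : 𝒟.F ⊕ 𝒟.F) : 𝒟.base x (𝒟.emb u) = 1 ⊗ₜ MvPolynomial.X u := by
  have h : idx (𝒟.emb u) ∈ 𝒟.F := by rw [idx_emb]; exact (idx u : 𝒟.F).2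
  rw [base, dif_pos h]
  rcases u with u | u <;> rfl

theorem base_of_mem_I {v : Fin n ⊕ Fin n} (hv : idx v ∈ 𝒟.I) : 𝒟.base x v = 0 := by
  rw [base, dif_neg (𝒟.not_mem_F_of_mem_I hv), if_pos hv]

theorem base_of_free {v : Fin n ⊕ Fin n} (hF : idx v ∉ 𝒟.F) (hI : idx v ∉ 𝒟.I) :
    𝒟.base x v = x v ⊗ₜ 1 := by
  rw [base, dif_neg hF, if_neg hI]

/-- The value of `x_i y_i`, for `i ∈ I`, that the moment map forces. -/
def pairValue (i : Fin n) : P ⊗[ℂ] MvPolynomial (𝒟.F ⊕ 𝒟.F) ℂ :=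
  -∑ k, (𝒟.c k i : ℂ) • (𝒟.base x (Sum.inl k) * 𝒟.base x (Sum.inr k))

/-- The image of a coordinate on the slice: for `i ∈ I`, one of `x_i`, `y_i` is put equal to `1`,
and the other one is determined by the moment map. -/
def coordImage (v : Fin n ⊕ Fin n) : P ⊗[ℂ] MvPolynomial (𝒟.F ⊕ 𝒟.F) ℂ :=
  if idx v ∈ 𝒟.I then (if 𝒟.mon v ≠ 0 then 1 else 𝒟.pairValue x (idx v)) else 𝒟.base x v

/-- The restriction of polynomials to the slice. -/
def sub : MvPolynomial (Fin n ⊕ Fin n) ℂ →ₐ[ℂ] P ⊗[ℂ] MvPolynomial (𝒟.F ⊕ 𝒟.F) ℂ :=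
  MvPolynomial.aeval (𝒟.coordImage x)

theorem sub_X (v : Fin n ⊕ Fin n) : 𝒟.sub x (MvPolynomial.X v) = 𝒟.coordImage x v :=
  MvPolynomial.aeval_X _ _

theorem coordImage_pivot {v : Fin n ⊕ Fin n} (hI : idx v ∈ 𝒟.I) (hv : 𝒟.mon v ≠ 0) :
    𝒟.coordImage x v = 1 := by
  rw [coordImage, if_pos hI, if_pos hv]

theorem coordImage_nonpivot {v : Fin n ⊕ Fin n} (hI : idx v ∈ 𝒟.I) (hv : 𝒟.mon v = 0) :
    𝒟.coordImage x v = 𝒟.pairValue x (idx v) := by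
  rw [coordImage, if_pos hI, if_neg (not_not.2 hv)]

theorem coordImage_of_not_mem {v : Fin n ⊕ Fin n} (hI : idx v ∉ 𝒟.I) :
    𝒟.coordImage x v = 𝒟.base x v := by
  rw [coordImage, if_neg hI]

theorem coordImage_emb (u : 𝒟.F ⊕ 𝒟.F) : 𝒟.coordImage x (𝒟.emb u) = 1 ⊗ₜ MvPolynomial.X u := by
  rw [coordImage_of_not_mem, base_emb]
  intro h
  rw [idx_emb] at h
  exact 𝒟.not_mem_F_of_mem_I h (idx u : 𝒟.F).2

theorem mon_dichotomy {i : Fin n} (hi : i ∈ 𝒟.I) :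
    (𝒟.mon (Sum.inl i) ≠ 0 ∧ 𝒟.mon (Sum.inr i) = 0) ∨
      (𝒟.mon (Sum.inl i) = 0 ∧ 𝒟.mon (Sum.inr i) ≠ 0) := by
  have := 𝒟.ne_of_mem i hi
  rw [mon_inl, mon_inr]
  omega

theorem coordImage_pair {i : Fin n} (hi : i ∈ 𝒟.I) :
    𝒟.coordImage x (Sum.inl i) * 𝒟.coordImage x (Sum.inr i) = 𝒟.pairValue x i := by
  rcases 𝒟.mon_dichotomy hi with ⟨h1, h2⟩ | ⟨h1, h2⟩
  · rw [𝒟.coordImage_pivot x (v := Sum.inl i) hi h1,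
      𝒟.coordImage_nonpivot x (v := Sum.inr i) hi h2, one_mul, idx_inr]
  · rw [𝒟.coordImage_pivot x (v := Sum.inr i) hi h2,
      𝒟.coordImage_nonpivot x (v := Sum.inl i) hi h1, mul_one, idx_inl]

/-- `pairValue` is defined so that this holds: among the indices in `I` only `i` itself has a
nonzero coefficient. -/
theorem sum_coord_I {i : Fin n} (hi : i ∈ 𝒟.I) :
    ∑ k, (𝒟.c k i : ℂ) • (𝒟.coordImage x (Sum.inl k) * 𝒟.coordImage x (Sum.inr k)) = 0 := by
  classical
  have hiK : i ∈ 𝒟.I ∪ 𝒟.J := Finset.mem_union_left _ hi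
  have h1 : ∀ k, (𝒟.c k i : ℂ) • (𝒟.coordImage x (Sum.inl k) * 𝒟.coordImage x (Sum.inr k)) =
      (if k = i then 𝒟.pairValue x i else 0) +
        (𝒟.c k i : ℂ) • (𝒟.base x (Sum.inl k) * 𝒟.base x (Sum.inr k)) := fun k => by
    by_cases hk : k ∈ 𝒟.I
    · rw [𝒟.coordImage_pair x hk, 𝒟.base_of_mem_I x (v := Sum.inl k) hk, zero_mul, smul_zero,
        add_zero, 𝒟.basis.delta i hiK k (Finset.mem_union_left _ hk)]
      split_ifs with h
      · rw [h, Int.cast_one, one_smul]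
      · rw [Int.cast_zero, zero_smul]
    · rw [𝒟.coordImage_of_not_mem x (v := Sum.inl k) hk,
        𝒟.coordImage_of_not_mem x (v := Sum.inr k) hk, if_neg, zero_add]
      rintro rfl
      exact hk hi
  rw [Finset.sum_congr rfl fun k _ => h1 k, Finset.sum_add_distrib, Finset.sum_ite_eq' Finset.univ i,
    if_pos (Finset.mem_univ _), pairValue, neg_add_cancel]

theorem sum_coord_J {j : Fin n} (hj : j ∈ 𝒟.J) :
    ∑ k, (𝒟.c k j : ℂ) • (𝒟.coordImage x (Sum.inl k) * 𝒟.coordImage x (Sum.inr k)) =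
      1 ⊗ₜ ∑ k : 𝒟.F, (𝒟.c k j : ℂ) •
        (MvPolynomial.X (Sum.inl k) * MvPolynomial.X (Sum.inr k)) := by
  rw [𝒟.sum_moved, TensorProduct.tmul_sum]
  · refine Finset.sum_congr rfl fun k _ => ?_
    have h1 := 𝒟.coordImage_emb x (Sum.inl k)
    have h2 := 𝒟.coordImage_emb x (Sum.inr k)
    simp only [emb, Sum.map_inl, Sum.map_inr] at h1 h2
    rw [h1, h2, Algebra.TensorProduct.tmul_mul_tmul, one_mul, TensorProduct.tmul_smul]
  · intro k hk
    rw [𝒟.mem_E_of_not_mem_F hk j hj, Int.cast_zero, zero_smul]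

/-- The restriction to the slice of a component of the moment map. -/
theorem sub_moment (ξ : Fin m → ℂ) : ∃ η ∈ lieAlg 𝒟.H,
    𝒟.sub x (moment B ξ) = 1 ⊗ₜ moment (sliceWeights B 𝒟.H) η := by
  classical
  choose! ζ hζ using 𝒟.basis.dual
  let β : Fin n → ℂ := fun i => ∑ j, (B i j : ℂ) * ξ j
  have hrow : ∀ k, β k = ∑ i ∈ 𝒟.I ∪ 𝒟.J, (𝒟.c k i : ℂ) * β i := fun k => by
    simp only [β, Finset.mul_sum]
    rw [Finset.sum_comm]
    refine Finset.sum_congr rfl fun j _ => ?_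
    have h1 := congrFun (𝒟.basis.row k) j
    rw [h1]
    simp only [Finset.sum_apply, Pi.smul_apply, smul_eq_mul]
    push_cast
    rw [Finset.sum_mul]
    simp only [mul_assoc]
  -- This is the part of `ξ` along the cocharacters dual to `J`; the components dual to `I` have
  -- been solved and restrict to zero.
  refine ⟨∑ j ∈ 𝒟.J, β j • fun l => (ζ j l : ℂ), Submodule.sum_mem _ fun j hj =>
    Submodule.smul_mem _ _ (𝒟.dual_mem_lieAlg hj (hζ j (Finset.mem_union_right _ hj))), ?_⟩
  have hη : ∀ k : 𝒟.F, ∑ l, (sliceWeights B 𝒟.H k l : ℂ) *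
      (∑ j ∈ 𝒟.J, β j • fun l => (ζ j l : ℂ)) l = ∑ j ∈ 𝒟.J, β j * 𝒟.c k j := fun k => by
    simp only [Finset.sum_apply, Pi.smul_apply, smul_eq_mul, Finset.mul_sum]
    rw [Finset.sum_comm]
    refine Finset.sum_congr rfl fun j hj => ?_
    rw [← hζ j (Finset.mem_union_right _ hj) k]
    push_cast
    rw [Finset.mul_sum]
    refine Finset.sum_congr rfl fun l _ => ?_
    simp only [sliceWeights, Matrix.submatrix_apply, id]
    ring
  have h1 : 𝒟.sub x (moment B ξ) =
      ∑ k, β k • (𝒟.coordImage x (Sum.inl k) * 𝒟.coordImage x (Sum.inr k)) := by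
    simp only [moment, map_sum, map_smul, map_mul, sub_X, β]
  have h2 : ∀ k, β k • (𝒟.coordImage x (Sum.inl k) * 𝒟.coordImage x (Sum.inr k)) =
      ∑ i ∈ 𝒟.I ∪ 𝒟.J, β i •
        (𝒟.c k i : ℂ) • (𝒟.coordImage x (Sum.inl k) * 𝒟.coordImage x (Sum.inr k)) := fun k => by
    conv_lhs => rw [hrow k]
    rw [Finset.sum_smul]
    refine Finset.sum_congr rfl fun i _ => ?_
    rw [smul_smul, mul_comm]
  rw [h1, Finset.sum_congr rfl fun k _ => h2 k, Finset.sum_comm]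
  simp only [← Finset.smul_sum]
  rw [Finset.sum_union 𝒟.basis.disj, Finset.sum_eq_zero (s := 𝒟.I) fun i hi => by
    rw [𝒟.sum_coord_I x hi, smul_zero], zero_add, Finset.sum_congr rfl fun j hj => by
    rw [𝒟.sum_coord_J x hj, ← TensorProduct.tmul_smul], ← TensorProduct.tmul_sum]
  congr 1
  rw [moment]
  simp only [hη, Finset.smul_sum, Finset.sum_smul, mul_smul]
  rw [Finset.sum_comm]

/-! ### Restriction of invariants -/

/-- The extension of the inclusion of the invariants on the slice. -/
def incl (P : Type) [CommRing P] [Algebra ℂ P] :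
    P ⊗[ℂ] invariants (sliceWeights B 𝒟.H) 𝒟.H →ₐ[ℂ] P ⊗[ℂ] MvPolynomial (𝒟.F ⊕ 𝒟.F) ℂ :=
  Algebra.TensorProduct.map (AlgHom.id ℂ P) (invariants (sliceWeights B 𝒟.H) 𝒟.H).val

theorem incl_tmul (p : P) (q : invariants (sliceWeights B 𝒟.H) 𝒟.H) :
    𝒟.incl P (p ⊗ₜ q) = p ⊗ₜ (q : MvPolynomial (𝒟.F ⊕ 𝒟.F) ℂ) := rfl

theorem incl_injective : Function.Injective (𝒟.incl P) :=
  Module.Flat.lTensor_preserves_injective_linearMap (M := P)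
    (invariants (sliceWeights B 𝒟.H) 𝒟.H).val.toLinearMap Subtype.val_injective

/-- Slice coordinates enter these images only through the products `x_k y_k` in `pairValue`, which
are invariant. -/
theorem coordImage_mem {v : Fin n ⊕ Fin n} (hv : idx v ∉ 𝒟.F) :
    𝒟.coordImage x v ∈ (𝒟.incl P).range := by
  have hfree : ∀ v, idx v ∉ 𝒟.F → 𝒟.base x v ∈ (𝒟.incl P).range := fun v hv => by
    rw [base, dif_neg hv]
    split_ifs
    · exact zero_mem _
    · exact ⟨x v ⊗ₜ 1, by simp [incl_tmul]⟩
  rw [coordImage]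
  split_ifs
  · exact one_mem _
  · rw [pairValue]
    refine neg_mem (sum_mem fun k _ => Subalgebra.smul_mem _ ?_ _)
    by_cases hk : k ∈ 𝒟.F
    · have h1 := 𝒟.base_emb x (Sum.inl ⟨k, hk⟩)
      have h2 := 𝒟.base_emb x (Sum.inr ⟨k, hk⟩)
      simp only [emb, Sum.map_inl, Sum.map_inr] at h1 h2
      rw [h1, h2, Algebra.TensorProduct.tmul_mul_tmul, one_mul]
      refine ⟨1 ⊗ₜ ⟨_, (IsInv.of_wt_eq_zero (wt_pair (sliceWeights B 𝒟.H) ⟨k, hk⟩)).monomial_mem 1⟩,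
        ?_⟩
      simp only [AlgHom.toRingHom_eq_coe, RingHom.coe_coe]
      rw [incl_tmul, MvPolynomial.X, MvPolynomial.X, MvPolynomial.monomial_mul, one_mul]
    · exact mul_mem (hfree (Sum.inl k) hk) (hfree (Sum.inr k) hk)
  · exact hfree v hv

theorem sub_monomial (s : Fin n ⊕ Fin n →₀ ℕ) :
    𝒟.sub x (MvPolynomial.monomial s 1) = ∏ v, 𝒟.coordImage x v ^ s v := by
  rw [sub, MvPolynomial.aeval_monomial, map_one, one_mul, Finsupp.prod_fintype _ _ (by simp)]

/-- The restriction of a monomial is the product of its part along the slice with other factors. -/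
theorem sub_monomial_eq (s : Fin n ⊕ Fin n →₀ ℕ) : 𝒟.sub x (MvPolynomial.monomial s 1) =
    (∏ v, if idx v ∈ 𝒟.F then 1 else 𝒟.coordImage x v ^ s v) *
      1 ⊗ₜ MvPolynomial.monomial (𝒟.restrict s) 1 := by
  have h1 : (1 : P) ⊗ₜ[ℂ] MvPolynomial.monomial (𝒟.restrict s) (1 : ℂ) =
      ∏ v, if idx v ∈ 𝒟.F then 𝒟.coordImage x v ^ s v else 1 := by
    rw [𝒟.prod_emb _ fun v hv => if_neg hv]
    have h2 : (1 : P) ⊗ₜ[ℂ] MvPolynomial.monomial (𝒟.restrict s) (1 : ℂ) =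
        Algebra.TensorProduct.includeRight (R := ℂ) (A := P)
          (MvPolynomial.monomial (𝒟.restrict s) (1 : ℂ)) := rfl
    rw [h2, MvPolynomial.monomial_eq, map_one, one_mul, Finsupp.prod_fintype _ _ (by simp), map_prod]
    refine Finset.prod_congr rfl fun u _ => ?_
    rw [if_pos (by rw [idx_emb]; exact (idx u : 𝒟.F).2), coordImage_emb, map_pow]
    rfl
  rw [h1, sub_monomial, ← Finset.prod_mul_distrib]
  refine Finset.prod_congr rfl fun v _ => ?_
  split_ifs <;> simp

theorem outer_mem (s : Fin n ⊕ Fin n →₀ ℕ) :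
    (∏ v, if idx v ∈ 𝒟.F then 1 else 𝒟.coordImage x v ^ s v) ∈ (𝒟.incl P).range := by
  refine prod_mem fun v _ => ?_
  split_ifs with hv
  · exact one_mem _
  · exact pow_mem (𝒟.coordImage_mem x hv) _

/-- A monomial of weight zero has an `H`-invariant slice part, and its other factors restrict to
invariants by `outer_mem`. -/
theorem sub_mem (p : invariants B ⊤) : 𝒟.sub x p ∈ (𝒟.incl P).range := by
  rw [MvPolynomial.as_sum (p : MvPolynomial (Fin n ⊕ Fin n) ℂ), map_sum]
  refine sum_mem fun s hs => ?_
  have hs0 : wt B s = 0 := isInv_top_iff.1 (mem_invariants_iff.1 p.2 s hs)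
  have h1 : ∀ a : ℂ, MvPolynomial.monomial s a = a • MvPolynomial.monomial s (1 : ℂ) := fun a => by
    rw [MvPolynomial.smul_monomial, smul_eq_mul, mul_one]
  rw [h1, map_smul, sub_monomial_eq]
  exact Subalgebra.smul_mem _ (mul_mem (𝒟.outer_mem x s)
    ⟨1 ⊗ₜ ⟨_, (𝒟.isInv_restrict hs0).monomial_mem 1⟩, rfl⟩) _

/-- The restriction of invariants to the slice. -/
def resInv : invariants B ⊤ →ₐ[ℂ] P ⊗[ℂ] invariants (sliceWeights B 𝒟.H) 𝒟.H :=
  (AlgEquiv.ofInjective (𝒟.incl P) 𝒟.incl_injective).symm.toAlgHom.comp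
    (((𝒟.sub x).comp (invariants B ⊤).val).codRestrict (𝒟.incl P).range (𝒟.sub_mem x))

theorem incl_resInv (p : invariants B ⊤) : 𝒟.incl P (𝒟.resInv x p) = 𝒟.sub x p := by
  have := (AlgEquiv.ofInjective (𝒟.incl P) 𝒟.incl_injective).apply_symm_apply
    (((𝒟.sub x).comp (invariants B ⊤).val).codRestrict (𝒟.incl P).range (𝒟.sub_mem x) p)
  exact congrArg Subtype.val this

theorem resInv_eq {p : invariants B ⊤} {w : P ⊗[ℂ] invariants (sliceWeights B 𝒟.H) 𝒟.H}
    (h : 𝒟.sub x p = 𝒟.incl P w) : 𝒟.resInv x p = w :=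
  𝒟.incl_injective (by rw [incl_resInv, h])

/-- The coordinate ring of the hypertoric cone of the slice, as a new type: this speeds up the
search for algebraic structures on its tensor products. -/
def SliceRing : Type := SliceCone B 𝒟.H

instance : CommRing 𝒟.SliceRing := inferInstanceAs (CommRing (SliceCone B 𝒟.H))

instance : Algebra ℂ 𝒟.SliceRing := inferInstanceAs (Algebra ℂ (SliceCone B 𝒟.H))

/-- The class in the coordinate ring of the slice of an invariant. -/
def sliceMk : invariants (sliceWeights B 𝒟.H) 𝒟.H →ₐ[ℂ] 𝒟.SliceRing :=
  Ideal.Quotient.mkₐ ℂ (redIdeal (sliceWeights B 𝒟.H) 𝒟.H)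

/-- The class in the coordinate ring of the slice of a monomial. -/
def sliceMon (t : 𝒟.F ⊕ 𝒟.F →₀ ℕ) : 𝒟.SliceRing := redMon (sliceWeights B 𝒟.H) 𝒟.H t

theorem sliceMon_of_isInv {t : 𝒟.F ⊕ 𝒟.F →₀ ℕ} (h : IsInv (sliceWeights B 𝒟.H) 𝒟.H t) :
    𝒟.sliceMon t = 𝒟.sliceMk ⟨MvPolynomial.monomial t 1, h.monomial_mem 1⟩ :=
  redMon_of_isInv h

theorem slice_induction {P : 𝒟.SliceRing → Prop}
    (mon : ∀ t, IsInv (sliceWeights B 𝒟.H) 𝒟.H t → ∀ a : ℂ, P (a • 𝒟.sliceMon t))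
    (add : ∀ p q, P p → P q → P (p + q)) (p : 𝒟.SliceRing) : P p :=
  red_induction mon add p

/-- The value of a function on the slice at the vertex. -/
def sliceVertex : 𝒟.SliceRing →ₐ[ℂ] ℂ := (vertex (sliceWeights B 𝒟.H) 𝒟.H).val

theorem sliceVertex_mon {t : 𝒟.F ⊕ 𝒟.F →₀ ℕ} (ht : t ≠ 0) : 𝒟.sliceVertex (𝒟.sliceMon t) = 0 :=
  vertex_redMon ht

theorem fg_ker_sliceVertex : (RingHom.ker 𝒟.sliceVertex).FG :=
  fg_ker_vertex (B := sliceWeights B 𝒟.H) (H := 𝒟.H)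

/-- The bracket on the slice. -/
def sliceBracket : Biderivation 𝒟.SliceRing := redBracket (sliceWeights B 𝒟.H) 𝒟.H

theorem sliceVertex_bracket (p q : 𝒟.SliceRing) : 𝒟.sliceVertex (𝒟.sliceBracket p q) = 0 :=
  vertex_redBracket (B := sliceWeights B 𝒟.H) (H := 𝒟.H) 𝒟.not_isInv_single p q

/-- The extension of the projection from the invariants to the reduction. -/
def proj (P : Type) [CommRing P] [Algebra ℂ P] :
    P ⊗[ℂ] invariants (sliceWeights B 𝒟.H) 𝒟.H →ₐ[ℂ] P ⊗[ℂ] 𝒟.SliceRing :=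
  Algebra.TensorProduct.map (AlgHom.id ℂ P) 𝒟.sliceMk

theorem proj_tmul (p : P) (q : invariants (sliceWeights B 𝒟.H) 𝒟.H) :
    𝒟.proj P (p ⊗ₜ q) = p ⊗ₜ 𝒟.sliceMk q := rfl

/-- By `redIdeal_eq_span` only the moment components need checking, and these restrict to moment
components of `H`. -/
theorem proj_resInv_of_mem (p : invariants B ⊤) (hp : p ∈ redIdeal B ⊤) :
    𝒟.proj P (𝒟.resInv x p) = 0 := by
  rw [redIdeal_eq_span] at hp
  have hle : Ideal.span {q : invariants B ⊤ | ∃ ξ ∈ lieAlg (⊤ : Subgroup (Fin m → ℂˣ)),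
      q = ⟨moment B ξ, moment_mem_invariants ξ⟩} ≤
      RingHom.ker ((𝒟.proj P).comp (𝒟.resInv x)) := by
    rw [Ideal.span_le]
    rintro _ ⟨ξ, -, rfl⟩
    obtain ⟨η, hη, h⟩ := 𝒟.sub_moment x ξ
    have h1 := 𝒟.resInv_eq x (p := ⟨moment B ξ, moment_mem_invariants ξ⟩)
      (w := 1 ⊗ₜ ⟨moment (sliceWeights B 𝒟.H) η, moment_mem_invariants η⟩) h
    have h2 : 𝒟.sliceMk
        ⟨moment (sliceWeights B 𝒟.H) η, moment_mem_invariants η⟩ = 0 :=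
      Ideal.Quotient.eq_zero_iff_mem.2 (Ideal.subset_span ⟨η, hη, rfl⟩)
    rw [SetLike.mem_coe, RingHom.mem_ker, AlgHom.comp_apply, h1, proj_tmul, h2,
      TensorProduct.tmul_zero]
  exact hle hp

/-- The restriction of functions on the cone to the product of the leaf and the slice. -/
def coneMap : Cone B →ₐ[ℂ] P ⊗[ℂ] 𝒟.SliceRing :=
  Ideal.Quotient.liftₐ (redIdeal B ⊤) ((𝒟.proj P).comp (𝒟.resInv x)) (𝒟.proj_resInv_of_mem x)

theorem coneMap_mk (p : invariants B ⊤) :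
    𝒟.coneMap x (Ideal.Quotient.mkₐ ℂ (redIdeal B ⊤) p) = 𝒟.proj P (𝒟.resInv x p) := rfl

theorem coneMap_redMon {s : Fin n ⊕ Fin n →₀ ℕ} (hs : wt B s = 0)
    {w : P ⊗[ℂ] invariants (sliceWeights B 𝒟.H) 𝒟.H}
    (h : 𝒟.sub x (MvPolynomial.monomial s 1) = 𝒟.incl P w) :
    𝒟.coneMap x (redMon B ⊤ s) = 𝒟.proj P w := by
  rw [redMon_of_isInv (IsInv.of_wt_eq_zero hs), coneMap_mk]
  congr 1
  exact 𝒟.resInv_eq x h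

theorem coneMap_redMon_eq {s : Fin n ⊕ Fin n →₀ ℕ} (hs : wt B s = 0) :
    ∃ a : P ⊗[ℂ] 𝒟.SliceRing, 𝒟.coneMap x (redMon B ⊤ s) =
      a * 1 ⊗ₜ 𝒟.sliceMon (𝒟.restrict s) := by
  obtain ⟨a, ha⟩ := 𝒟.outer_mem x s
  have hinv := 𝒟.isInv_restrict hs
  have h1 := 𝒟.sub_monomial_eq x s
  refine ⟨𝒟.proj P a, ?_⟩
  rw [sliceMon_of_isInv 𝒟 hinv, ← proj_tmul, ← map_mul]
  refine 𝒟.coneMap_redMon x hs ?_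
  rw [h1, map_mul, incl_tmul]
  congr 1
  exact ha.symm

end ChartData

end Slice

/-! ### Homomorphisms from principal open subsets -/

section Away

variable {A T : Type} [CommRing A] [Algebra ℂ A] [CommRing T] [Algebra ℂ T] {f : A}

/-- Restriction to a principal open subset. -/
def toLoc (f : A) : A →ₐ[ℂ] Localization.Away f := Algebra.algHom ℂ A (Localization.Away f)

/-- The extension of a homomorphism to a principal open subset. -/
def awayLift (φ : A →ₐ[ℂ] T) (h : IsUnit (φ f)) : Localization.Away f →ₐ[ℂ] T :=
  IsLocalization.Away.liftAlgHom f (f := φ) h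

theorem awayLift_toLoc (φ : A →ₐ[ℂ] T) (h : IsUnit (φ f)) (a : A) :
    awayLift φ h (toLoc f a) = φ a :=
  IsLocalization.Away.lift_eq f h a

theorem mem_range_awayLift {φ : A →ₐ[ℂ] T} (h : IsUnit (φ f)) {a : A} {N : ℕ} {w : T}
    (ha : φ a = φ f ^ N * w) : w ∈ (awayLift φ h).range := by
  refine ⟨toLoc f a * IsLocalization.Away.invSelf f ^ N, ?_⟩
  have h1 := congrArg (awayLift φ h) (IsLocalization.Away.mul_invSelf
    (S := Localization.Away f) f)
  rw [map_mul, map_one] at h1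
  have h2 : φ f * awayLift φ h (IsLocalization.Away.invSelf f) = 1 := by
    rw [← h1]
    congr 1
    exact (awayLift_toLoc φ h f).symm
  have h3 : awayLift φ h (toLoc f a * IsLocalization.Away.invSelf f ^ N) = w := by
    rw [map_mul, map_pow, awayLift_toLoc, ha, mul_right_comm, ← mul_pow, h2, one_pow, one_mul]
  exact h3

theorem awayLift_injective {φ : A →ₐ[ℂ] T} (h : IsUnit (φ f))
    (h0 : ∀ a, φ a = 0 → ∃ K : ℕ, f ^ K * a = 0) : Function.Injective (awayLift φ h) := by
  rw [injective_iff_map_eq_zero]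
  intro w hw
  obtain ⟨⟨a, s⟩, hs⟩ := IsLocalization.surj (Submonoid.powers f) w
  have hu : IsUnit (algebraMap A (Localization.Away f) s) := IsLocalization.map_units _ s
  have h1 := congrArg (awayLift φ h) hs
  rw [map_mul, hw, zero_mul] at h1
  have h2 : φ a = 0 := by
    rw [h1]
    exact (awayLift_toLoc φ h a).symm
  obtain ⟨K, hK⟩ := h0 a h2
  have h3 : algebraMap A (Localization.Away f) a = 0 := by
    have h4 := congrArg (algebraMap A (Localization.Away f)) hK
    rw [map_mul, map_pow, map_zero] at h4
    exact ((IsLocalization.Away.algebraMap_isUnit f).pow K).mul_right_eq_zero.1 h4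
  simp only [h3] at hs
  exact hu.mul_left_eq_zero.1 hs

end Away

/-! ### The chart around a point of a hypertoric cone -/

section Chart

variable {n m : ℕ} {B : Matrix (Fin n) (Fin m) ℤ}

namespace ChartData

variable (𝒟 : ChartData B) {P : Type} [CommRing P] [Algebra ℂ P] (x : Fin n ⊕ Fin n → P)

theorem idx_mem_E_of_mon {v : Fin n ⊕ Fin n} (hv : 𝒟.mon v ≠ 0) : idx v ∈ 𝒟.E :=
  𝒟.flat_of_ne _ (𝒟.γ_ne hv)

/-- The restriction of the monomial of the chart to the leaf. -/
def monVal : P := ∏ v, if idx v ∈ 𝒟.I then 1 else x v ^ 𝒟.mon v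

theorem coordImage_pow_mon (v : Fin n ⊕ Fin n) : 𝒟.coordImage x v ^ 𝒟.mon v =
    (if idx v ∈ 𝒟.I then 1 else x v ^ 𝒟.mon v) ⊗ₜ 1 := by
  by_cases hv : 𝒟.mon v = 0
  · simp only [hv, pow_zero, ite_self]
    rfl
  · split_ifs with hI
    · rw [𝒟.coordImage_pivot x hI hv, one_pow]
      rfl
    · rw [𝒟.coordImage_of_not_mem x hI,
        𝒟.base_of_free x (𝒟.not_mem_F (𝒟.idx_mem_E_of_mon hv)) hI,
        Algebra.TensorProduct.tmul_pow, one_pow]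

/-- The monomial of the chart contains no slice coordinates, and its factors with index in `I` are
pivots. -/
theorem sub_mon : 𝒟.sub x (MvPolynomial.monomial 𝒟.mon 1) = 𝒟.monVal x ⊗ₜ 1 := by
  have h1 : 𝒟.monVal x ⊗ₜ[ℂ] (1 : MvPolynomial (𝒟.F ⊕ 𝒟.F) ℂ) =
      Algebra.TensorProduct.includeLeft (R := ℂ) (S := ℂ) (𝒟.monVal x) := rfl
  rw [sub_monomial, h1, monVal, map_prod]
  exact Finset.prod_congr rfl fun v _ => 𝒟.coordImage_pow_mon x v

theorem coneMap_mon : 𝒟.coneMap x (redMon B ⊤ 𝒟.mon) = 𝒟.monVal x ⊗ₜ 1 := by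
  rw [𝒟.coneMap_redMon x 𝒟.wt_mon (w := 𝒟.monVal x ⊗ₜ 1) (𝒟.sub_mon x), proj_tmul, map_one]

theorem sum_pivot {M : Type} [AddCommMonoid M] (g : Fin n → M) :
    ∑ v, (if idx v ∈ 𝒟.I ∧ 𝒟.mon v ≠ 0 then g (idx v) else 0) = ∑ i ∈ 𝒟.I, g i := by
  classical
  rw [Fintype.sum_sum_type, ← Finset.sum_add_distrib, ← Finset.sum_subset (Finset.subset_univ 𝒟.I)]
  · refine Finset.sum_congr rfl fun i hi => ?_
    rcases 𝒟.mon_dichotomy hi with ⟨h1, h2⟩ | ⟨h1, h2⟩ <;> simp [hi, h1, h2]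
  · intro i _ hi
    simp [hi]

theorem sgn_mul_sgn {ι : Type} (v : ι ⊕ ι) : sgn v * sgn v = 1 := by
  rcases v with v | v <;> rfl

/-- Monomials in the coordinates with indices outside `I` lift, up to a power of the monomial of the
chart, to invariant monomials. -/
theorem exists_lift {s : Fin n ⊕ Fin n →₀ ℕ} (hsI : ∀ v, idx v ∈ 𝒟.I → s v = 0) {d : Fin n → ℤ}
    (hd : wt B s = ∑ i ∈ 𝒟.I, d i • B i) : ∃ (a : Fin n ⊕ Fin n →₀ ℕ) (N : ℕ), wt B a = 0 ∧
      (∀ v, idx v ∉ 𝒟.I → a v = N * 𝒟.mon v + s v) ∧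
      𝒟.sub x (MvPolynomial.monomial a 1) =
        𝒟.sub x (MvPolynomial.monomial 𝒟.mon 1) ^ N * 𝒟.sub x (MvPolynomial.monomial s 1) := by
  classical
  -- Pivots restrict to `1`, so their exponents may be altered at will to cancel the weight of `s`.
  -- The `N`-th power of the chart monomial provides large enough exponents for the result to remain
  -- a polynomial.
  set N : ℕ := ∑ i, (d i).natAbs with hN
  let a : Fin n ⊕ Fin n →₀ ℕ := Finsupp.equivFunOnFinite.symm fun v =>
    if idx v ∈ 𝒟.I ∧ 𝒟.mon v ≠ 0 then (N * 𝒟.mon v - sgn v * d (idx v) : ℤ).toNat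
    else N * 𝒟.mon v + s v
  have ha : ∀ v, (a v : ℤ) = N * 𝒟.mon v + s v -
      (if idx v ∈ 𝒟.I ∧ 𝒟.mon v ≠ 0 then sgn v * d (idx v) else 0) := fun v => by
    by_cases hv : idx v ∈ 𝒟.I ∧ 𝒟.mon v ≠ 0
    · have h1 : ((d (idx v)).natAbs : ℤ) ≤ N := by
        have := Finset.single_le_sum (f := fun i => (d i).natAbs) (fun _ _ => Nat.zero_le _)
          (Finset.mem_univ (idx v))
        exact_mod_cast this
      have h2 : sgn v * d (idx v) ≤ N := by
        rcases v with k | k <;> simp only [sgn_inl, sgn_inr] <;> omega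
      have h3 : (N : ℤ) ≤ N * 𝒟.mon v := by
        have : (1 : ℤ) ≤ 𝒟.mon v := by exact_mod_cast Nat.one_le_iff_ne_zero.2 hv.2
        nlinarith
      have h4 : a v = (N * 𝒟.mon v - sgn v * d (idx v) : ℤ).toNat := if_pos hv
      rw [if_pos hv, h4, hsI v hv.1, Int.toNat_of_nonneg (by omega)]
      simp
    · have h4 : a v = N * 𝒟.mon v + s v := if_neg hv
      rw [if_neg hv, h4]
      simp
  have hfree : ∀ v, ¬ (idx v ∈ 𝒟.I ∧ 𝒟.mon v ≠ 0) → a v = N * 𝒟.mon v + s v := fun v hv => if_neg hv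
  refine ⟨a, N, ?_, fun v hv => hfree v fun h => hv h.1, ?_⟩
  · have h1 : wt B a = N • wt B 𝒟.mon + wt B s - ∑ v,
        (if idx v ∈ 𝒟.I ∧ 𝒟.mon v ≠ 0 then d (idx v) • B (idx v) else 0) := by
      rw [wt, wt, wt, Finset.smul_sum, ← Finset.sum_add_distrib, ← Finset.sum_sub_distrib]
      refine Finset.sum_congr rfl fun v _ => ?_
      rw [ha]
      ext j
      split_ifs with h
      · simp only [Pi.smul_apply, Pi.add_apply, Pi.sub_apply, smul_eq_mul, nsmul_eq_mul,
          Pi.mul_apply, Pi.natCast_apply]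
        linear_combination (-d (idx v) * B (idx v) j) * sgn_mul_sgn v
      · simp only [Pi.smul_apply, Pi.add_apply, Pi.sub_apply, smul_eq_mul, nsmul_eq_mul,
          Pi.mul_apply, Pi.natCast_apply, Pi.zero_apply]
        ring
    rw [h1, 𝒟.sum_pivot fun i => d i • B i, 𝒟.wt_mon, smul_zero, zero_add, hd, sub_self]
  · rw [sub_monomial, sub_monomial, sub_monomial, ← Finset.prod_pow, ← Finset.prod_mul_distrib]
    refine Finset.prod_congr rfl fun v _ => ?_
    by_cases hv : idx v ∈ 𝒟.I ∧ 𝒟.mon v ≠ 0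
    · rw [𝒟.coordImage_pivot x hv.1 hv.2]
      simp
    · rw [hfree v hv, pow_add, ← pow_mul, mul_comm N]

theorem row_of_mem_E {k : Fin n} (hk : k ∈ 𝒟.E) : B k = ∑ i ∈ 𝒟.I, 𝒟.c k i • B i := by
  conv_lhs => rw [𝒟.basis.row k]
  rw [Finset.sum_union 𝒟.basis.disj, Finset.sum_eq_zero (s := 𝒟.J) fun j hj => by
    rw [hk j hj, zero_smul], add_zero]

theorem exists_wt_eq {s : Fin n ⊕ Fin n →₀ ℕ} (hs : ∀ v, s v ≠ 0 → idx v ∈ 𝒟.E) :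
    ∃ d : Fin n → ℤ, wt B s = ∑ i ∈ 𝒟.I, d i • B i := by
  refine ⟨fun i => ∑ v, sgn v * s v * 𝒟.c (idx v) i, ?_⟩
  simp only [Finset.sum_smul]
  rw [Finset.sum_comm, wt]
  refine Finset.sum_congr rfl fun v _ => ?_
  by_cases hv : s v = 0
  · simp [hv]
  · conv_lhs => rw [𝒟.row_of_mem_E (hs v hv)]
    rw [Finset.smul_sum]
    exact Finset.sum_congr rfl fun i _ => by rw [smul_smul]

theorem sub_extend (t : 𝒟.F ⊕ 𝒟.F →₀ ℕ) :
    𝒟.sub x (MvPolynomial.monomial (𝒟.extend t) 1) = 1 ⊗ₜ MvPolynomial.monomial t 1 := by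
  rw [sub_monomial_eq, restrict_extend, Finset.prod_eq_one, one_mul]
  intro v _
  split_ifs with hv
  · rfl
  · rw [𝒟.extend_apply_of_not_mem t hv, pow_zero]

/-- The monomials on the slice lift, up to a power of the monomial of the chart. -/
theorem exists_lift_slice {t : 𝒟.F ⊕ 𝒟.F →₀ ℕ} (ht : IsInv (sliceWeights B 𝒟.H) 𝒟.H t) :
    ∃ (a : Fin n ⊕ Fin n →₀ ℕ) (N : ℕ), wt B a = 0 ∧ 𝒟.restrict a = t ∧
      𝒟.coneMap x (redMon B ⊤ a) =
        𝒟.coneMap x (redMon B ⊤ 𝒟.mon) ^ N * 1 ⊗ₜ 𝒟.sliceMon t := by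
  obtain ⟨d, hd⟩ := (𝒟.isInv_restrict_iff (𝒟.extend t)).1 (by rwa [restrict_extend])
  obtain ⟨a, N, ha, hav, h⟩ := 𝒟.exists_lift x (s := 𝒟.extend t)
    (fun v hv => 𝒟.extend_apply_of_not_mem t (𝒟.not_mem_F_of_mem_I hv)) hd
  refine ⟨a, N, ha, ?_, ?_⟩
  · ext u
    have hu : idx (𝒟.emb u) ∈ 𝒟.F := by rw [idx_emb]; exact (idx u : 𝒟.F).2
    rw [restrict_apply, hav _ fun hI => 𝒟.not_mem_F_of_mem_I hI hu]
    have : 𝒟.mon (𝒟.emb u) = 0 := by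
      by_contra hm
      exact 𝒟.not_mem_F (𝒟.idx_mem_E_of_mon hm) hu
    rw [this, mul_zero, zero_add, ← restrict_apply, restrict_extend]
  · rw [sub_mon, sub_extend] at h
    rw [𝒟.coneMap_redMon x ha
      (w := (𝒟.monVal x ⊗ₜ 1) ^ N * 1 ⊗ₜ ⟨MvPolynomial.monomial t 1, ht.monomial_mem 1⟩),
      coneMap_mon, map_mul, map_pow, proj_tmul, proj_tmul, map_one, sliceMon_of_isInv 𝒟 ht]
    rw [h, map_mul, map_pow, incl_tmul, incl_tmul]
    rfl

/-- A coordinate is free if its index lies in the flat but not in the basis of the flat. -/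
def free (v : Fin n ⊕ Fin n) : Prop := idx v ∉ 𝒟.F ∧ idx v ∉ 𝒟.I

variable {x} in
theorem coneMap_lift_leaf {s a : Fin n ⊕ Fin n →₀ ℕ} {N : ℕ} (ha : wt B a = 0)
    (h : 𝒟.sub x (MvPolynomial.monomial a 1) =
      𝒟.sub x (MvPolynomial.monomial 𝒟.mon 1) ^ N * 𝒟.sub x (MvPolynomial.monomial s 1)) {p : P}
    (hp : 𝒟.sub x (MvPolynomial.monomial s 1) = p ⊗ₜ 1) :
    𝒟.coneMap x (redMon B ⊤ a) = 𝒟.coneMap x (redMon B ⊤ 𝒟.mon) ^ N * p ⊗ₜ 1 := by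
  rw [sub_mon, hp] at h
  rw [𝒟.coneMap_redMon x ha (w := (𝒟.monVal x ⊗ₜ 1) ^ N * p ⊗ₜ 1),
    coneMap_mon, map_mul, map_pow, proj_tmul, proj_tmul, map_one]
  rw [h, map_mul, map_pow, incl_tmul, incl_tmul]
  rfl

/-- The coordinates along the leaf lift, up to a power of the monomial of the chart. -/
theorem exists_lift_free {v : Fin n ⊕ Fin n} (hv : 𝒟.free v) :
    ∃ a N, wt B a = 0 ∧ 𝒟.coneMap x (redMon B ⊤ a) =
      𝒟.coneMap x (redMon B ⊤ 𝒟.mon) ^ N * x v ⊗ₜ 1 := by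
  classical
  obtain ⟨d, hd⟩ := 𝒟.exists_wt_eq (s := Finsupp.single v 1) fun w hw => by
    rw [Finsupp.single_apply] at hw
    have : v = w := by_contra fun h => hw (if_neg h)
    rw [← this]
    exact 𝒟.mem_E_of_not_mem_F hv.1
  obtain ⟨a, N, ha, -, h⟩ := 𝒟.exists_lift x (s := Finsupp.single v 1) (fun w hw => by
    rw [Finsupp.single_apply, if_neg]
    rintro rfl
    exact hv.2 hw) hd
  refine ⟨a, N, ha, 𝒟.coneMap_lift_leaf ha h ?_⟩
  have h1 := 𝒟.sub_X x v
  rw [𝒟.coordImage_of_not_mem x hv.2, 𝒟.base_of_free x hv.1 hv.2] at h1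
  exact h1

/-- The inverses of the invertible coordinates along the leaf lift, up to a power of the monomial of
the chart. -/
theorem exists_lift_inv {v : Fin n ⊕ Fin n} (hv : 𝒟.free v) (hm : 𝒟.mon v ≠ 0) {u : P}
    (hu : u * x v = 1) : ∃ a N, wt B a = 0 ∧ 𝒟.coneMap x (redMon B ⊤ a) =
      𝒟.coneMap x (redMon B ⊤ 𝒟.mon) ^ N * (𝒟.monVal x * u) ⊗ₜ 1 := by
  classical
  -- The chart monomial without its pivots and with one factor `v` removed; it restricts to `monVal
  -- x * u`.
  let s : Fin n ⊕ Fin n →₀ ℕ := Finsupp.equivFunOnFinite.symm fun w =>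
    if idx w ∈ 𝒟.I then 0 else 𝒟.mon w - if w = v then 1 else 0
  have hsI : ∀ w, idx w ∈ 𝒟.I → s w = 0 := fun w hw => if_pos hw
  have hs : ∀ w, idx w ∉ 𝒟.I → s w = 𝒟.mon w - if w = v then 1 else 0 := fun w hw => if_neg hw
  obtain ⟨d, hd⟩ := 𝒟.exists_wt_eq (s := s) fun w hw => 𝒟.idx_mem_E_of_mon fun h => by
    by_cases hI : idx w ∈ 𝒟.I
    · exact hw (hsI w hI)
    · exact hw (by rw [hs w hI, h, Nat.zero_sub])
  obtain ⟨a, N, ha, -, h⟩ := 𝒟.exists_lift x (s := s) hsI hd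
  refine ⟨a, N, ha, 𝒟.coneMap_lift_leaf ha h ?_⟩
  have h1 : 𝒟.sub x (MvPolynomial.monomial s 1) * x v ⊗ₜ 1 = 𝒟.monVal x ⊗ₜ 1 := by
    rw [← sub_mon, sub_monomial, sub_monomial, ← Finset.mul_prod_erase _ _ (Finset.mem_univ v),
      ← Finset.mul_prod_erase _ _ (Finset.mem_univ v), mul_right_comm]
    congr 1
    · rw [← 𝒟.base_of_free x hv.1 hv.2, ← 𝒟.coordImage_of_not_mem x hv.2, ← pow_succ, hs v hv.2,
        if_pos rfl, Nat.sub_add_cancel (Nat.one_le_iff_ne_zero.2 hm)]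
    · refine Finset.prod_congr rfl fun w hw => ?_
      by_cases hI : idx w ∈ 𝒟.I
      · rw [hsI w hI, pow_zero]
        by_cases hw0 : 𝒟.mon w = 0
        · rw [hw0, pow_zero]
        · rw [𝒟.coordImage_pivot x hI hw0, one_pow]
      · rw [hs w hI, if_neg (Finset.ne_of_mem_erase hw), Nat.sub_zero]
  calc 𝒟.sub x (MvPolynomial.monomial s 1) =
      𝒟.sub x (MvPolynomial.monomial s 1) * (x v ⊗ₜ 1) * (u ⊗ₜ 1) := by
        rw [mul_assoc, Algebra.TensorProduct.tmul_mul_tmul, mul_comm (x v), hu, mul_one,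
          ← Algebra.TensorProduct.one_def, mul_one]
    _ = (𝒟.monVal x * u) ⊗ₜ 1 := by
        rw [h1, Algebra.TensorProduct.tmul_mul_tmul, mul_one]

/-- The coordinates along the leaf that occur in the monomial of the chart are invertible. -/
def Inverts : Prop := ∀ v, 𝒟.free v → 𝒟.mon v ≠ 0 → IsUnit (x v)

variable {x}

theorem Inverts.isUnit_monVal (hx : 𝒟.Inverts x) : IsUnit (𝒟.monVal x) := by
  refine Submonoid.prod_mem (IsUnit.submonoid P) fun v _ => ?_
  split_ifs with hI
  · exact isUnit_one
  · by_cases hm : 𝒟.mon v = 0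
    · rw [hm, pow_zero]
      exact isUnit_one
    · exact (hx v ⟨𝒟.not_mem_F (𝒟.idx_mem_E_of_mon hm), hI⟩ hm).pow _

/-- The function whose nonvanishing locus is the domain of the chart. -/
abbrev f : Cone B := redMon B ⊤ 𝒟.mon

theorem Inverts.isUnit_coneMap (hx : 𝒟.Inverts x) : IsUnit (𝒟.coneMap x 𝒟.f) := by
  rw [coneMap_mon]
  exact (hx.isUnit_monVal 𝒟).map (Algebra.TensorProduct.includeLeft (R := ℂ) (S := ℂ)
    (A := P) (B := 𝒟.SliceRing))

/-- The restriction of functions on the principal open subset to the product of the leaf and the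
slice. -/
def chart (hx : 𝒟.Inverts x) : Localization.Away 𝒟.f →ₐ[ℂ] P ⊗[ℂ] 𝒟.SliceRing :=
  awayLift (𝒟.coneMap x) (hx.isUnit_coneMap 𝒟)

theorem chart_toLoc (hx : 𝒟.Inverts x) (a : Cone B) :
    𝒟.chart hx (toLoc 𝒟.f a) = 𝒟.coneMap x a :=
  awayLift_toLoc _ _ _

theorem mem_range_chart (hx : 𝒟.Inverts x) {a : Cone B} {N : ℕ} {w : P ⊗[ℂ] 𝒟.SliceRing}
    (h : 𝒟.coneMap x a = 𝒟.coneMap x 𝒟.f ^ N * w) : w ∈ (𝒟.chart hx).range :=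
  mem_range_awayLift _ h

/-- `P` is generated by the coordinates along the leaf and the inverses of those that occur in the
monomial of the chart. -/
def Generates (x : Fin n ⊕ Fin n → P) : Prop :=
  ∀ S : Subalgebra ℂ P, (∀ v, 𝒟.free v → x v ∈ S) →
    (∀ v, 𝒟.free v → 𝒟.mon v ≠ 0 → ∀ u, u * x v = 1 → u ∈ S) → S = ⊤

/-- The generators of both tensor factors have lifts up to powers of the restriction of `f`, which
is a unit in the target. -/
theorem chart_surjective (hx : 𝒟.Inverts x) (hg : 𝒟.Generates x) :
    Function.Surjective (𝒟.chart hx) := by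
  rw [← AlgHom.range_eq_top, eq_top_iff]
  have hleft : ((𝒟.chart hx).range.comap
      (Algebra.TensorProduct.includeLeft (R := ℂ) (S := ℂ) (A := P) (B := 𝒟.SliceRing))) = ⊤ := by
    refine hg _ (fun v hv => ?_) fun v hv hm u hu => ?_
    · obtain ⟨a, N, -, h⟩ := 𝒟.exists_lift_free x hv
      exact 𝒟.mem_range_chart hx h
    · obtain ⟨a, N, -, h⟩ := 𝒟.exists_lift_inv x hv hm hu
      -- The additional power absorbs the factor `monVal x`, which is the restriction of `f`.
      refine 𝒟.mem_range_chart hx (N := N + 1) (a := redMon B ⊤ a) ?_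
      rw [h, pow_succ, mul_assoc]
      congr 1
      have h2 : (𝒟.monVal x * u) ⊗ₜ[ℂ] (1 : 𝒟.SliceRing) = 𝒟.monVal x ⊗ₜ 1 * u ⊗ₜ 1 := by
        rw [Algebra.TensorProduct.tmul_mul_tmul, mul_one]
      rw [coneMap_mon]
      exact h2
  have hright : ∀ q : 𝒟.SliceRing, 1 ⊗ₜ q ∈ (𝒟.chart hx).range := fun q => by
    refine 𝒟.slice_induction (P := fun q => 1 ⊗ₜ q ∈ (𝒟.chart hx).range) (fun t ht r => ?_)
      (fun p q hp hq => ?_) q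
    · obtain ⟨a, N, -, -, h⟩ := 𝒟.exists_lift_slice x ht
      rw [TensorProduct.tmul_smul]
      exact Subalgebra.smul_mem _ (𝒟.mem_range_chart hx h) _
    · rw [TensorProduct.tmul_add]
      exact add_mem hp hq
  rintro w -
  induction w using TensorProduct.induction_on with
  | zero => exact zero_mem _
  | add a b ha hb => exact add_mem ha hb
  | tmul p q =>
    have hp : p ⊗ₜ[ℂ] (1 : 𝒟.SliceRing) ∈ (𝒟.chart hx).range := by
      have : p ∈ (⊤ : Subalgebra ℂ P) := trivial
      rw [← hleft] at this
      exact this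
    have := mul_mem hp (hright q)
    rwa [Algebra.TensorProduct.tmul_mul_tmul, one_mul, mul_one] at this

end ChartData

end Chart

/-! ### Injectivity of the chart -/

section Injectivity

variable {n m : ℕ} {B : Matrix (Fin n) (Fin m) ℤ}

theorem units_zpow_prod {T : Type} [CommRing T] {κ : Type} (x : Tˣ) (s : Finset κ) (f : κ → ℤ) :
    x ^ (∑ i ∈ s, f i) = ∏ i ∈ s, x ^ f i := by
  classical
  induction s using Finset.induction_on with
  | empty => simp
  | insert a s ha ih => rw [Finset.sum_insert ha, Finset.prod_insert ha, zpow_add, ih]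

namespace ChartData

variable (𝒟 : ChartData B)

/-! ### Changes of gauge -/

section gauge

variable {T : Type} [CommRing T] [Algebra ℂ T] (θ : MvPolynomial (Fin n ⊕ Fin n) ℂ →ₐ[ℂ] T)
  (t : Fin n → Tˣ)

/-- The change of gauge of the coordinates `θ` by the torus element with values `t` on the basis of
the flat. -/
def gaugeUnit (v : Fin n ⊕ Fin n) : Tˣ := (∏ i ∈ 𝒟.I, t i ^ 𝒟.c (idx v) i) ^ sgn v

/-- The coordinates `θ` after a change of gauge. -/
def gauge : MvPolynomial (Fin n ⊕ Fin n) ℂ →ₐ[ℂ] T :=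
  MvPolynomial.aeval fun v => (𝒟.gaugeUnit t v : T) * θ (MvPolynomial.X v)

theorem gauge_X (v : Fin n ⊕ Fin n) :
    𝒟.gauge θ t (MvPolynomial.X v) = 𝒟.gaugeUnit t v * θ (MvPolynomial.X v) :=
  MvPolynomial.aeval_X _ _

/-- The exponent of each `t i` in the total factor is the `i`-th coordinate of the weight, which is
zero. -/
theorem gauge_monomial {s : Fin n ⊕ Fin n →₀ ℕ} (hs : wt B s = 0) (a : ℂ) :
    𝒟.gauge θ t (MvPolynomial.monomial s a) = θ (MvPolynomial.monomial s a) := by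
  have h1 : ∏ v, 𝒟.gaugeUnit t v ^ s v = 1 := by
    have h2 : ∀ v, 𝒟.gaugeUnit t v ^ s v =
        ∏ i ∈ 𝒟.I, t i ^ (sgn v * s v * 𝒟.c (idx v) i) := fun v => by
      rw [gaugeUnit, ← zpow_natCast, ← zpow_mul, ← Finset.prod_zpow]
      refine Finset.prod_congr rfl fun i _ => ?_
      rw [← zpow_mul, mul_comm]
    rw [Finset.prod_congr rfl fun v _ => h2 v, Finset.prod_comm]
    refine Finset.prod_eq_one fun i hi => ?_
    rw [← units_zpow_prod]
    have h3 : ∑ v, sgn v * s v * 𝒟.c (idx v) i =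
        ∑ k, ((s (Sum.inl k) : ℤ) - s (Sum.inr k)) * 𝒟.c k i := by
      rw [Fintype.sum_sum_type, ← Finset.sum_add_distrib]
      refine Finset.sum_congr rfl fun k _ => ?_
      simp only [sgn_inl, sgn_inr, idx_inl, idx_inr]
      ring
    rw [h3, 𝒟.basis.rel_coord ((wt_eq_sum s).symm.trans hs) (Finset.mem_union_left _ hi), zpow_zero]
  have h4 : MvPolynomial.monomial s a =
      MvPolynomial.C a * ∏ v, (MvPolynomial.X v : MvPolynomial (Fin n ⊕ Fin n) ℂ) ^ s v := by
    rw [MvPolynomial.monomial_eq, Finsupp.prod_fintype _ _ (by simp)]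
  have hC : ∀ φ : MvPolynomial (Fin n ⊕ Fin n) ℂ →ₐ[ℂ] T,
      φ (MvPolynomial.C a) = algebraMap ℂ T a := fun φ => φ.commutes a
  rw [h4, map_mul, map_mul, map_prod, map_prod, hC, hC]
  simp only [map_pow, gauge_X, mul_pow]
  rw [Finset.prod_mul_distrib]
  have h5 := congrArg (Units.val) h1
  rw [Units.coe_prod, Units.val_one] at h5
  simp only [Units.val_pow_eq_pow_val] at h5
  rw [h5, one_mul]

theorem gauge_of_mem {p : MvPolynomial (Fin n ⊕ Fin n) ℂ} (hp : p ∈ invariants B ⊤) :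
    𝒟.gauge θ t p = θ p := by
  rw [p.as_sum, map_sum, map_sum]
  exact Finset.sum_congr rfl fun s hs =>
    𝒟.gauge_monomial θ t (isInv_top_iff.1 (mem_invariants_iff.1 hp s hs)) _

theorem gauge_pair (k : Fin n) : 𝒟.gauge θ t (MvPolynomial.X (Sum.inl k)) *
    𝒟.gauge θ t (MvPolynomial.X (Sum.inr k)) =
      θ (MvPolynomial.X (Sum.inl k)) * θ (MvPolynomial.X (Sum.inr k)) := by
  have h := 𝒟.gauge_monomial θ t (wt_pairExp k) 1
  have h1 : MvPolynomial.monomial (pairExp k) (1 : ℂ) =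
      MvPolynomial.X (Sum.inl k) * MvPolynomial.X (Sum.inr k) := by
    rw [MvPolynomial.X, MvPolynomial.X, MvPolynomial.monomial_mul, one_mul, pairExp]
  rwa [h1, map_mul, map_mul] at h

/-- The coordinate of index `i ∈ I` is scaled only by `t i` or its inverse, so `t i` can be read off
from the pivot. -/
theorem exists_gauge (hθ : ∀ v, 𝒟.mon v ≠ 0 → IsUnit (θ (MvPolynomial.X v))) :
    ∃ t : Fin n → Tˣ, ∀ v, idx v ∈ 𝒟.I → 𝒟.mon v ≠ 0 →
      𝒟.gauge θ t (MvPolynomial.X v) = 1 := by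
  classical
  have h1 : ∀ i, ∃ t : Tˣ, i ∈ 𝒟.I → ∀ v, idx v = i → 𝒟.mon v ≠ 0 →
      ((t ^ sgn v : Tˣ) : T) * θ (MvPolynomial.X v) = 1 := fun i => by
    by_cases hi : i ∈ 𝒟.I
    · rcases 𝒟.mon_dichotomy hi with ⟨h1, h2⟩ | ⟨h1, h2⟩
      · refine ⟨(hθ _ h1).unit⁻¹, fun _ v hv hm => ?_⟩
        rcases v with k | k
        · obtain rfl : k = i := hv
          rw [sgn_inl, zpow_one]
          exact (hθ _ h1).val_inv_mul
        · obtain rfl : k = i := hv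
          exact absurd h2 hm
      · refine ⟨(hθ _ h2).unit, fun _ v hv hm => ?_⟩
        rcases v with k | k
        · obtain rfl : k = i := hv
          exact absurd h1 hm
        · obtain rfl : k = i := hv
          rw [sgn_inr, zpow_neg_one]
          exact (hθ _ h2).val_inv_mul
    · exact ⟨1, fun h => absurd h hi⟩
  choose t ht using h1
  refine ⟨t, fun v hI hm => ?_⟩
  have h2 : 𝒟.gaugeUnit t v = t (idx v) ^ sgn v := by
    rw [gaugeUnit, Finset.prod_eq_single (idx v)]
    · rw [𝒟.basis.delta _ (Finset.mem_union_left _ hI) _ (Finset.mem_union_left _ hI), if_pos rfl,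
        zpow_one]
    · intro i hi hne
      rw [𝒟.basis.delta _ (Finset.mem_union_left _ hi) _ (Finset.mem_union_left _ hI),
        if_neg hne.symm, zpow_zero]
    · exact fun h => absurd hI h
  rw [gauge_X, h2]
  exact ht _ hI v rfl hm

theorem sum_pair_of_moment (hμ : ∀ ξ, θ (moment B ξ) = 0) {i : Fin n} (hi : i ∈ 𝒟.I ∪ 𝒟.J) :
    ∑ k, (𝒟.c k i : ℂ) • (θ (MvPolynomial.X (Sum.inl k)) * θ (MvPolynomial.X (Sum.inr k))) = 0 := by
  obtain ⟨ξ, hξ⟩ := 𝒟.basis.dual i hi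
  have h1 := hμ fun j => (ξ j : ℂ)
  simp only [moment, map_sum, map_smul, map_mul] at h1
  rw [← h1]
  refine Finset.sum_congr rfl fun k _ => ?_
  rw [← hξ k]
  push_cast
  rfl

end gauge

variable {P : Type} [CommRing P] [Algebra ℂ P] {x : Fin n ⊕ Fin n → P}

/-- Homomorphisms from `P` are given by the values of the coordinates along the leaf. -/
def Represents (x : Fin n ⊕ Fin n → P) : Prop :=
  ∀ (T : Type) [CommRing T] [Algebra ℂ T] (y : Fin n ⊕ Fin n → T),
    (∀ v, 𝒟.free v → 𝒟.mon v ≠ 0 → IsUnit (y v)) →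
      ∃ ψ : P →ₐ[ℂ] T, ∀ v, 𝒟.free v → ψ (x v) = y v

/-- The homomorphism from the coordinate ring of the slice given by the coordinates `τ`. -/
def sliceLift {T : Type} [CommRing T] [Algebra ℂ T] (τ : 𝒟.F ⊕ 𝒟.F → T)
    (h : ∀ η ∈ lieAlg 𝒟.H, MvPolynomial.aeval τ (moment (sliceWeights B 𝒟.H) η) = 0) :
    𝒟.SliceRing →ₐ[ℂ] T :=
  Ideal.Quotient.liftₐ (redIdeal (sliceWeights B 𝒟.H) 𝒟.H)
    ((MvPolynomial.aeval τ).comp (invariants (sliceWeights B 𝒟.H) 𝒟.H).val) (by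
      intro q hq
      have hle : momentIdeal (sliceWeights B 𝒟.H) 𝒟.H ≤
          RingHom.ker (MvPolynomial.aeval (R := ℂ) τ) := by
        refine Ideal.span_le.2 ?_
        rintro _ ⟨η, hη, rfl⟩
        exact h η hη
      exact hle hq)

theorem sliceLift_mk {T : Type} [CommRing T] [Algebra ℂ T] (τ : 𝒟.F ⊕ 𝒟.F → T)
    (h : ∀ η ∈ lieAlg 𝒟.H, MvPolynomial.aeval τ (moment (sliceWeights B 𝒟.H) η) = 0)
    (q : invariants (sliceWeights B 𝒟.H) 𝒟.H) :
    𝒟.sliceLift τ h (𝒟.sliceMk q) = MvPolynomial.aeval τ (q : MvPolynomial (𝒟.F ⊕ 𝒟.F) ℂ) := rfl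

/-- In the gauge where all pivots are `1`, the moment equations dual to `I` determine their
partners, so all coordinates are recovered from those of the leaf and the slice. Invariants do not
notice the change of gauge. -/
theorem exists_factor (hrep : 𝒟.Represents x) {T : Type} [CommRing T] [Algebra ℂ T]
    (θ : MvPolynomial (Fin n ⊕ Fin n) ℂ →ₐ[ℂ] T)
    (hθ : ∀ v, 𝒟.mon v ≠ 0 → IsUnit (θ (MvPolynomial.X v))) (hμ : ∀ ξ, θ (moment B ξ) = 0) :
    ∃ ψ : P ⊗[ℂ] 𝒟.SliceRing →ₐ[ℂ] T, ∀ p : invariants B ⊤,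
      ψ (𝒟.coneMap x (Ideal.Quotient.mkₐ ℂ (redIdeal B ⊤) p)) =
        θ (p : MvPolynomial (Fin n ⊕ Fin n) ℂ) := by
  classical
  obtain ⟨t, ht⟩ := 𝒟.exists_gauge θ hθ
  set τ := 𝒟.gauge θ t with hτ
  obtain ⟨ψP, hψP⟩ := hrep T (fun v => τ (MvPolynomial.X v)) fun v _ hm => by
    rw [hτ, gauge_X]
    exact (𝒟.gaugeUnit t v).isUnit.mul (hθ v hm)
  let ψF : MvPolynomial (𝒟.F ⊕ 𝒟.F) ℂ →ₐ[ℂ] T :=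
    MvPolynomial.aeval fun u => τ (MvPolynomial.X (𝒟.emb u))
  let ψW : P ⊗[ℂ] MvPolynomial (𝒟.F ⊕ 𝒟.F) ℂ →ₐ[ℂ] T := Algebra.TensorProduct.productMap ψP ψF
  have hWt : ∀ p q, ψW (p ⊗ₜ q) = ψP p * ψF q := fun p q =>
    Algebra.TensorProduct.productMap_apply_tmul _ _ _ _
  have hbase : ∀ v, idx v ∉ 𝒟.I → ψW (𝒟.base x v) = τ (MvPolynomial.X v) := fun v hI => by
    by_cases hF : idx v ∈ 𝒟.F
    · obtain ⟨u, rfl⟩ := 𝒟.exists_emb hF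
      rw [base_emb, hWt, map_one, one_mul]
      exact MvPolynomial.aeval_X _ _
    · rw [𝒟.base_of_free x hF hI, hWt, map_one, mul_one, hψP v ⟨hF, hI⟩]
  have hpairs : ∀ i ∈ 𝒟.I ∪ 𝒟.J, ∑ k, (𝒟.c k i : ℂ) • (τ (MvPolynomial.X (Sum.inl k)) *
      τ (MvPolynomial.X (Sum.inr k))) = 0 := fun i hi => by
    simp only [hτ, gauge_pair]
    exact 𝒟.sum_pair_of_moment θ hμ hi
  have hpv : ∀ i ∈ 𝒟.I, ψW (𝒟.pairValue x i) =
      τ (MvPolynomial.X (Sum.inl i)) * τ (MvPolynomial.X (Sum.inr i)) := fun i hi => by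
    have h1 := hpairs i (Finset.mem_union_left _ hi)
    have h2 : ∀ k, (𝒟.c k i : ℂ) • (τ (MvPolynomial.X (Sum.inl k)) * τ (MvPolynomial.X (Sum.inr k)))
        = (if k = i then τ (MvPolynomial.X (Sum.inl i)) * τ (MvPolynomial.X (Sum.inr i)) else 0) +
          ψW ((𝒟.c k i : ℂ) • (𝒟.base x (Sum.inl k) * 𝒟.base x (Sum.inr k))) := fun k => by
      by_cases hk : k ∈ 𝒟.I
      · rw [𝒟.base_of_mem_I x (v := Sum.inl k) hk, zero_mul, smul_zero, map_zero, add_zero,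
          𝒟.basis.delta i (Finset.mem_union_left _ hi) k (Finset.mem_union_left _ hk)]
        split_ifs with h
        · rw [h, Int.cast_one, one_smul]
        · rw [Int.cast_zero, zero_smul]
      · rw [map_smul, map_mul, hbase (Sum.inl k) hk, hbase (Sum.inr k) hk, if_neg, zero_add]
        rintro rfl
        exact hk hi
    rw [Finset.sum_congr rfl fun k _ => h2 k, Finset.sum_add_distrib,
      Finset.sum_ite_eq' Finset.univ i, if_pos (Finset.mem_univ _), ← map_sum] at h1
    rw [pairValue, map_neg]
    exact (eq_neg_of_add_eq_zero_left h1).symm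
  -- The gauge-fixed coordinates are recovered from leaf and slice data: a pivot is `1` on both
  -- sides, and its partner equals the product of the pair.
  have hsub : ψW.comp (𝒟.sub x) = τ := by
    refine MvPolynomial.algHom_ext fun v => ?_
    rw [AlgHom.comp_apply, sub_X]
    by_cases hI : idx v ∈ 𝒟.I
    · by_cases hm : 𝒟.mon v = 0
      · rw [𝒟.coordImage_nonpivot x hI hm, hpv _ hI]
        rcases v with k | k
        · rcases 𝒟.mon_dichotomy hI with ⟨h1, h2⟩ | ⟨h1, h2⟩
          · exact absurd hm h1
          · rw [idx_inl] at h2 hI ⊢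
            rw [ht (Sum.inr k) hI h2, mul_one]
        · rcases 𝒟.mon_dichotomy hI with ⟨h1, h2⟩ | ⟨h1, h2⟩
          · rw [idx_inr] at h1 hI ⊢
            rw [ht (Sum.inl k) hI h1, one_mul]
          · exact absurd hm h2
      · rw [𝒟.coordImage_pivot x hI hm, map_one, ht v hI hm]
    · rw [𝒟.coordImage_of_not_mem x hI, hbase v hI]
  have hslice : ∀ η ∈ lieAlg 𝒟.H, ψF (moment (sliceWeights B 𝒟.H) η) = 0 := fun η hη => by
    have h1 := hμ η
    rw [moment, map_sum, 𝒟.sum_moved] at h1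
    · rw [← h1, moment, map_sum]
      refine Finset.sum_congr rfl fun k _ => ?_
      rw [map_smul, map_smul, map_mul, map_mul, ← 𝒟.gauge_pair θ t k]
      congr 1
      simp only [ψF, MvPolynomial.aeval_X]
      rfl
    · intro k hk
      rw [𝒟.lieAlg_pairing hη (𝒟.mem_E_of_not_mem_F hk), zero_smul, map_zero]
  refine ⟨Algebra.TensorProduct.productMap ψP (𝒟.sliceLift _ hslice), fun p => ?_⟩
  rw [coneMap_mk]
  have hcomm : (Algebra.TensorProduct.productMap ψP (𝒟.sliceLift _ hslice)).comp (𝒟.proj P) =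
      ψW.comp (𝒟.incl P) := by
    refine Algebra.TensorProduct.ext' fun a b => ?_
    rw [AlgHom.comp_apply, AlgHom.comp_apply, proj_tmul, incl_tmul, hWt,
      Algebra.TensorProduct.productMap_apply_tmul, sliceLift_mk]
  have h1 := congrArg (fun φ => φ (𝒟.resInv x p)) hcomm
  simp only [AlgHom.comp_apply] at h1
  rw [h1, incl_resInv]
  have h2 := congrArg (fun φ => φ (p : MvPolynomial (Fin n ⊕ Fin n) ℂ)) hsub
  simp only [AlgHom.comp_apply] at h2
  rw [h2, hτ, 𝒟.gauge_of_mem θ t p.2]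

/-- `exists_factor` is applied to the universal case: the coordinate ring of the zero fibre with the
chart monomial inverted. -/
theorem coneMap_eq_zero (hrep : 𝒟.Represents x) {a : Cone B} (ha : 𝒟.coneMap x a = 0) :
    ∃ K : ℕ, 𝒟.f ^ K * a = 0 := by
  obtain ⟨p, rfl⟩ := Ideal.Quotient.mkₐ_surjective ℂ (redIdeal B ⊤) a
  let S := MvPolynomial (Fin n ⊕ Fin n) ℂ ⧸ momentIdeal B (⊤ : Subgroup (Fin m → ℂˣ))
  let π : MvPolynomial (Fin n ⊕ Fin n) ℂ →ₐ[ℂ] S := Ideal.Quotient.mkₐ ℂ _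
  let M : MvPolynomial (Fin n ⊕ Fin n) ℂ := MvPolynomial.monomial 𝒟.mon 1
  let θ : MvPolynomial (Fin n ⊕ Fin n) ℂ →ₐ[ℂ] Localization.Away (π M) := (toLoc (π M)).comp π
  have hM : IsUnit (θ M) := IsLocalization.Away.algebraMap_isUnit (π M)
  have hθ : ∀ v, 𝒟.mon v ≠ 0 → IsUnit (θ (MvPolynomial.X v)) := fun v hv => by
    refine isUnit_of_dvd_unit (map_dvd θ ?_) hM
    rw [MvPolynomial.X_dvd_monomial]
    exact Or.inr hv
  have hμ : ∀ ξ, θ (moment B ξ) = 0 := fun ξ => by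
    have : π (moment B ξ) = 0 := Ideal.Quotient.eq_zero_iff_mem.2
      (Ideal.subset_span ⟨ξ, by rw [lieAlg_top]; trivial, rfl⟩)
    rw [AlgHom.comp_apply, this, map_zero]
  obtain ⟨ψ, hψ⟩ := 𝒟.exists_factor hrep θ hθ hμ
  have h1 := hψ p
  rw [ha, map_zero] at h1
  have h2 : algebraMap S (Localization.Away (π M)) (π p) = algebraMap S _ 0 := by
    rw [map_zero]
    exact h1.symm
  obtain ⟨⟨_, K, rfl⟩, hK⟩ := (IsLocalization.eq_iff_exists (Submonoid.powers (π M)) _).1 h2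
  refine ⟨K, ?_⟩
  simp only [mul_zero] at hK
  have h3 : M ^ K * (p : MvPolynomial (Fin n ⊕ Fin n) ℂ) ∈
      momentIdeal B (⊤ : Subgroup (Fin m → ℂˣ)) := by
    refine Ideal.Quotient.eq_zero_iff_mem.1 ?_
    rw [map_mul, map_pow]
    exact hK
  rw [f, redMon_of_isInv (IsInv.of_wt_eq_zero 𝒟.wt_mon), ← map_pow, ← map_mul]
  exact Ideal.Quotient.eq_zero_iff_mem.2 h3

theorem chart_injective (hx : 𝒟.Inverts x) (hrep : 𝒟.Represents x) :
    Function.Injective (𝒟.chart hx) :=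
  awayLift_injective _ fun _ ha => 𝒟.coneMap_eq_zero hrep ha

end ChartData

end Injectivity

/-! ### Brackets along a homomorphism -/

section Along

variable {S T : Type} [CommRing S] [Algebra ℂ S] [CommRing T] [Algebra ℂ T]

/-- `β` is a derivation along `φ` in each of its arguments. -/
structure IsBiderAlong (φ : S →ₐ[ℂ] T) (β : S →ₗ[ℂ] S →ₗ[ℂ] T) : Prop where
  right : ∀ u, IsDerAlong φ (β u)
  left : ∀ v, IsDerAlong φ (β.flip v)

namespace IsBiderAlong

variable {φ : S →ₐ[ℂ] T} {β β' : S →ₗ[ℂ] S →ₗ[ℂ] T}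

theorem add (h : IsBiderAlong φ β) (h' : IsBiderAlong φ β') : IsBiderAlong φ (β + β') :=
  ⟨fun u => (h.right u).add (h'.right u), fun v => (h.left v).add (h'.left v)⟩

theorem sub (h : IsBiderAlong φ β) (h' : IsBiderAlong φ β') : IsBiderAlong φ (β - β') :=
  ⟨fun u => (h.right u).sub (h'.right u), fun v => (h.left v).sub (h'.left v)⟩

theorem zero : IsBiderAlong φ (0 : S →ₗ[ℂ] S →ₗ[ℂ] T) :=
  ⟨fun _ => IsDerAlong.zero, fun _ => IsDerAlong.zero⟩

theorem sum {κ : Type} (s : Finset κ) (F : κ → S →ₗ[ℂ] S →ₗ[ℂ] T)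
    (h : ∀ i ∈ s, IsBiderAlong φ (F i)) : IsBiderAlong φ (∑ i ∈ s, F i) :=
  Finset.sum_induction F (IsBiderAlong φ) (fun _ _ => add) zero h

theorem mul {D E : S →ₗ[ℂ] T} (hD : IsDerAlong φ D) (hE : IsDerAlong φ E) :
    IsBiderAlong φ ((LinearMap.mul ℂ T).compl₁₂ D E) := by
  refine ⟨fun u a b => ?_, fun v a b => ?_⟩
  · simp only [LinearMap.compl₁₂_apply, LinearMap.mul_apply', hE a b]
    ring
  · simp only [LinearMap.flip_apply, LinearMap.compl₁₂_apply, LinearMap.mul_apply', hD a b]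
    ring

/-- The antisymmetrized product of two derivations. -/
def _root_.Hypertoric.wedge (D E : S →ₗ[ℂ] T) : S →ₗ[ℂ] S →ₗ[ℂ] T :=
  (LinearMap.mul ℂ T).compl₁₂ D E - (LinearMap.mul ℂ T).compl₁₂ E D

theorem _root_.Hypertoric.wedge_apply (D E : S →ₗ[ℂ] T) (u v : S) :
    wedge D E u v = D u * E v - E u * D v := rfl

theorem wedge {D E : S →ₗ[ℂ] T} (hD : IsDerAlong φ D) (hE : IsDerAlong φ E) :
    IsBiderAlong φ (wedge D E) := (mul hD hE).sub (mul hE hD)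

theorem of_comp (b : Biderivation S) {γ : S →ₗ[ℂ] S →ₗ[ℂ] T} (h : ∀ u v, γ u v = φ (b u v)) :
    IsBiderAlong φ γ := by
  refine ⟨fun u a c => ?_, fun v a c => ?_⟩
  · rw [h, h, h, Derivation.leibniz, map_add, smul_eq_mul, smul_eq_mul, map_mul, map_mul]
  · rw [LinearMap.flip_apply, LinearMap.flip_apply, LinearMap.flip_apply, h, h, h,
      Derivation.leibniz, Derivation.add_apply, Derivation.smul_apply, Derivation.smul_apply,
      map_add, smul_eq_mul, smul_eq_mul, map_mul, map_mul]

theorem comp {β : T →ₗ[ℂ] T →ₗ[ℂ] T} (h : IsBiderAlong (AlgHom.id ℂ T) β) (φ : S →ₐ[ℂ] T) :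
    IsBiderAlong φ (β.compl₁₂ φ.toLinearMap φ.toLinearMap) := by
  refine ⟨fun u a c => ?_, fun v a c => ?_⟩
  · have := h.right (φ u) (φ a) (φ c)
    simpa only [LinearMap.compl₁₂_apply, AlgHom.toLinearMap_apply, map_mul,
      AlgHom.id_apply] using this
  · have := h.left (φ v) (φ a) (φ c)
    simpa only [LinearMap.flip_apply, LinearMap.compl₁₂_apply, AlgHom.toLinearMap_apply, map_mul,
      AlgHom.id_apply] using this

theorem ext_X {σ : Type} {φ : MvPolynomial σ ℂ →ₐ[ℂ] T}
    {β β' : MvPolynomial σ ℂ →ₗ[ℂ] MvPolynomial σ ℂ →ₗ[ℂ] T}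
    (h : IsBiderAlong φ β) (h' : IsBiderAlong φ β')
    (hX : ∀ i j, β (MvPolynomial.X i) (MvPolynomial.X j) =
      β' (MvPolynomial.X i) (MvPolynomial.X j)) : β = β' := by
  refine LinearMap.ext fun u => (h.right u).ext_X (h'.right u) fun j => ?_
  exact LinearMap.congr_fun ((h.left (MvPolynomial.X j)).ext_X (h'.left (MvPolynomial.X j))
    fun i => hX i j) u

theorem ext_away {A : Type} [CommRing A] [Algebra ℂ A] {f : A} {φ : Localization.Away f →ₐ[ℂ] T}
    {β β' : Localization.Away f →ₗ[ℂ] Localization.Away f →ₗ[ℂ] T}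
    (h : IsBiderAlong φ β) (h' : IsBiderAlong φ β')
    (ha : ∀ a a', β (toLoc f a) (toLoc f a') = β' (toLoc f a) (toLoc f a')) : β = β' := by
  refine LinearMap.ext fun u => (h.right u).ext_away (h'.right u) fun a' => ?_
  exact LinearMap.congr_fun ((h.left (toLoc f a')).ext_away (h'.left (toLoc f a'))
    fun a => ha a a') u

end IsBiderAlong

/-- The composition of a bracket with a homomorphism. -/
def bracketComp (b : Biderivation S) (φ : S →ₐ[ℂ] T) : S →ₗ[ℂ] S →ₗ[ℂ] T :=
  LinearMap.mk₂ ℂ (fun u v => φ (b u v)) (by simp) (by simp) (by simp) (by simp)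

theorem bracketComp_apply (b : Biderivation S) (φ : S →ₐ[ℂ] T) (u v : S) :
    bracketComp b φ u v = φ (b u v) := rfl

theorem isBiderAlong_bracketComp (b : Biderivation S) (φ : S →ₐ[ℂ] T) :
    IsBiderAlong φ (bracketComp b φ) := .of_comp b fun _ _ => rfl

/-- Both sides are biderivations along the same homomorphism from the localization, so they are
compared on elements of `S`. -/
theorem awayLift_bracket {f : S} (b : Biderivation S) {β : T →ₗ[ℂ] T →ₗ[ℂ] T}
    (hβ : IsBiderAlong (AlgHom.id ℂ T) β) {φ : S →ₐ[ℂ] T} (hf : IsUnit (φ f))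
    (h : ∀ u v, φ (b u v) = β (φ u) (φ v)) (u v : Localization.Away f) :
    awayLift φ hf (awayBracket b f u v) = β (awayLift φ hf u) (awayLift φ hf v) := by
  have h1 := (isBiderAlong_bracketComp (awayBracket b f) (awayLift φ hf)).ext_away
    (hβ.comp (awayLift φ hf)) fun a a' => by
      rw [bracketComp_apply, LinearMap.compl₁₂_apply, AlgHom.toLinearMap_apply,
        AlgHom.toLinearMap_apply, awayLift_toLoc, awayLift_toLoc, ← h, ← awayLift_toLoc φ hf]
      exact congrArg _ (awayBracket_algebraMap b f a a')
  exact LinearMap.congr_fun₂ h1 u v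

end Along

/-! ### Product brackets -/

section Product

variable {A A' C C' : Type} [CommRing A] [Algebra ℂ A] [CommRing C] [Algebra ℂ C]
  [CommRing A'] [Algebra ℂ A'] [CommRing C'] [Algebra ℂ C']

theorem isBiderAlong_prodBracket (bA : Biderivation A) (bC : Biderivation C) :
    IsBiderAlong (AlgHom.id ℂ (A ⊗[ℂ] C)) (prodBracket bA bC) := by
  refine ⟨fun u v w => ?_, fun u v w => ?_⟩
  · simp only [AlgHom.id_apply]
    induction u using TensorProduct.induction_on with
    | zero => simp
    | add u u' h h' => simp only [map_add, LinearMap.add_apply, h, h', mul_add]; ring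
    | tmul u₁ u₂ =>
      induction v using TensorProduct.induction_on with
      | zero => simp
      | add v v' h h' => simp only [map_add, add_mul, mul_add, h, h']; ring
      | tmul v₁ v₂ =>
        induction w using TensorProduct.induction_on with
        | zero => simp
        | add w w' h h' => simp only [map_add, add_mul, mul_add, h, h']; ring
        | tmul w₁ w₂ =>
          simp only [Algebra.TensorProduct.tmul_mul_tmul, prodBracket_tmul, Derivation.leibniz,
            smul_eq_mul, mul_add, TensorProduct.add_tmul, TensorProduct.tmul_add]
          rw [add_add_add_comm]
          congr 3 <;> ring
  · simp only [AlgHom.id_apply, LinearMap.flip_apply]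
    induction u using TensorProduct.induction_on with
    | zero => simp
    | add u u' h h' => simp only [map_add, h, h', mul_add]; ring
    | tmul u₁ u₂ =>
      induction v using TensorProduct.induction_on with
      | zero => simp
      | add v v' h h' => simp only [map_add, LinearMap.add_apply, add_mul, mul_add, h, h']; ring
      | tmul v₁ v₂ =>
        induction w using TensorProduct.induction_on with
        | zero => simp
        | add w w' h h' => simp only [map_add, LinearMap.add_apply, add_mul, mul_add, h, h']; ring
        | tmul w₁ w₂ =>
          simp only [Algebra.TensorProduct.tmul_mul_tmul, prodBracket_tmul, Derivation.leibniz,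
            Derivation.add_apply, Derivation.smul_apply,
            smul_eq_mul, mul_add, TensorProduct.add_tmul, TensorProduct.tmul_add]
          rw [add_add_add_comm]
          congr 3 <;> ring

theorem map_prodBracket {bA : Biderivation A} {bC : Biderivation C} {bA' : Biderivation A'}
    {bC' : Biderivation C'} {φ : A →ₐ[ℂ] A'} {ψ : C →ₐ[ℂ] C'}
    (hφ : ∀ u v, φ (bA u v) = bA' (φ u) (φ v)) (hψ : ∀ u v, ψ (bC u v) = bC' (ψ u) (ψ v))
    (u v : A ⊗[ℂ] C) : Algebra.TensorProduct.map φ ψ (prodBracket bA bC u v) =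
      prodBracket bA' bC' (Algebra.TensorProduct.map φ ψ u) (Algebra.TensorProduct.map φ ψ v) := by
  induction u using TensorProduct.induction_on with
  | zero => simp
  | add u u' h h' => simp only [map_add, LinearMap.add_apply, h, h']
  | tmul u₁ u₂ =>
    induction v using TensorProduct.induction_on with
    | zero => simp
    | add v v' h h' => simp only [map_add, h, h']
    | tmul v₁ v₂ =>
      simp only [prodBracket_tmul, map_add, Algebra.TensorProduct.map_tmul, map_mul, hφ, hψ]

end Product

/-! ### The chart is a Poisson map -/

section Poisson

theorem redBracket_mk {ι : Type} [Fintype ι] {m : ℕ} (B : Matrix ι (Fin m) ℤ)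
    (H : Subgroup (Fin m → ℂˣ)) (u v : invariants B H) :
    redBracket B H (Ideal.Quotient.mkₐ ℂ (redIdeal B H) u)
      (Ideal.Quotient.mkₐ ℂ (redIdeal B H) v) = Ideal.Quotient.mkₐ ℂ (redIdeal B H)
        (subBracket (polyBracket ι) _ (bracket_mem_invariants B H) u v) :=
  quotBracket_mk _ _ (bracket_mem_redIdeal B H) (bracket_mem_redIdeal' B H) u v

open scoped Classical in
/-- The brackets of the coordinates. -/
def omega {ι : Type} (v w : ι ⊕ ι) : ℂ := if w = v.swap then (sgn v : ℂ) else 0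

theorem polyBracket_X_X {ι : Type} (v w : ι ⊕ ι) :
    polyBracket ι (MvPolynomial.X v) (MvPolynomial.X w) = algebraMap ℂ _ (omega v w) := by
  classical
  rcases v with v | v <;> rcases w with w | w <;>
    simp [polyBracket_inl, polyBracket_inr, omega, MvPolynomial.pderiv_X, Pi.single_apply,
      eq_comm, apply_ite]

theorem omega_eq_zero {ι : Type} {v w : ι ⊕ ι} (h : idx v ≠ idx w) : omega v w = 0 := by
  rw [omega, if_neg]
  rintro rfl
  rcases v with v | v <;> exact h rfl

theorem omega_self {ι : Type} (v : ι ⊕ ι) : omega v v = 0 := by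
  rw [omega, if_neg]
  rcases v with v | v <;> simp

theorem omega_of_ne {ι : Type} {v w : ι ⊕ ι} (h : idx v = idx w) (hne : v ≠ w) :
    omega v w = sgn v := by
  rw [omega, if_pos]
  rcases v with v | v <;> rcases w with w | w <;> simp_all

theorem omega_skew {ι : Type} (v w : ι ⊕ ι) : omega v w = -omega w v := by
  by_cases h : idx v = idx w
  · by_cases hne : v = w
    · rw [hne, omega_self, neg_zero]
    · rw [omega_of_ne h hne, omega_of_ne h.symm (Ne.symm hne)]
      rcases v with v | v <;> rcases w with w | w <;> simp_all
  · rw [omega_eq_zero h, omega_eq_zero (Ne.symm h), neg_zero]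

variable {n m : ℕ} {B : Matrix (Fin n) (Fin m) ℤ}

namespace ChartData

variable (𝒟 : ChartData B)

/-- The vector field generated by the torus in the direction dual to `i`. -/
def euler (i : Fin n) :
    Derivation ℂ (MvPolynomial (Fin n ⊕ Fin n) ℂ) (MvPolynomial (Fin n ⊕ Fin n) ℂ) :=
  ∑ v, ((sgn v * 𝒟.c (idx v) i : ℤ) : ℂ) • (MvPolynomial.X (R := ℂ) v • MvPolynomial.pderiv v)

theorem euler_X (i : Fin n) (w : Fin n ⊕ Fin n) : 𝒟.euler i (MvPolynomial.X w) =
    ((sgn w * 𝒟.c (idx w) i : ℤ) : ℂ) • MvPolynomial.X w := by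
  classical
  rw [euler, Derivation.sum_apply, Finset.sum_eq_single w]
  · simp
  · intro v _ hv
    simp [MvPolynomial.pderiv_X, hv.symm]
  · simp

/-- On a monomial the vector field is multiplication by the `i`-th coordinate of its weight. -/
theorem euler_of_mem {i : Fin n} (hi : i ∈ 𝒟.I) {p : MvPolynomial (Fin n ⊕ Fin n) ℂ}
    (hp : p ∈ invariants B ⊤) : 𝒟.euler i p = 0 := by
  rw [p.as_sum, map_sum]
  refine Finset.sum_eq_zero fun s hs => ?_
  have hs0 : wt B s = 0 := isInv_top_iff.1 (mem_invariants_iff.1 hp s hs)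
  rw [euler, Derivation.sum_apply]
  simp only [Derivation.smul_apply, smul_eq_mul, MvPolynomial.X_mul_pderiv_monomial]
  have h3 : ∑ v, sgn v * s v * 𝒟.c (idx v) i =
      ∑ k, ((s (Sum.inl k) : ℤ) - s (Sum.inr k)) * 𝒟.c k i := by
    rw [Fintype.sum_sum_type, ← Finset.sum_add_distrib]
    refine Finset.sum_congr rfl fun k _ => ?_
    simp only [sgn_inl, sgn_inr, idx_inl, idx_inr]
    ring
  have h4 := h3.trans (𝒟.basis.rel_coord ((wt_eq_sum s).symm.trans hs0)
    (Finset.mem_union_left _ hi))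
  have h5 : ∀ v, ((sgn v * 𝒟.c (idx v) i : ℤ) : ℂ) •
      s v • MvPolynomial.monomial s (MvPolynomial.coeff s p) =
      ((sgn v * s v * 𝒟.c (idx v) i : ℤ) : ℂ) •
        MvPolynomial.monomial s (MvPolynomial.coeff s p) := fun v => by
    rw [← Nat.cast_smul_eq_nsmul ℂ, smul_smul]
    congr 1
    push_cast
    ring
  rw [Finset.sum_congr rfl fun v _ => h5 v, ← Finset.sum_smul, ← Int.cast_sum, h4, Int.cast_zero,
    zero_smul]

open scoped Classical in
/-- The coordinate of index `i` that is eliminated by the moment map. -/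
def elim (i : Fin n) : Fin n ⊕ Fin n := if 𝒟.mon (Sum.inl i) ≠ 0 then Sum.inr i else Sum.inl i

theorem idx_elim (i : Fin n) : idx (𝒟.elim i) = i := by
  rw [elim]
  split_ifs <;> rfl

theorem mon_elim {i : Fin n} (hi : i ∈ 𝒟.I) : 𝒟.mon (𝒟.elim i) = 0 := by
  rw [elim]
  rcases 𝒟.mon_dichotomy hi with ⟨h1, h2⟩ | ⟨h1, h2⟩
  · rw [if_pos h1, h2]
  · rw [if_neg (not_not.2 h1), h1]

theorem eq_elim {v : Fin n ⊕ Fin n} (hI : idx v ∈ 𝒟.I) (hm : 𝒟.mon v = 0) :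
    v = 𝒟.elim (idx v) := by
  rw [elim]
  rcases 𝒟.mon_dichotomy hI with ⟨h1, h2⟩ | ⟨h1, h2⟩
  · rw [if_pos h1]
    rcases v with k | k
    · exact absurd hm h1
    · rfl
  · rw [if_neg (not_not.2 h1)]
    rcases v with k | k
    · rfl
    · exact absurd hm h2

variable {P : Type} [CommRing P] [Algebra ℂ P] (x : Fin n ⊕ Fin n → P)

/-- The restriction to the slice of the vector field generated by the torus. -/
def eulerAlong (i : Fin n) :
    MvPolynomial (Fin n ⊕ Fin n) ℂ →ₗ[ℂ] P ⊗[ℂ] MvPolynomial (𝒟.F ⊕ 𝒟.F) ℂ :=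
  (𝒟.sub x).toLinearMap ∘ₗ (𝒟.euler i : _ →ₗ[ℂ] _)

/-- The restriction to the slice of the derivative by an eliminated coordinate. -/
def elimAlong (i : Fin n) :
    MvPolynomial (Fin n ⊕ Fin n) ℂ →ₗ[ℂ] P ⊗[ℂ] MvPolynomial (𝒟.F ⊕ 𝒟.F) ℂ :=
  (𝒟.sub x).toLinearMap ∘ₗ
    (MvPolynomial.pderiv (𝒟.elim i) : Derivation ℂ _ (MvPolynomial (Fin n ⊕ Fin n) ℂ)).toLinearMap

theorem isDerAlong_comp {S T : Type} [CommRing S] [Algebra ℂ S] [CommRing T] [Algebra ℂ T]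
    (φ : S →ₐ[ℂ] T) (D : Derivation ℂ S S) :
    IsDerAlong φ (φ.toLinearMap ∘ₗ (D : S →ₗ[ℂ] S)) := fun a b => by
  simp

theorem eulerAlong_X (i : Fin n) (w : Fin n ⊕ Fin n) : 𝒟.eulerAlong x i (MvPolynomial.X w) =
    ((sgn w * 𝒟.c (idx w) i : ℤ) : ℂ) • 𝒟.coordImage x w := by
  rw [← sub_X, ← map_smul, ← euler_X]
  rfl

theorem elimAlong_X (i : Fin n) (w : Fin n ⊕ Fin n) : 𝒟.elimAlong x i (MvPolynomial.X w) =
    if w = 𝒟.elim i then 1 else 0 := by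
  classical
  have h1 : 𝒟.elimAlong x i (MvPolynomial.X w) =
      𝒟.sub x (MvPolynomial.pderiv (𝒟.elim i) (MvPolynomial.X w)) := rfl
  rw [h1, MvPolynomial.pderiv_X, Pi.single_apply]
  simp only [eq_comm]
  split_ifs <;> simp

/-- The terms by which the restriction to the slice fails to preserve brackets. -/
def defect : MvPolynomial (Fin n ⊕ Fin n) ℂ →ₗ[ℂ] MvPolynomial (Fin n ⊕ Fin n) ℂ →ₗ[ℂ]
    P ⊗[ℂ] MvPolynomial (𝒟.F ⊕ 𝒟.F) ℂ :=
  ∑ i ∈ 𝒟.I, wedge (𝒟.eulerAlong x i) (𝒟.elimAlong x i)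

theorem isBiderAlong_defect : IsBiderAlong (𝒟.sub x) (𝒟.defect x) :=
  .sum _ _ fun _ _ => .wedge (isDerAlong_comp _ _) (isDerAlong_comp _ _)

theorem defect_apply (u v : MvPolynomial (Fin n ⊕ Fin n) ℂ) : 𝒟.defect x u v =
    ∑ i ∈ 𝒟.I, (𝒟.eulerAlong x i u * 𝒟.elimAlong x i v -
      𝒟.elimAlong x i u * 𝒟.eulerAlong x i v) := by
  simp only [defect, LinearMap.sum_apply, wedge_apply]

/-- Every term contains the derivative of an invariant along a torus direction. -/
theorem defect_of_mem {u v : MvPolynomial (Fin n ⊕ Fin n) ℂ} (hu : u ∈ invariants B ⊤)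
    (hv : v ∈ invariants B ⊤) : 𝒟.defect x u v = 0 := by
  rw [defect_apply]
  refine Finset.sum_eq_zero fun i hi => ?_
  have h : ∀ w ∈ invariants B (⊤ : Subgroup (Fin m → ℂˣ)), 𝒟.eulerAlong x i w = 0 :=
    fun w hw => by
    have h1 : 𝒟.eulerAlong x i w = 𝒟.sub x (𝒟.euler i w) := rfl
    rw [h1, 𝒟.euler_of_mem hi hw, map_zero]
  rw [h u hu, h v hv, zero_mul, mul_zero, sub_zero]

variable {x} {bP : Biderivation P}

/-- The bracket of `P` is the standard one on the coordinates along the leaf. -/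
def IsCanonical (x : Fin n ⊕ Fin n → P) (bP : Biderivation P) : Prop :=
  ∀ v w, 𝒟.free v → 𝒟.free w → bP (x v) (x w) = algebraMap ℂ P (omega v w)

/-- The bracket on the slice and the leaf. -/
def outerBracket (bP : Biderivation P) : P ⊗[ℂ] MvPolynomial (𝒟.F ⊕ 𝒟.F) ℂ →ₗ[ℂ]
    P ⊗[ℂ] MvPolynomial (𝒟.F ⊕ 𝒟.F) ℂ →ₗ[ℂ] P ⊗[ℂ] MvPolynomial (𝒟.F ⊕ 𝒟.F) ℂ :=
  prodBracket bP (polyBracket 𝒟.F)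

theorem isBiderAlong_outer (bP : Biderivation P) :
    IsBiderAlong (AlgHom.id ℂ _) (𝒟.outerBracket bP) := isBiderAlong_prodBracket _ _

theorem outer_base_base (hb : 𝒟.IsCanonical x bP) {v w : Fin n ⊕ Fin n} (hv : idx v ∉ 𝒟.I)
    (hw : idx w ∉ 𝒟.I) : 𝒟.outerBracket bP (𝒟.base x v) (𝒟.base x w) =
      algebraMap ℂ _ (omega v w) := by
  rw [Algebra.algebraMap_eq_smul_one]
  by_cases hvF : idx v ∈ 𝒟.F <;> by_cases hwF : idx w ∈ 𝒟.F
  · obtain ⟨v, rfl⟩ := 𝒟.exists_emb hvF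
    obtain ⟨w, rfl⟩ := 𝒟.exists_emb hwF
    have h1 : omega (𝒟.emb v) (𝒟.emb w) = omega v w := by
      have h2 : (𝒟.emb v).swap = 𝒟.emb v.swap := by rcases v with v | v <;> rfl
      simp only [omega, h2, 𝒟.emb_injective.eq_iff, sgn_emb]
      split_ifs <;> rfl
    rw [base_emb, base_emb, outerBracket, prodBracket_tmul, Derivation.map_one_eq_zero,
      TensorProduct.zero_tmul, zero_add, polyBracket_X_X, h1, one_mul,
      Algebra.algebraMap_eq_smul_one, TensorProduct.tmul_smul]
    rfl
  · obtain ⟨v, rfl⟩ := 𝒟.exists_emb hvF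
    rw [omega_eq_zero fun h => hwF (h ▸ hvF : idx w ∈ 𝒟.F), zero_smul, base_emb, 𝒟.base_of_free x hwF hw,
      outerBracket, prodBracket_tmul, Derivation.map_one_eq_zero, Derivation.map_one_eq_zero,
      Derivation.zero_apply, TensorProduct.zero_tmul, TensorProduct.tmul_zero, zero_add]
  · obtain ⟨w, rfl⟩ := 𝒟.exists_emb hwF
    rw [omega_eq_zero (v := v) fun h => hvF (h.symm ▸ hwF : idx v ∈ 𝒟.F), zero_smul, base_emb, 𝒟.base_of_free x hvF hv,
      outerBracket, prodBracket_tmul, Derivation.map_one_eq_zero, Derivation.map_one_eq_zero,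
      Derivation.zero_apply, TensorProduct.zero_tmul, TensorProduct.tmul_zero, zero_add]
  · rw [𝒟.base_of_free x hvF hv, 𝒟.base_of_free x hwF hw, outerBracket, prodBracket_tmul,
      Derivation.map_one_eq_zero, TensorProduct.tmul_zero, add_zero,
      hb v w ⟨hvF, hv⟩ ⟨hwF, hw⟩, one_mul, Algebra.algebraMap_eq_smul_one,
      ← TensorProduct.smul_tmul']
    rfl

/-- Up to sign, `pairValue x i` is the moment component dual to `i` for the coordinates with index
outside `I`, so its Hamiltonian vector field generates the corresponding torus action. -/
theorem outer_pairValue_base (hb : 𝒟.IsCanonical x bP) (i : Fin n) {w : Fin n ⊕ Fin n}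
    (hw : idx w ∉ 𝒟.I) : 𝒟.outerBracket bP (𝒟.pairValue x i) (𝒟.base x w) =
      ((sgn w * 𝒟.c (idx w) i : ℤ) : ℂ) • 𝒟.base x w := by
  classical
  have hterm : ∀ k, 𝒟.outerBracket bP (𝒟.base x (Sum.inl k) * 𝒟.base x (Sum.inr k))
      (𝒟.base x w) = if k = idx w then -(sgn w : ℂ) • 𝒟.base x w else 0 := fun k => by
    have h0 := (𝒟.isBiderAlong_outer bP).left (𝒟.base x w) (𝒟.base x (Sum.inl k))
      (𝒟.base x (Sum.inr k))
    simp only [LinearMap.flip_apply, AlgHom.id_apply] at h0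
    rw [h0]
    by_cases hk : k ∈ 𝒟.I
    · rw [𝒟.base_of_mem_I x (v := Sum.inl k) hk, 𝒟.base_of_mem_I x (v := Sum.inr k) hk, if_neg]
      · simp
      · rintro rfl
        exact hw hk
    · rw [𝒟.outer_base_base hb (v := Sum.inr k) hk hw, 𝒟.outer_base_base hb (v := Sum.inl k) hk hw]
      by_cases hkw : k = idx w
      · rw [if_pos hkw]
        rcases w with w | w
        · obtain rfl : k = w := hkw
          rw [omega_self, omega_of_ne (v := Sum.inr k) (w := Sum.inl k) rfl (by simp)]
          simp [Algebra.algebraMap_eq_smul_one]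
        · obtain rfl : k = w := hkw
          rw [omega_self, omega_of_ne (v := Sum.inl k) (w := Sum.inr k) rfl (by simp)]
          simp [Algebra.algebraMap_eq_smul_one]
      · rw [if_neg hkw, omega_eq_zero (by exact hkw), omega_eq_zero (by exact hkw), map_zero,
          mul_zero, mul_zero, add_zero]
  rw [pairValue, map_neg, LinearMap.neg_apply, map_sum, LinearMap.sum_apply]
  simp only [map_smul, LinearMap.smul_apply, hterm]
  rw [Finset.sum_eq_single (idx w)]
  · rw [if_pos rfl, smul_smul, ← neg_smul]
    congr 1
    push_cast
    ring
  · intro k _ hk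
    rw [if_neg hk, smul_zero]
  · simp

theorem outer_skew_base (hb : 𝒟.IsCanonical x bP) (i : Fin n) {w : Fin n ⊕ Fin n}
    (hw : idx w ∉ 𝒟.I) : 𝒟.outerBracket bP (𝒟.base x w) (𝒟.pairValue x i) =
      -𝒟.outerBracket bP (𝒟.pairValue x i) (𝒟.base x w) := by
  have hterm : ∀ k, 𝒟.outerBracket bP (𝒟.base x w) (𝒟.base x (Sum.inl k) * 𝒟.base x (Sum.inr k)) =
      -𝒟.outerBracket bP (𝒟.base x (Sum.inl k) * 𝒟.base x (Sum.inr k)) (𝒟.base x w) := fun k => by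
    have h0 := (𝒟.isBiderAlong_outer bP).left (𝒟.base x w) (𝒟.base x (Sum.inl k))
      (𝒟.base x (Sum.inr k))
    have h1 := (𝒟.isBiderAlong_outer bP).right (𝒟.base x w) (𝒟.base x (Sum.inl k))
      (𝒟.base x (Sum.inr k))
    simp only [LinearMap.flip_apply, AlgHom.id_apply] at h0 h1
    rw [h0, h1]
    by_cases hk : k ∈ 𝒟.I
    · rw [𝒟.base_of_mem_I x (v := Sum.inl k) hk, 𝒟.base_of_mem_I x (v := Sum.inr k) hk]
      simp
    · rw [𝒟.outer_base_base hb (v := Sum.inr k) hk hw, 𝒟.outer_base_base hb (v := Sum.inl k) hk hw,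
        𝒟.outer_base_base hb (w := Sum.inr k) hw hk, 𝒟.outer_base_base hb (w := Sum.inl k) hw hk,
        omega_skew w, omega_skew w, map_neg, map_neg]
      ring
  rw [pairValue, map_neg, map_neg, LinearMap.neg_apply, map_sum, map_sum, LinearMap.sum_apply]
  refine congrArg Neg.neg ?_
  rw [← Finset.sum_neg_distrib]
  refine Finset.sum_congr rfl fun k _ => ?_
  rw [map_smul, map_smul, LinearMap.smul_apply, hterm, smul_neg]

/-- The weights of `x_k` and `y_k` are opposite, so the torus action generated by `pairValue x i`
fixes every product `x_k y_k`. -/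
theorem outer_pairValue_pairValue (hb : 𝒟.IsCanonical x bP) (i j : Fin n) :
    𝒟.outerBracket bP (𝒟.pairValue x i) (𝒟.pairValue x j) = 0 := by
  have hterm : ∀ k, 𝒟.outerBracket bP (𝒟.pairValue x i)
      (𝒟.base x (Sum.inl k) * 𝒟.base x (Sum.inr k)) = 0 := fun k => by
    have h1 := (𝒟.isBiderAlong_outer bP).right (𝒟.pairValue x i) (𝒟.base x (Sum.inl k))
      (𝒟.base x (Sum.inr k))
    simp only [AlgHom.id_apply] at h1
    rw [h1]
    by_cases hk : k ∈ 𝒟.I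
    · rw [𝒟.base_of_mem_I x (v := Sum.inl k) hk, 𝒟.base_of_mem_I x (v := Sum.inr k) hk]
      simp
    · rw [𝒟.outer_pairValue_base hb i (w := Sum.inr k) hk,
        𝒟.outer_pairValue_base hb i (w := Sum.inl k) hk, mul_smul_comm, mul_smul_comm,
        mul_comm (𝒟.base x (Sum.inr k)), ← add_smul]
      simp
  have h2 : 𝒟.pairValue x j = -∑ k, (𝒟.c k j : ℂ) •
    (𝒟.base x (Sum.inl k) * 𝒟.base x (Sum.inr k)) := rfl
  rw [h2, map_neg, map_sum]
  simp only [map_smul, hterm, smul_zero, Finset.sum_const_zero, neg_zero]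

variable (x) in
open scoped Classical in
/-- A part of the defect of a pair of coordinates. -/
def defectTerm (v w : Fin n ⊕ Fin n) : P ⊗[ℂ] MvPolynomial (𝒟.F ⊕ 𝒟.F) ℂ :=
  if idx w ∈ 𝒟.I ∧ 𝒟.mon w = 0 then
    ((sgn v * 𝒟.c (idx v) (idx w) : ℤ) : ℂ) • 𝒟.coordImage x v else 0

variable (x) in
theorem defectTerm_of {v w : Fin n ⊕ Fin n} (hw : idx w ∈ 𝒟.I) (hm : 𝒟.mon w = 0) :
    𝒟.defectTerm x v w = ((sgn v * 𝒟.c (idx v) (idx w) : ℤ) : ℂ) • 𝒟.coordImage x v :=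
  if_pos ⟨hw, hm⟩

variable (x) in
theorem defectTerm_of_not (v : Fin n ⊕ Fin n) {w : Fin n ⊕ Fin n}
    (h : ¬ (idx w ∈ 𝒟.I ∧ 𝒟.mon w = 0)) : 𝒟.defectTerm x v w = 0 :=
  if_neg h

variable (x) in
theorem defectTerm_of_eq {v w : Fin n ⊕ Fin n} (hw : idx w ∈ 𝒟.I) (hm : 𝒟.mon w = 0)
    (h : idx v = idx w) : 𝒟.defectTerm x v w = (sgn v : ℂ) • 𝒟.coordImage x v := by
  rw [𝒟.defectTerm_of x hw hm, h, 𝒟.basis.delta _ (Finset.mem_union_left _ hw) _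
    (Finset.mem_union_left _ hw), if_pos rfl, mul_one]

variable (x) in
theorem defectTerm_of_ne {v w : Fin n ⊕ Fin n} (hv : idx v ∈ 𝒟.I) (h : idx v ≠ idx w) :
    𝒟.defectTerm x v w = 0 := by
  by_cases hw : idx w ∈ 𝒟.I ∧ 𝒟.mon w = 0
  · rw [𝒟.defectTerm_of x hw.1 hw.2, 𝒟.basis.delta _ (Finset.mem_union_left _ hw.1) _
      (Finset.mem_union_left _ hv), if_neg h, mul_zero, Int.cast_zero, zero_smul]
  · exact 𝒟.defectTerm_of_not x v hw

theorem defect_X_X (v w : Fin n ⊕ Fin n) :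
    𝒟.defect x (MvPolynomial.X v) (MvPolynomial.X w) =
      𝒟.defectTerm x v w - 𝒟.defectTerm x w v := by
  have key : ∀ v w : Fin n ⊕ Fin n, ∑ i ∈ 𝒟.I,
      𝒟.eulerAlong x i (MvPolynomial.X v) * 𝒟.elimAlong x i (MvPolynomial.X w) =
      𝒟.defectTerm x v w := fun v w => by
    simp only [eulerAlong_X, elimAlong_X]
    by_cases h : idx w ∈ 𝒟.I ∧ 𝒟.mon w = 0
    · rw [𝒟.defectTerm_of x h.1 h.2, Finset.sum_eq_single (idx w), if_pos (𝒟.eq_elim h.1 h.2),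
        mul_one]
      · intro i _ hi
        rw [if_neg, mul_zero]
        intro hw
        rw [hw, idx_elim] at hi
        exact hi rfl
      · exact fun hw => absurd h.1 hw
    · rw [𝒟.defectTerm_of_not x v h]
      refine Finset.sum_eq_zero fun i hi => ?_
      rw [if_neg, mul_zero]
      rintro rfl
      exact h ⟨by rwa [idx_elim], 𝒟.mon_elim hi⟩
  rw [defect_apply, Finset.sum_sub_distrib, key, ← key w v]
  simp only [mul_comm]

theorem eq_of_pivot {v w : Fin n ⊕ Fin n} (hI : idx v ∈ 𝒟.I) (h : idx v = idx w)
    (hm : 𝒟.mon v = 0 ↔ 𝒟.mon w = 0) : v = w := by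
  rcases 𝒟.mon_dichotomy hI with ⟨h1, h2⟩ | ⟨h1, h2⟩ <;> rcases v with v | v <;>
    rcases w with w | w <;> simp only [idx_inl, idx_inr] at h hI h1 h2 <;> subst h <;> simp_all

/-- The restriction to the slice preserves brackets up to the defect. -/
theorem sub_bracket (hb : 𝒟.IsCanonical x bP) (u v : MvPolynomial (Fin n ⊕ Fin n) ℂ) :
    𝒟.sub x (polyBracket (Fin n) u v) =
      𝒟.outerBracket bP (𝒟.sub x u) (𝒟.sub x v) + 𝒟.defect x u v := by
  -- Both sides are biderivations along the restriction, so only pairs of coordinates matter.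
  have key := (isBiderAlong_bracketComp (polyBracket (Fin n)) (𝒟.sub x)).ext_X
    (((𝒟.isBiderAlong_outer bP).comp (𝒟.sub x)).add (𝒟.isBiderAlong_defect x)) fun v w => ?_
  · exact LinearMap.congr_fun₂ key u v
  rw [bracketComp_apply, polyBracket_X_X, AlgHom.commutes, LinearMap.add_apply,
    LinearMap.add_apply, LinearMap.compl₁₂_apply, AlgHom.toLinearMap_apply,
    AlgHom.toLinearMap_apply, sub_X, sub_X, defect_X_X]
  have hone : ∀ y, 𝒟.outerBracket bP 1 y = 0 := fun y =>
    ((𝒟.isBiderAlong_outer bP).left y).map_one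
  have hone' : ∀ y, 𝒟.outerBracket bP y 1 = 0 := fun y =>
    ((𝒟.isBiderAlong_outer bP).right y).map_one
  by_cases hv : idx v ∈ 𝒟.I
  · by_cases hw : idx w ∈ 𝒟.I
    · by_cases h : idx v = idx w
      -- For a pivot and its partner the bracket on the product vanishes, since the pivot has become
      -- constant; the value `±1` comes from the defect alone.
      · by_cases hmv : 𝒟.mon v = 0 <;> by_cases hmw : 𝒟.mon w = 0
        · obtain rfl := 𝒟.eq_of_pivot hv h (iff_of_true hmv hmw)
          rw [𝒟.coordImage_nonpivot x hv hmv, 𝒟.outer_pairValue_pairValue hb, omega_self, map_zero,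
            sub_self, add_zero]
        · rw [𝒟.coordImage_pivot x hw hmw, hone', omega_skew,
            omega_of_ne h.symm fun h' => hmw (h' ▸ hmv),
            𝒟.defectTerm_of_not x v fun h' => hmw h'.2, 𝒟.defectTerm_of_eq x hv hmv h.symm,
            𝒟.coordImage_pivot x hw hmw, map_neg, Algebra.algebraMap_eq_smul_one, zero_sub,
            zero_add]
        · rw [𝒟.coordImage_pivot x hv hmv, hone, omega_of_ne h fun h' => hmv (h' ▸ hmw),
            𝒟.defectTerm_of_not x w fun h' => hmv h'.2, 𝒟.defectTerm_of_eq x hw hmw h,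
            𝒟.coordImage_pivot x hv hmv, Algebra.algebraMap_eq_smul_one, sub_zero, zero_add]
        · obtain rfl := 𝒟.eq_of_pivot hv h (iff_of_false hmv hmw)
          rw [𝒟.coordImage_pivot x hv hmv, hone, omega_self, map_zero, sub_self, add_zero]
      · rw [omega_eq_zero h, 𝒟.defectTerm_of_ne x hv h, 𝒟.defectTerm_of_ne x hw (Ne.symm h),
          map_zero, sub_self, add_zero]
        by_cases hmv : 𝒟.mon v = 0 <;> by_cases hmw : 𝒟.mon w = 0
        · rw [𝒟.coordImage_nonpivot x hv hmv, 𝒟.coordImage_nonpivot x hw hmw,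
            𝒟.outer_pairValue_pairValue hb]
        · rw [𝒟.coordImage_pivot x hw hmw, hone']
        · rw [𝒟.coordImage_pivot x hv hmv, hone]
        · rw [𝒟.coordImage_pivot x hv hmv, hone]
    · rw [omega_eq_zero fun h => hw (h ▸ hv), map_zero,
        𝒟.defectTerm_of_not x v fun h => hw h.1]
      -- For an eliminated coordinate and one with index outside `I`, the polynomial bracket is
      -- zero; the defect cancels the torus action generated by `pairValue`.
      by_cases hmv : 𝒟.mon v = 0
      · rw [𝒟.defectTerm_of x hv hmv, 𝒟.coordImage_of_not_mem x hw,
          𝒟.coordImage_nonpivot x hv hmv, 𝒟.outer_pairValue_base hb _ hw, zero_sub, add_neg_cancel]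
      · rw [𝒟.coordImage_pivot x hv hmv, hone, 𝒟.defectTerm_of_not x w fun h => hmv h.2, sub_zero,
          add_zero]
  · rw [𝒟.defectTerm_of_not x w fun h => hv h.1, sub_zero]
    by_cases hw : idx w ∈ 𝒟.I
    · rw [omega_eq_zero fun h => hv (h.symm ▸ hw : idx v ∈ 𝒟.I), map_zero]
      by_cases hmw : 𝒟.mon w = 0
      · rw [𝒟.defectTerm_of x hw hmw, 𝒟.coordImage_of_not_mem x hv,
          𝒟.coordImage_nonpivot x hw hmw, 𝒟.outer_skew_base hb _ hv,
          𝒟.outer_pairValue_base hb _ hv, neg_add_cancel]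
      · rw [𝒟.coordImage_pivot x hw hmw, hone', 𝒟.defectTerm_of_not x v fun h => hmw h.2, add_zero]
    · rw [𝒟.coordImage_of_not_mem x hv, 𝒟.coordImage_of_not_mem x hw, 𝒟.outer_base_base hb hv hw,
        𝒟.defectTerm_of_not x v fun h => hw h.1, add_zero]

theorem resInv_bracket (hb : 𝒟.IsCanonical x bP) (p q : invariants B ⊤) :
    𝒟.resInv x (subBracket (polyBracket (Fin n)) _ (bracket_mem_invariants B ⊤) p q) =
      prodBracket bP (subBracket (polyBracket 𝒟.F) _ (bracket_mem_invariants (sliceWeights B 𝒟.H) 𝒟.H))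
        (𝒟.resInv x p) (𝒟.resInv x q) := by
  refine 𝒟.resInv_eq x ?_
  rw [incl, map_prodBracket (bA' := bP) (bC' := polyBracket 𝒟.F) (fun _ _ => rfl) fun _ _ => rfl]
  have h1 := 𝒟.incl_resInv x p
  have h2 := 𝒟.incl_resInv x q
  rw [incl] at h1 h2
  rw [h1, h2, subBracket_apply, 𝒟.sub_bracket hb, 𝒟.defect_of_mem x p.2 q.2, add_zero]
  rfl

theorem sliceMk_bracket (u v : invariants (sliceWeights B 𝒟.H) 𝒟.H) :
    𝒟.sliceBracket (𝒟.sliceMk u) (𝒟.sliceMk v) = 𝒟.sliceMk (subBracket (polyBracket 𝒟.F) _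
      (bracket_mem_invariants (sliceWeights B 𝒟.H) 𝒟.H) u v) :=
  redBracket_mk (sliceWeights B 𝒟.H) 𝒟.H u v

theorem proj_bracket (u v : P ⊗[ℂ] invariants (sliceWeights B 𝒟.H) 𝒟.H) :
    𝒟.proj P (prodBracket bP (subBracket (polyBracket 𝒟.F) _
      (bracket_mem_invariants (sliceWeights B 𝒟.H) 𝒟.H)) u v) =
      prodBracket bP 𝒟.sliceBracket (𝒟.proj P u) (𝒟.proj P v) :=
  map_prodBracket (φ := AlgHom.id ℂ P) (ψ := 𝒟.sliceMk) (fun _ _ => rfl)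
    (fun p q => (𝒟.sliceMk_bracket p q).symm) u v

theorem coneMap_bracket (hb : 𝒟.IsCanonical x bP) (a a' : Cone B) :
    𝒟.coneMap x (redBracket B ⊤ a a') =
      prodBracket bP 𝒟.sliceBracket (𝒟.coneMap x a) (𝒟.coneMap x a') := by
  obtain ⟨p, rfl⟩ := Ideal.Quotient.mkₐ_surjective ℂ (redIdeal B ⊤) a
  obtain ⟨q, rfl⟩ := Ideal.Quotient.mkₐ_surjective ℂ (redIdeal B ⊤) a'
  rw [redBracket_mk, coneMap_mk, coneMap_mk, coneMap_mk, 𝒟.resInv_bracket hb,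
    proj_bracket]

theorem chart_bracket (hx : 𝒟.Inverts x) (hb : 𝒟.IsCanonical x bP) (u v : Localization.Away 𝒟.f) :
    𝒟.chart hx (awayBracket (redBracket B ⊤) 𝒟.f u v) =
      prodBracket bP 𝒟.sliceBracket (𝒟.chart hx u) (𝒟.chart hx v) :=
  awayLift_bracket _ (isBiderAlong_prodBracket _ _) _ (𝒟.coneMap_bracket hb) u v

end ChartData

end Poisson

/-! ### Equivariance of the chart -/

section Equivariance

theorem away_algHom_ext {A T : Type} [CommRing A] [Algebra ℂ A] [CommRing T] [Algebra ℂ T] {f : A}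
    {φ ψ : Localization.Away f →ₐ[ℂ] T} (h : ∀ a, φ (toLoc f a) = ψ (toLoc f a)) : φ = ψ := by
  have h1 : φ.toRingHom = ψ.toRingHom :=
    IsLocalization.ringHom_ext (Submonoid.powers f) (RingHom.ext h)
  exact AlgHom.ext fun u => congrArg (fun F => F u) h1

theorem awayAct_toLoc {A : Type} [CommRing A] [Algebra ℂ A] (ρ : ℂˣ → A →ₐ[ℂ] A) (f : A)
    (hf : IsWeightVector ρ f) (t : ℂˣ) (a : A) :
    awayAct ρ f hf t (toLoc f a) = toLoc f (ρ t a) :=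
  IsLocalization.Away.lift_eq f (hf.isUnit t) a

theorem awayLift_awayAct {A T : Type} [CommRing A] [Algebra ℂ A] [CommRing T] [Algebra ℂ T] {f : A}
    {ρ : ℂˣ → A →ₐ[ℂ] A} (hf : IsWeightVector ρ f) {φ : A →ₐ[ℂ] T} (hu : IsUnit (φ f)) (t : ℂˣ)
    {σ : T →ₐ[ℂ] T} (h : ∀ a, φ (ρ t a) = σ (φ a)) (u : Localization.Away f) :
    awayLift φ hu (awayAct ρ f hf t u) = σ (awayLift φ hu u) := by
  have h1 : (awayLift φ hu).comp (awayAct ρ f hf t) = σ.comp (awayLift φ hu) :=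
    away_algHom_ext fun a => by
      rw [AlgHom.comp_apply, AlgHom.comp_apply, awayAct_toLoc, awayLift_toLoc, awayLift_toLoc, h]
  exact congrArg (fun F => F u) h1

/-- The degree of a coordinate under the action with weights `w`. -/
def deg {ι : Type} (w : ι → ℤ) (v : ι ⊕ ι) : ℤ := 1 + sgn v * (w (idx v) - 1)

theorem elim_eq_deg {ι : Type} (w : ι → ℤ) (t : ℂˣ) (v : ι ⊕ ι) :
    Sum.elim (fun i => t ^ w i) (fun i => t ^ (2 - w i)) v = t ^ deg w v := by
  rcases v with v | v <;> simp only [Sum.elim_inl, Sum.elim_inr, deg, sgn_inl, sgn_inr, idx_inl,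
    idx_inr] <;> congr 1 <;> ring

theorem scale_X {σ : Type} (u : σ → ℂˣ) (v : σ) :
    scale u (MvPolynomial.X v) = (u v : ℂ) • MvPolynomial.X v :=
  MvPolynomial.aeval_X _ _

theorem weightAct_X {ι : Type} (w : ι → ℤ) (t : ℂˣ) (v : ι ⊕ ι) :
    weightAct w t (MvPolynomial.X v) = ((t ^ deg w v : ℂˣ) : ℂ) • MvPolynomial.X v := by
  rw [weightAct, scale_X, elim_eq_deg]

theorem weightAct_monomial {ι : Type} [Fintype ι] (w : ι → ℤ) (t : ℂˣ) (s : ι ⊕ ι →₀ ℕ) (a : ℂ) :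
    weightAct w t (MvPolynomial.monomial s a) =
      ((t ^ (∑ v, deg w v * s v) : ℂˣ) : ℂ) • MvPolynomial.monomial s a := by
  rw [weightAct, scale_monomial, MvPolynomial.smul_monomial, smul_eq_mul]
  congr 3
  rw [Finsupp.prod_fintype _ _ (by simp), zpow_sum]
  refine Finset.prod_congr rfl fun v _ => ?_
  rw [elim_eq_deg, ← zpow_natCast, ← zpow_mul]

/-! ### The action of `ℂˣ` on invariants and reductions -/

section Red

variable {ι : Type} {m : ℕ} (B : Matrix ι (Fin m) ℤ) (H : Subgroup (Fin m → ℂˣ))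
  (w : ι → ℤ) (t : ℂˣ)

/-- The action of `ℂˣ` on invariants. -/
def invAct : invariants B H →ₐ[ℂ] invariants B H :=
  ((weightAct w t).comp (invariants B H).val).codRestrict (invariants B H) fun p c hc => by
    change torusAct B c (weightAct w t p) = weightAct w t p
    rw [torusAct, weightAct, scale_comm]
    exact congrArg _ (p.2 c hc)

theorem coe_invAct (p : invariants B H) :
    (invAct B H w t p : MvPolynomial (ι ⊕ ι) ℂ) = weightAct w t p := rfl

variable [Fintype ι]

theorem redAct_mk (p : invariants B H) :
    redAct B H w t (Ideal.Quotient.mkₐ ℂ (redIdeal B H) p) =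
      Ideal.Quotient.mkₐ ℂ (redIdeal B H) (invAct B H w t p) := rfl

theorem isWeightVector_redMon (s : ι ⊕ ι →₀ ℕ) : IsWeightVector (redAct B H w) (redMon B H s) := by
  refine ⟨∑ v, deg w v * s v, fun t => ?_⟩
  by_cases hs : IsInv B H s
  · rw [redMon_of_isInv hs, redAct_mk, ← map_smul]
    congr 1
    exact Subtype.ext (weightAct_monomial w t s 1)
  · rw [redMon_of_not hs, map_zero, smul_zero]

end Red

variable {n m : ℕ} {B : Matrix (Fin n) (Fin m) ℤ}

namespace ChartData

variable (𝒟 : ChartData B)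

/-- The sign of the coordinate of index `i` that occurs in the monomial of the chart. -/
def pivotSgn (i : Fin n) : ℤ := -sgn (𝒟.elim i)

theorem pivotSgn_of_mon {v : Fin n ⊕ Fin n} (hv : idx v ∈ 𝒟.I) (hm : 𝒟.mon v ≠ 0) :
    𝒟.pivotSgn (idx v) = sgn v := by
  rw [pivotSgn, elim]
  rcases 𝒟.mon_dichotomy hv with ⟨h1, h2⟩ | ⟨h1, h2⟩
  · rw [if_pos h1]
    rcases v with k | k
    · simp
    · exact absurd h2 hm
  · rw [if_neg (not_not.2 h1)]
    rcases v with k | k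
    · exact absurd h1 hm
    · simp

theorem pivotSgn_of_elim {v : Fin n ⊕ Fin n} (hv : idx v ∈ 𝒟.I) (hm : 𝒟.mon v = 0) :
    𝒟.pivotSgn (idx v) = -sgn v := by
  rw [pivotSgn, ← 𝒟.eq_elim hv hm]

/-- The degrees of the coordinates, after a twist of the dilation by a one-parameter subgroup of the
torus for which the coordinates put equal to one are invariant. -/
def weight (k : Fin n) : ℤ := 1 - ∑ i ∈ 𝒟.I, 𝒟.pivotSgn i * 𝒟.c k i

theorem weight_of_mem {i : Fin n} (hi : i ∈ 𝒟.I) : 𝒟.weight i = 1 - 𝒟.pivotSgn i := by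
  rw [weight, Finset.sum_eq_single i, 𝒟.basis.delta _ (Finset.mem_union_left _ hi) _
    (Finset.mem_union_left _ hi), if_pos rfl, mul_one]
  · intro j hj hji
    rw [𝒟.basis.delta _ (Finset.mem_union_left _ hj) _ (Finset.mem_union_left _ hi),
      if_neg hji.symm, mul_zero]
  · exact fun h => absurd hi h

theorem deg_pivot {v : Fin n ⊕ Fin n} (hv : idx v ∈ 𝒟.I) (hm : 𝒟.mon v ≠ 0) :
    deg 𝒟.weight v = 0 := by
  rw [deg, 𝒟.weight_of_mem hv, 𝒟.pivotSgn_of_mon hv hm]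
  linear_combination -sgn_mul_sgn v

theorem deg_elim {v : Fin n ⊕ Fin n} (hv : idx v ∈ 𝒟.I) (hm : 𝒟.mon v = 0) :
    deg 𝒟.weight v = 2 := by
  rw [deg, 𝒟.weight_of_mem hv, 𝒟.pivotSgn_of_elim hv hm]
  linear_combination sgn_mul_sgn v

/-- The torus element has character value `t ^ (-pivotSgn i)` for `i ∈ I` and `1` for the indices in
`J`, so it compensates the dilation on pivots. As it fixes invariants, the twisted action and the
dilation agree on them. -/
theorem exists_twist (t : ℂˣ) : ∃ τ : Fin m → ℂˣ, ∀ p,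
    weightAct (fun _ => 1) t (torusAct B τ p) = weightAct 𝒟.weight t p := by
  classical
  obtain ⟨τ, hτ⟩ := 𝒟.basis.torus fun i => if i ∈ 𝒟.I then t ^ (-𝒟.pivotSgn i) else 1
  have hχ : ∀ k, character (B k) τ = t ^ (𝒟.weight k - 1) := fun k => by
    rw [𝒟.basis.character_row, Finset.prod_union 𝒟.basis.disj]
    have h1 : ∏ j ∈ 𝒟.J, character (B j) τ ^ 𝒟.c k j = 1 := Finset.prod_eq_one fun j hj => by
      rw [hτ j (Finset.mem_union_right _ hj), if_neg, one_zpow]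
      exact fun h => Finset.disjoint_left.1 𝒟.basis.disj h hj
    have h2 : 𝒟.weight k - 1 = ∑ i ∈ 𝒟.I, -𝒟.pivotSgn i * 𝒟.c k i := by
      rw [weight, Finset.sum_congr rfl fun i _ => neg_mul _ _, Finset.sum_neg_distrib]
      ring
    rw [h1, mul_one, h2, zpow_sum]
    refine Finset.prod_congr rfl fun i hi => ?_
    rw [hτ i (Finset.mem_union_left _ hi), if_pos hi, zpow_mul]
  refine ⟨τ, fun p => ?_⟩
  have h : (weightAct (fun _ => 1) t).comp (torusAct B τ) = weightAct 𝒟.weight t := by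
    refine MvPolynomial.algHom_ext fun v => ?_
    rw [AlgHom.comp_apply, torusAct, scale_X, map_smul, weightAct_X, weightAct_X, smul_smul,
      ← Units.val_mul, sum_elim_eq_zpow, hχ, ← zpow_mul, ← zpow_add]
    congr 3
    rw [deg, deg]
    ring
  exact congrArg (fun F => F p) h

variable {P : Type} [CommRing P] [Algebra ℂ P] {x : Fin n ⊕ Fin n → P}

/-- The coordinates along the leaf are homogeneous of the given degrees. -/
def IsGraded (x : Fin n ⊕ Fin n → P) (t : ℂˣ) (σ : P →ₐ[ℂ] P) : Prop :=
  ∀ v, 𝒟.free v → σ (x v) = ((t ^ deg 𝒟.weight v : ℂˣ) : ℂ) • x v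

/-- The degrees of the coordinates of the slice. -/
def sliceWeight (k : 𝒟.F) : ℤ := 𝒟.weight k

variable {t : ℂˣ} {σ : P →ₐ[ℂ] P}

theorem map_base (hσ : 𝒟.IsGraded x t σ) (v : Fin n ⊕ Fin n) :
    Algebra.TensorProduct.map σ (weightAct 𝒟.sliceWeight t) (𝒟.base x v) =
      ((t ^ deg 𝒟.weight v : ℂˣ) : ℂ) • 𝒟.base x v := by
  by_cases hF : idx v ∈ 𝒟.F
  · obtain ⟨u, rfl⟩ := 𝒟.exists_emb hF
    have h1 : deg 𝒟.weight (𝒟.emb u) = deg 𝒟.sliceWeight u := by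
      simp only [deg, sgn_emb, idx_emb]
      rfl
    rw [base_emb, Algebra.TensorProduct.map_tmul, map_one, weightAct_X, TensorProduct.tmul_smul, h1]
  · by_cases hI : idx v ∈ 𝒟.I
    · rw [𝒟.base_of_mem_I x hI, map_zero, smul_zero]
    · rw [𝒟.base_of_free x hF hI, Algebra.TensorProduct.map_tmul, map_one, hσ v ⟨hF, hI⟩,
        ← TensorProduct.smul_tmul']

/-- However the action is twisted, each product `x_k y_k` has degree two. -/
theorem map_pairValue (hσ : 𝒟.IsGraded x t σ) (i : Fin n) :
    Algebra.TensorProduct.map σ (weightAct 𝒟.sliceWeight t) (𝒟.pairValue x i) =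
      ((t ^ (2 : ℤ) : ℂˣ) : ℂ) • 𝒟.pairValue x i := by
  rw [pairValue, map_neg, map_sum, smul_neg, Finset.smul_sum]
  refine congrArg Neg.neg (Finset.sum_congr rfl fun k _ => ?_)
  rw [map_smul, map_mul, 𝒟.map_base hσ, 𝒟.map_base hσ, smul_mul_smul_comm, ← Units.val_mul,
    ← zpow_add, smul_comm]
  congr 4
  simp only [deg, sgn_inl, sgn_inr, idx_inl, idx_inr]
  ring

theorem map_act_sub (hσ : 𝒟.IsGraded x t σ) (p : MvPolynomial (Fin n ⊕ Fin n) ℂ) :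
    Algebra.TensorProduct.map σ (weightAct 𝒟.sliceWeight t) (𝒟.sub x p) =
      𝒟.sub x (weightAct 𝒟.weight t p) := by
  have h : (Algebra.TensorProduct.map σ (weightAct 𝒟.sliceWeight t)).comp (𝒟.sub x) =
      (𝒟.sub x).comp (weightAct 𝒟.weight t) := by
    refine MvPolynomial.algHom_ext fun v => ?_
    rw [AlgHom.comp_apply, AlgHom.comp_apply, weightAct_X, map_smul, sub_X]
    by_cases hI : idx v ∈ 𝒟.I
    · by_cases hm : 𝒟.mon v = 0
      · rw [𝒟.coordImage_nonpivot x hI hm, 𝒟.map_pairValue hσ, 𝒟.deg_elim hI hm]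
      · rw [𝒟.coordImage_pivot x hI hm, map_one, 𝒟.deg_pivot hI hm, zpow_zero, Units.val_one,
          one_smul]
    · rw [𝒟.coordImage_of_not_mem x hI, 𝒟.map_base hσ]
  exact congrArg (fun F => F p) h

theorem resInv_act (hσ : 𝒟.IsGraded x t σ) (p : invariants B ⊤) :
    𝒟.resInv x (invAct B ⊤ (fun _ => 1) t p) =
      Algebra.TensorProduct.map σ (invAct (sliceWeights B 𝒟.H) 𝒟.H 𝒟.sliceWeight t)
        (𝒟.resInv x p) := by
  obtain ⟨τ, hτ⟩ := 𝒟.exists_twist t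
  refine 𝒟.resInv_eq x ?_
  have h1 : (𝒟.incl P).comp
      (Algebra.TensorProduct.map σ (invAct (sliceWeights B 𝒟.H) 𝒟.H 𝒟.sliceWeight t)) =
      (Algebra.TensorProduct.map σ (weightAct 𝒟.sliceWeight t)).comp (𝒟.incl P) :=
    Algebra.TensorProduct.ext' fun _ _ => rfl
  have h2 := congrArg (fun F => F (𝒟.resInv x p)) h1
  simp only [AlgHom.comp_apply] at h2
  rw [h2, incl_resInv, 𝒟.map_act_sub hσ, ← hτ, p.2 τ trivial, coe_invAct]

/-- The action of `ℂˣ` on the coordinate ring of the slice. -/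
def sliceAct (t : ℂˣ) : 𝒟.SliceRing →ₐ[ℂ] 𝒟.SliceRing :=
  redAct (sliceWeights B 𝒟.H) 𝒟.H 𝒟.sliceWeight t

theorem sliceAct_mk (t : ℂˣ) (p : invariants (sliceWeights B 𝒟.H) 𝒟.H) :
    𝒟.sliceAct t (𝒟.sliceMk p) =
      𝒟.sliceMk (invAct (sliceWeights B 𝒟.H) 𝒟.H 𝒟.sliceWeight t p) :=
  redAct_mk (sliceWeights B 𝒟.H) 𝒟.H 𝒟.sliceWeight t p

theorem coneMap_act (hσ : 𝒟.IsGraded x t σ) (a : Cone B) :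
    𝒟.coneMap x (redAct B ⊤ (fun _ => 1) t a) =
      Algebra.TensorProduct.map σ (𝒟.sliceAct t) (𝒟.coneMap x a) := by
  obtain ⟨p, rfl⟩ := Ideal.Quotient.mkₐ_surjective ℂ (redIdeal B ⊤) a
  rw [redAct_mk, coneMap_mk, coneMap_mk, 𝒟.resInv_act hσ]
  have h1 : (𝒟.proj P).comp
      (Algebra.TensorProduct.map σ (invAct (sliceWeights B 𝒟.H) 𝒟.H 𝒟.sliceWeight t)) =
      (Algebra.TensorProduct.map σ (𝒟.sliceAct t)).comp (𝒟.proj P) :=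
    Algebra.TensorProduct.ext' fun p q => by
      rw [AlgHom.comp_apply, AlgHom.comp_apply, Algebra.TensorProduct.map_tmul, proj_tmul,
        proj_tmul, Algebra.TensorProduct.map_tmul, sliceAct_mk]
  exact congrArg (fun F => F (𝒟.resInv x p)) h1

theorem isWeightVector_f : IsWeightVector (redAct B ⊤ fun _ => 1) 𝒟.f :=
  isWeightVector_redMon B ⊤ _ 𝒟.mon

theorem chart_act (hx : 𝒟.Inverts x) (hσ : 𝒟.IsGraded x t σ) (u : Localization.Away 𝒟.f) :
    𝒟.chart hx (awayAct (redAct B ⊤ fun _ => 1) 𝒟.f 𝒟.isWeightVector_f t u) =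
      Algebra.TensorProduct.map σ (𝒟.sliceAct t) (𝒟.chart hx u) :=
  awayLift_awayAct _ _ t (𝒟.coneMap_act hσ) u

end ChartData

end Equivariance

/-! ### The leaf in the chart -/

theorem eq_of_forall_ker {A P : Type} [CommRing A] [Algebra ℂ A] [CommRing P] [Algebra ℂ P]
    (ρ : A →ₐ[ℂ] P) (p : A →ₐ[ℂ] ℂ) (h : ∀ u ∈ RingHom.ker ρ, p u = 0) {u : A} {c : ℂ}
    (hu : ρ u = algebraMap ℂ P c) : p u = c := by
  have h1 := h (u - algebraMap ℂ A c) (by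
    rw [RingHom.mem_ker, map_sub, AlgHom.commutes, hu, sub_self])
  rw [map_sub, AlgHom.commutes, sub_eq_zero] at h1
  exact h1

section LeafInChart

variable {n m : ℕ} {B : Matrix (Fin n) (Fin m) ℤ}

namespace ChartData

variable (𝒟 : ChartData B)

theorem mem_active_of_mon {z : Pts (Cone B)} (hz : z.val 𝒟.f ≠ 0) {v : Fin n ⊕ Fin n}
    (hv : 𝒟.mon v ≠ 0) : v ∈ active z :=
  ⟨𝒟.mon, 𝒟.wt_mon, hv, hz⟩

theorem mem_activeIdx_of_mem_I {z : Pts (Cone B)} (hz : z.val 𝒟.f ≠ 0) {i : Fin n}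
    (hi : i ∈ 𝒟.I) : i ∈ activeIdx z := by
  rcases 𝒟.mon_dichotomy hi with ⟨h1, -⟩ | ⟨-, h2⟩
  · exact ⟨_, 𝒟.mem_active_of_mon hz h1, rfl⟩
  · exact ⟨_, 𝒟.mem_active_of_mon hz h2, rfl⟩

/-- Nonvanishing of `f` already makes the spanning set `I` active, so the flat can only be too
large. -/
theorem flat_eq_iff {z : Pts (Cone B)} (hz : z.val 𝒟.f ≠ 0) :
    flat z = 𝒟.E ↔ activeIdx z ⊆ 𝒟.E := by
  constructor
  · intro h
    rw [← h]
    exact subset_hull B _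
  · intro h
    ext k
    exact 𝒟.basis.mem_hull_iff (fun i hi => 𝒟.mem_activeIdx_of_mem_I hz hi) h

variable {P : Type} [CommRing P] [Algebra ℂ P] {x : Fin n ⊕ Fin n → P}

/-- The chart as an isomorphism. -/
def chartEquiv (hx : 𝒟.Inverts x) (hg : 𝒟.Generates x) (hrep : 𝒟.Represents x) :
    Localization.Away 𝒟.f ≃ₐ[ℂ] P ⊗[ℂ] 𝒟.SliceRing :=
  AlgEquiv.ofBijective (𝒟.chart hx) ⟨𝒟.chart_injective hx hrep, 𝒟.chart_surjective hx hg⟩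

variable (hx : 𝒟.Inverts x) (hg : 𝒟.Generates x) (hrep : 𝒟.Represents x)

theorem chartEquiv_toLoc (a : Cone B) :
    𝒟.chartEquiv hx hg hrep (toLoc 𝒟.f a) = 𝒟.coneMap x a :=
  𝒟.chart_toLoc hx a

theorem chartEquiv_symm_coneMap (a : Cone B) :
    (𝒟.chartEquiv hx hg hrep).symm (𝒟.coneMap x a) = toLoc 𝒟.f a := by
  rw [← 𝒟.chartEquiv_toLoc hx hg hrep, AlgEquiv.symm_apply_apply]

/-- The slice part of `p` is the vertex exactly when all nonconstant invariant monomials on the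
slice vanish there, and up to factors these are restrictions of invariant monomials containing a
coordinate with index outside the flat. -/
theorem flat_ofAway_iff (p : Pts (Localization.Away 𝒟.f)) : flat p.ofAway = 𝒟.E ↔
    ∀ q : 𝒟.SliceRing, p.val ((𝒟.chartEquiv hx hg hrep).symm (1 ⊗ₜ q)) = 𝒟.sliceVertex q := by
  set ψ : P ⊗[ℂ] 𝒟.SliceRing →ₐ[ℂ] ℂ := p.val.comp (𝒟.chartEquiv hx hg hrep).symm.toAlgHom
    with hψ
  have hψa : ∀ a, ψ (𝒟.coneMap x a) = p.ofAway.val a := fun a => by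
    have h1 : ψ (𝒟.coneMap x a) = p.val ((𝒟.chartEquiv hx hg hrep).symm (𝒟.coneMap x a)) := rfl
    rw [h1, chartEquiv_symm_coneMap]
    rfl
  have hf : p.ofAway.val 𝒟.f ≠ 0 :=
    ((IsLocalization.Away.algebraMap_isUnit (S := Localization.Away 𝒟.f) 𝒟.f).map p.val).ne_zero
  rw [𝒟.flat_eq_iff hf]
  change _ ↔ ∀ q : 𝒟.SliceRing, ψ (1 ⊗ₜ q) = 𝒟.sliceVertex q
  constructor
  · intro h q
    refine 𝒟.slice_induction (P := fun q => ψ (1 ⊗ₜ q) = 𝒟.sliceVertex q) (fun t ht r => ?_)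
      (fun q q' h h' => ?_) q
    · rw [TensorProduct.tmul_smul, map_smul, map_smul]
      congr 1
      by_cases ht0 : t = 0
      · have h1 : 𝒟.sliceMon t = 1 := by
          rw [ht0]
          exact redMon_zero
        rw [h1, map_one]
        exact map_one ψ
      · obtain ⟨a, N, ha, hat, h1⟩ := 𝒟.exists_lift_slice x ht
        have h2 := congrArg ψ h1
        rw [map_mul, map_pow, hψa, hψa] at h2
        -- The lift of a nonconstant slice monomial contains a coordinate with index in `F`, which
        -- would otherwise be active.
        have h3 : p.ofAway.val (redMon B ⊤ a) = 0 := by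
          by_contra hne
          obtain ⟨u, hu⟩ := Finsupp.ne_iff.1 ht0
          rw [← hat, restrict_apply] at hu
          have h4 : idx (𝒟.emb u) ∈ 𝒟.E := h ⟨_, ⟨a, ha, hu, hne⟩, rfl⟩
          rw [idx_emb] at h4
          exact 𝒟.not_mem_F h4 (idx u : 𝒟.F).2
        rw [h3] at h2
        rw [𝒟.sliceVertex_mon ht0]
        exact (mul_eq_zero.1 h2.symm).resolve_left (pow_ne_zero _ hf)
    · rw [TensorProduct.tmul_add, map_add, map_add, h, h']
  · rintro h _ ⟨v, ⟨s, hs, hsv, hne⟩, rfl⟩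
    by_contra hE
    obtain ⟨u, rfl⟩ := 𝒟.exists_emb (𝒟.mem_moved.2 hE)
    obtain ⟨a, ha⟩ := 𝒟.coneMap_redMon_eq x hs
    rw [← hψa, ha, map_mul, h, 𝒟.sliceVertex_mon, mul_zero] at hne
    · exact hne rfl
    · intro h0
      exact hsv (by rw [← restrict_apply, h0, Finsupp.zero_apply])

/-- The restriction of functions to the product of the leaf and the vertex of the slice. -/
def leafEval (P : Type) [CommRing P] [Algebra ℂ P] : P ⊗[ℂ] 𝒟.SliceRing →ₐ[ℂ] P :=
  Algebra.TensorProduct.productMap (AlgHom.id ℂ P) ((Algebra.ofId ℂ P).comp 𝒟.sliceVertex)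

theorem leafEval_tmul (p : P) (q : 𝒟.SliceRing) :
    𝒟.leafEval P (p ⊗ₜ q) = 𝒟.sliceVertex q • p := by
  rw [leafEval, Algebra.TensorProduct.productMap_apply_tmul, AlgHom.id_apply, AlgHom.comp_apply,
    Algebra.ofId_apply, Algebra.smul_def, mul_comm]

theorem leafEval_bracket (bP : Biderivation P) (u v : P ⊗[ℂ] 𝒟.SliceRing) :
    𝒟.leafEval P (prodBracket bP 𝒟.sliceBracket u v) =
      bP (𝒟.leafEval P u) (𝒟.leafEval P v) := by
  induction u using TensorProduct.induction_on with
  | zero => simp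
  | add u u' h h' => simp only [map_add, LinearMap.add_apply, h, h', Derivation.add_apply]
  | tmul u₁ u₂ =>
    induction v using TensorProduct.induction_on with
    | zero => simp
    | add v v' h h' => simp only [map_add, h, h']
    | tmul v₁ v₂ =>
      rw [prodBracket_tmul, map_add, leafEval_tmul, leafEval_tmul, leafEval_tmul, leafEval_tmul,
        sliceVertex_bracket, zero_smul, add_zero, map_mul, Derivation.map_smul, Derivation.map_smul,
        Derivation.smul_apply, smul_smul, mul_comm]

/-- The difference of `p ⊗ q` and its value along the leaf is `p ⊗ 1` times the image of `q -
q(vertex)`. Hence the kernel inherits finite generation from the vertex. -/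
theorem ker_leafEval : RingHom.ker (𝒟.leafEval P) = (RingHom.ker 𝒟.sliceVertex).map
    (Algebra.TensorProduct.includeRight (R := ℂ) (A := P) (B := 𝒟.SliceRing)) := by
  apply le_antisymm
  · intro w hw
    have key : ∀ w : P ⊗[ℂ] 𝒟.SliceRing, w - 𝒟.leafEval P w ⊗ₜ 1 ∈
        (RingHom.ker 𝒟.sliceVertex).map
          (Algebra.TensorProduct.includeRight (R := ℂ) (A := P) (B := 𝒟.SliceRing)) := fun w => by
      induction w using TensorProduct.induction_on with
      | zero => simp
      | add w w' h h' =>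
        rw [map_add, TensorProduct.add_tmul, add_sub_add_comm]
        exact Ideal.add_mem _ h h'
      | tmul p q =>
        have h1 : p ⊗ₜ[ℂ] q - 𝒟.leafEval P (p ⊗ₜ q) ⊗ₜ[ℂ] (1 : 𝒟.SliceRing) = p ⊗ₜ 1 *
            Algebra.TensorProduct.includeRight (R := ℂ) (A := P) (B := 𝒟.SliceRing)
              (q - algebraMap ℂ _ (𝒟.sliceVertex q)) := by
          rw [leafEval_tmul, Algebra.TensorProduct.includeRight_apply,
            Algebra.TensorProduct.tmul_mul_tmul, one_mul, mul_one, TensorProduct.tmul_sub,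
            Algebra.algebraMap_eq_smul_one, TensorProduct.smul_tmul]
        rw [h1]
        refine Ideal.mul_mem_left _ _ (Ideal.mem_map_of_mem _ ?_)
        rw [RingHom.mem_ker, map_sub, AlgHom.commutes, Algebra.algebraMap_self, RingHom.id_apply,
          sub_self]
    have h2 := key w
    rwa [RingHom.mem_ker.1 hw, TensorProduct.zero_tmul, sub_zero] at h2
  · refine Ideal.map_le_iff_le_comap.2 fun q hq => ?_
    rw [Ideal.mem_comap, RingHom.mem_ker, Algebra.TensorProduct.includeRight_apply, leafEval_tmul,
      RingHom.mem_ker.1 hq, zero_smul]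

/-- The retraction of the domain of the chart to the leaf. -/
def retract : Localization.Away 𝒟.f →ₐ[ℂ] P :=
  (𝒟.leafEval P).comp (𝒟.chartEquiv hx hg hrep).toAlgHom

theorem retract_apply (u : Localization.Away 𝒟.f) :
    𝒟.retract hx hg hrep u = 𝒟.leafEval P (𝒟.chartEquiv hx hg hrep u) := rfl

theorem ker_retract : RingHom.ker (𝒟.retract hx hg hrep) = (RingHom.ker 𝒟.sliceVertex).map
    ((𝒟.chartEquiv hx hg hrep).symm.toAlgHom.comp
      (Algebra.TensorProduct.includeRight (R := ℂ) (A := P) (B := 𝒟.SliceRing))) := by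
  apply le_antisymm
  · intro u hu
    have h1 : 𝒟.chartEquiv hx hg hrep u ∈ RingHom.ker (𝒟.leafEval P) := hu
    rw [ker_leafEval] at h1
    have h2 := Ideal.mem_map_of_mem (𝒟.chartEquiv hx hg hrep).symm.toAlgHom h1
    rw [Ideal.map_mapₐ] at h2
    have h3 : (𝒟.chartEquiv hx hg hrep).symm.toAlgHom (𝒟.chartEquiv hx hg hrep u) = u :=
      (𝒟.chartEquiv hx hg hrep).symm_apply_apply u
    rwa [h3] at h2
  · refine Ideal.map_le_iff_le_comap.2 fun q hq => ?_
    have h1 : 𝒟.retract hx hg hrep ((𝒟.chartEquiv hx hg hrep).symm (1 ⊗ₜ q)) = 0 := by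
      rw [retract_apply, AlgEquiv.apply_symm_apply, leafEval_tmul, RingHom.mem_ker.1 hq, zero_smul]
    exact h1

theorem fg_ker_retract : (RingHom.ker (𝒟.retract hx hg hrep)).FG := by
  rw [ker_retract]
  exact 𝒟.fg_ker_sliceVertex.map _

theorem retract_bracket {bP : Biderivation P} (hb : 𝒟.IsCanonical x bP) (a a' : Cone B) :
    𝒟.retract hx hg hrep (toLoc 𝒟.f (redBracket B ⊤ a a')) =
      bP (𝒟.retract hx hg hrep (toLoc 𝒟.f a)) (𝒟.retract hx hg hrep (toLoc 𝒟.f a')) := by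
  simp only [retract_apply, chartEquiv_toLoc]
  rw [𝒟.coneMap_bracket hb, leafEval_bracket]

theorem flat_ofAway_iff_ker (p : Pts (Localization.Away 𝒟.f)) : flat p.ofAway = 𝒟.E ↔
    ∀ u ∈ RingHom.ker (𝒟.retract hx hg hrep), p.val u = 0 := by
  rw [𝒟.flat_ofAway_iff hx hg hrep]
  constructor
  · intro h u hu
    have hle : RingHom.ker (𝒟.retract hx hg hrep) ≤ RingHom.ker p.val := by
      rw [ker_retract]
      refine Ideal.map_le_iff_le_comap.2 fun q hq => ?_
      exact (h q).trans (RingHom.mem_ker.1 hq)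
    exact hle hu
  · intro h q
    refine eq_of_forall_ker (𝒟.retract hx hg hrep) p.val h ?_
    rw [retract_apply, AlgEquiv.apply_symm_apply, leafEval_tmul, Algebra.algebraMap_eq_smul_one]

end ChartData

end LeafInChart

/-! ### The coordinates along the leaf -/

section LeafCoordinates

namespace IsWeightVector

variable {A : Type} [CommRing A] [Algebra ℂ A] {ρ : ℂˣ → A →ₐ[ℂ] A}

theorem one : IsWeightVector ρ 1 := ⟨0, fun t => by simp⟩

theorem mul {f g : A} (hf : IsWeightVector ρ f) (hg : IsWeightVector ρ g) :
    IsWeightVector ρ (f * g) := by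
  obtain ⟨a, ha⟩ := hf
  obtain ⟨b, hb⟩ := hg
  refine ⟨a + b, fun t => ?_⟩
  rw [map_mul, ha, hb, smul_mul_smul_comm, zpow_add, Units.val_mul]

theorem prod {κ : Type} (s : Finset κ) {f : κ → A} (h : ∀ i ∈ s, IsWeightVector ρ (f i)) :
    IsWeightVector ρ (∏ i ∈ s, f i) :=
  Finset.prod_induction f (IsWeightVector ρ) (fun _ _ => mul) one h

end IsWeightVector

variable {n m : ℕ} {B : Matrix (Fin n) (Fin m) ℤ}

namespace ChartData

variable (𝒟 : ChartData B)

/-- The indices of the coordinates along the leaf. -/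
abbrev LeafIdx : Type := {k : Fin n // k ∉ 𝒟.F ∧ k ∉ 𝒟.I}

/-- Half the dimension of the leaf. -/
def dim : ℕ := Fintype.card 𝒟.LeafIdx

/-- An enumeration of the indices of the coordinates along the leaf. -/
def enum : Fin 𝒟.dim ≃ 𝒟.LeafIdx := (Fintype.equivFin _).symm

/-- The coordinates along the leaf. -/
def leafCoord : Fin 𝒟.dim ⊕ Fin 𝒟.dim → Fin n ⊕ Fin n :=
  Sum.map (fun i => (𝒟.enum i : Fin n)) (fun i => (𝒟.enum i : Fin n))

theorem idx_leafCoord (w : Fin 𝒟.dim ⊕ Fin 𝒟.dim) : idx (𝒟.leafCoord w) = 𝒟.enum (idx w) := by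
  rcases w with w | w <;> rfl

theorem sgn_leafCoord (w : Fin 𝒟.dim ⊕ Fin 𝒟.dim) : sgn (𝒟.leafCoord w) = sgn w := by
  rcases w with w | w <;> rfl

theorem swap_leafCoord (w : Fin 𝒟.dim ⊕ Fin 𝒟.dim) :
    (𝒟.leafCoord w).swap = 𝒟.leafCoord w.swap := by
  rcases w with w | w <;> rfl

theorem leafCoord_injective : Function.Injective 𝒟.leafCoord :=
  Function.Injective.sumMap (Subtype.val_injective.comp 𝒟.enum.injective)
    (Subtype.val_injective.comp 𝒟.enum.injective)

theorem free_leafCoord (w : Fin 𝒟.dim ⊕ Fin 𝒟.dim) : 𝒟.free (𝒟.leafCoord w) := by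
  rw [free, idx_leafCoord]
  exact (𝒟.enum (idx w)).2

theorem exists_leafCoord {v : Fin n ⊕ Fin n} (hv : 𝒟.free v) : ∃ w, 𝒟.leafCoord w = v := by
  rcases v with k | k
  · exact ⟨Sum.inl (𝒟.enum.symm ⟨k, hv⟩), by simp [leafCoord]⟩
  · exact ⟨Sum.inr (𝒟.enum.symm ⟨k, hv⟩), by simp [leafCoord]⟩

/-- The coordinates along the leaf that occur in the monomial of the chart. -/
def invCoords : Finset (Fin 𝒟.dim ⊕ Fin 𝒟.dim) := {w | 𝒟.mon (𝒟.leafCoord w) ≠ 0}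

theorem mem_invCoords {w : Fin 𝒟.dim ⊕ Fin 𝒟.dim} :
    w ∈ 𝒟.invCoords ↔ 𝒟.mon (𝒟.leafCoord w) ≠ 0 := by simp [invCoords]

theorem eq_of_mon_ne_zero {v w : Fin n ⊕ Fin n} (hv : 𝒟.mon v ≠ 0) (hw : 𝒟.mon w ≠ 0)
    (h : idx v = idx w) : v = w := by
  rcases v with v | v <;> rcases w with w | w <;> obtain rfl : v = w := h
  · rfl
  · rw [mon_inl] at hv
    rw [mon_inr] at hw
    omega
  · rw [mon_inr] at hv
    rw [mon_inl] at hw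
    omega
  · rfl

/-- The chart monomial contains at most one of `x_k`, `y_k` for each `k`. -/
theorem card_invCoords_le : 𝒟.invCoords.card ≤ n := by
  have h1 : 𝒟.invCoords.card ≤ (Finset.univ : Finset (Fin n)).card := by
    refine Finset.card_le_card_of_injOn (fun w => idx (𝒟.leafCoord w)) (by simp) ?_
    intro w hw w' hw' h
    exact 𝒟.leafCoord_injective
      (𝒟.eq_of_mon_ne_zero (𝒟.mem_invCoords.1 hw) (𝒟.mem_invCoords.1 hw') h)
  simpa using h1

/-- The linear forms whose nonvanishing locus is the domain of the coordinates along the leaf. -/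
def hyperplane (r : Fin 𝒟.invCoords.card) : MvPolynomial (Fin 𝒟.dim ⊕ Fin 𝒟.dim) ℂ :=
  MvPolynomial.X (𝒟.invCoords.equivFin.symm r : Fin 𝒟.dim ⊕ Fin 𝒟.dim)

theorem hyperplane_isHomogeneous (r : Fin 𝒟.invCoords.card) : (𝒟.hyperplane r).IsHomogeneous 1 :=
  MvPolynomial.isHomogeneous_X _ _

theorem hyperplane_ne_zero (r : Fin 𝒟.invCoords.card) : 𝒟.hyperplane r ≠ 0 :=
  MvPolynomial.X_ne_zero _

/-- The equation of the complement of the domain of the coordinates along the leaf. -/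
abbrev g : MvPolynomial (Fin 𝒟.dim ⊕ Fin 𝒟.dim) ℂ := ∏ r, 𝒟.hyperplane r

theorem g_ne_zero : 𝒟.g ≠ 0 := Finset.prod_ne_zero_iff.2 fun r _ => 𝒟.hyperplane_ne_zero r

theorem g_eq : 𝒟.g = ∏ w ∈ 𝒟.invCoords, MvPolynomial.X w := by
  rw [← Finset.prod_coe_sort, ← 𝒟.invCoords.equivFin.symm.prod_comp]
  rfl

/-- The coordinates along the leaf, as functions on it. -/
def leafFun (v : Fin n ⊕ Fin n) : Localization.Away 𝒟.g :=
  open scoped Classical in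
  if h : 𝒟.free v then toLoc 𝒟.g (MvPolynomial.X (place v (𝒟.enum.symm ⟨idx v, h⟩))) else 0

theorem leafFun_leafCoord (w : Fin 𝒟.dim ⊕ Fin 𝒟.dim) :
    𝒟.leafFun (𝒟.leafCoord w) = toLoc 𝒟.g (MvPolynomial.X w) := by
  rw [leafFun, dif_pos (𝒟.free_leafCoord w)]
  congr 2
  rcases w with w | w
  · exact congrArg Sum.inl (𝒟.enum.symm_apply_apply w)
  · exact congrArg Sum.inr (𝒟.enum.symm_apply_apply w)

theorem isUnit_toLoc_g : IsUnit (toLoc 𝒟.g 𝒟.g) :=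
  IsLocalization.Away.algebraMap_isUnit (S := Localization.Away 𝒟.g) 𝒟.g

theorem inverts_leafFun : 𝒟.Inverts 𝒟.leafFun := by
  intro v hv hm
  obtain ⟨w, rfl⟩ := 𝒟.exists_leafCoord hv
  rw [leafFun_leafCoord]
  refine isUnit_of_dvd_unit (map_dvd (toLoc 𝒟.g) ?_) 𝒟.isUnit_toLoc_g
  rw [g_eq]
  exact Finset.dvd_prod_of_mem _ (𝒟.mem_invCoords.2 hm)

theorem generates_leafFun : 𝒟.Generates 𝒟.leafFun := by
  intro S h1 h2
  have hpoly : ∀ p, toLoc 𝒟.g p ∈ S := by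
    have h3 : S.comap (toLoc 𝒟.g) = ⊤ := by
      rw [eq_top_iff, ← MvPolynomial.adjoin_range_X]
      refine Algebra.adjoin_le ?_
      rintro _ ⟨w, rfl⟩
      have h4 := h1 _ (𝒟.free_leafCoord w)
      rwa [leafFun_leafCoord] at h4
    intro p
    have h4 : p ∈ S.comap (toLoc 𝒟.g) := h3 ▸ Algebra.mem_top
    exact h4
  have hinv : ∃ u ∈ S, u * toLoc 𝒟.g 𝒟.g = 1 := by
    have h3 : ∀ w ∈ 𝒟.invCoords, ∃ u ∈ S, u * toLoc 𝒟.g (MvPolynomial.X w) = 1 := fun w hw => by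
      have h4 := 𝒟.inverts_leafFun _ (𝒟.free_leafCoord w) (𝒟.mem_invCoords.1 hw)
      obtain ⟨u, hu⟩ := h4.exists_left_inv
      refine ⟨u, h2 _ (𝒟.free_leafCoord w) (𝒟.mem_invCoords.1 hw) u hu, ?_⟩
      rwa [leafFun_leafCoord] at hu
    choose! u hu hu' using h3
    refine ⟨∏ w ∈ 𝒟.invCoords, u w, Subalgebra.prod_mem S hu, ?_⟩
    have h4 := congrArg (toLoc 𝒟.g) 𝒟.g_eq
    rw [h4, map_prod, ← Finset.prod_mul_distrib]
    exact Finset.prod_eq_one hu'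
  obtain ⟨u, hu, hu'⟩ := hinv
  rw [eq_top_iff]
  intro y _
  obtain ⟨N, a, ha⟩ := IsLocalization.Away.surj 𝒟.g y
  have h3 : y = toLoc 𝒟.g a * u ^ N := by
    calc y = y * toLoc 𝒟.g 𝒟.g ^ N * u ^ N := by
          rw [mul_assoc, ← mul_pow, mul_comm _ u, hu', one_pow, mul_one]
      _ = _ := by
        congr 1
  rw [h3]
  exact S.mul_mem (hpoly a) (S.pow_mem hu N)

theorem represents_leafFun : 𝒟.Represents 𝒟.leafFun := by
  intro T _ _ y hy
  refine ⟨awayLift (MvPolynomial.aeval fun w => y (𝒟.leafCoord w)) ?_, fun v hv => ?_⟩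
  · rw [g_eq, map_prod]
    refine Submonoid.prod_mem (IsUnit.submonoid T) fun w hw => ?_
    rw [MvPolynomial.aeval_X]
    exact hy _ (𝒟.free_leafCoord w) (𝒟.mem_invCoords.1 hw)
  · obtain ⟨w, rfl⟩ := 𝒟.exists_leafCoord hv
    rw [leafFun_leafCoord, awayLift_toLoc, MvPolynomial.aeval_X]

theorem omega_leafCoord (v w : Fin 𝒟.dim ⊕ Fin 𝒟.dim) :
    omega (𝒟.leafCoord v) (𝒟.leafCoord w) = omega v w := by
  rw [omega, omega, sgn_leafCoord, swap_leafCoord]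
  by_cases h : w = v.swap
  · rw [if_pos h, if_pos (congrArg _ h)]
  · rw [if_neg h, if_neg (𝒟.leafCoord_injective.ne h)]

theorem isCanonical_leafFun :
    𝒟.IsCanonical 𝒟.leafFun (awayBracket (polyBracket (Fin 𝒟.dim)) 𝒟.g) := by
  intro v w hv hw
  obtain ⟨v, rfl⟩ := 𝒟.exists_leafCoord hv
  obtain ⟨w, rfl⟩ := 𝒟.exists_leafCoord hw
  rw [leafFun_leafCoord, leafFun_leafCoord, omega_leafCoord]
  refine (awayBracket_algebraMap _ _ _ _).trans ?_
  rw [polyBracket_X_X]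
  exact (toLoc 𝒟.g).commutes _

/-- The degrees of the coordinates along the leaf. -/
def leafWeight (i : Fin 𝒟.dim) : ℤ := 𝒟.weight (𝒟.enum i)

theorem deg_leafWeight (w : Fin 𝒟.dim ⊕ Fin 𝒟.dim) :
    deg 𝒟.leafWeight w = deg 𝒟.weight (𝒟.leafCoord w) := by
  rw [deg, deg, sgn_leafCoord, idx_leafCoord]
  rfl

theorem isWeightVector_g : IsWeightVector (weightAct 𝒟.leafWeight) 𝒟.g :=
  IsWeightVector.prod _ fun _ _ => ⟨_, fun t => weightAct_X 𝒟.leafWeight t _⟩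

theorem isGraded_leafFun (t : ℂˣ) : 𝒟.IsGraded 𝒟.leafFun t
    (awayAct (weightAct 𝒟.leafWeight) 𝒟.g 𝒟.isWeightVector_g t) := by
  intro v hv
  obtain ⟨w, rfl⟩ := 𝒟.exists_leafCoord hv
  rw [leafFun_leafCoord, awayAct_toLoc, weightAct_X, map_smul, deg_leafWeight]

/-- The isomorphism of the principal open subset with the product of the leaf and the slice. -/
def leafEquiv : Localization.Away 𝒟.f ≃ₐ[ℂ] Localization.Away 𝒟.g ⊗[ℂ] 𝒟.SliceRing :=
  𝒟.chartEquiv 𝒟.inverts_leafFun 𝒟.generates_leafFun 𝒟.represents_leafFun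

/-- The chart of the leaf. -/
def leafChart (z : Pts (Cone B)) (hz : z.val 𝒟.f ≠ 0) :
    LeafChart (redBracket B ⊤) {z' | flat z' = 𝒟.E} z where
  f := 𝒟.f
  val_ne := hz
  d := 𝒟.dim
  g := 𝒟.g
  g_ne := 𝒟.g_ne_zero
  ρ := 𝒟.retract 𝒟.inverts_leafFun 𝒟.generates_leafFun 𝒟.represents_leafFun
  sec := 𝒟.leafEquiv.symm.toAlgHom.comp (Algebra.TensorProduct.includeLeft (R := ℂ) (S := ℂ)
    (A := Localization.Away 𝒟.g) (B := 𝒟.SliceRing))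
  ρ_sec u := by
    have h : 𝒟.retract 𝒟.inverts_leafFun 𝒟.generates_leafFun 𝒟.represents_leafFun
        (𝒟.leafEquiv.symm (u ⊗ₜ 1)) = u := by
      rw [retract_apply, leafEquiv, AlgEquiv.apply_symm_apply, leafEval_tmul, map_one, one_smul]
    exact h
  fg := 𝒟.fg_ker_retract 𝒟.inverts_leafFun 𝒟.generates_leafFun 𝒟.represents_leafFun
  poisson a a' := 𝒟.retract_bracket 𝒟.inverts_leafFun 𝒟.generates_leafFun 𝒟.represents_leafFun
    𝒟.isCanonical_leafFun a a'
  mem_iff p := 𝒟.flat_ofAway_iff_ker 𝒟.inverts_leafFun 𝒟.generates_leafFun 𝒟.represents_leafFun p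

end ChartData

end LeafCoordinates

/-! ### The closure of a leaf -/

section Closure

variable {n m : ℕ} {B : Matrix (Fin n) (Fin m) ℤ}

theorem eval_moment (v : Fin n ⊕ Fin n → ℂ) (ξ : Fin m → ℂ) :
    MvPolynomial.eval v (moment B ξ) =
      ∑ i, (∑ j, (B i j : ℂ) * ξ j) * (v (Sum.inl i) * v (Sum.inr i)) := by
  rw [moment, map_sum]
  exact Finset.sum_congr rfl fun i _ => by
    rw [MvPolynomial.smul_eval, map_mul, MvPolynomial.eval_X, MvPolynomial.eval_X]

theorem pr_mk (v : zeroFibre B ⊤) (p : invariants B ⊤) :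
    (pr B ⊤ v).val (Ideal.Quotient.mkₐ ℂ (redIdeal B ⊤) p) =
      MvPolynomial.aeval v.1 (p : MvPolynomial (Fin n ⊕ Fin n) ℂ) := rfl

theorem pr_redMon (v : zeroFibre B ⊤) {s : Fin n ⊕ Fin n →₀ ℕ} (hs : wt B s = 0) :
    (pr B ⊤ v).val (redMon B ⊤ s) = ∏ u, v.1 u ^ s u := by
  rw [redMon_of_isInv (IsInv.of_wt_eq_zero hs), pr_mk, MvPolynomial.aeval_monomial, map_one,
    one_mul, Finsupp.prod_fintype _ _ (by simp)]

theorem pr_redMon_ne_zero (v : zeroFibre B ⊤) {s : Fin n ⊕ Fin n →₀ ℕ} (hs : wt B s = 0) :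
    (pr B ⊤ v).val (redMon B ⊤ s) ≠ 0 ↔ ∀ u, s u ≠ 0 → v.1 u ≠ 0 := by
  rw [pr_redMon v hs, Finset.prod_ne_zero_iff]
  simp only [Finset.mem_univ, true_implies]
  refine forall_congr' fun u => ?_
  by_cases hu : s u = 0
  · simp [hu]
  · simp [hu]

theorem activeIdx_pr_subset {D : Set (Fin n)} (v : zeroFibre B ⊤) (hv : ∀ u, idx u ∉ D → v.1 u = 0) :
    activeIdx (pr B ⊤ v) ⊆ D := by
  rintro _ ⟨u, ⟨s, hs, hsu, hne⟩, rfl⟩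
  by_contra h
  exact (pr_redMon_ne_zero v hs).1 hne u hsu (hv u h)

/-- Adding a multiple of a relation to the vector of products `x_k y_k` therefore preserves the
moment equations. -/
theorem sum_pairing_of_relation {η : Fin n → ℤ} (hη : ∑ k, η k • B k = 0) (ξ : Fin m → ℂ) :
    ∑ i, (∑ j, (B i j : ℂ) * ξ j) * (η i : ℂ) = 0 := by
  have h1 : ∀ j, ∑ i, (B i j : ℂ) * η i = 0 := fun j => by
    have h2 := congrFun hη j
    simp only [Finset.sum_apply, Pi.smul_apply, smul_eq_mul, Pi.zero_apply] at h2
    have h3 := congrArg (Int.cast : ℤ → ℂ) h2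
    push_cast at h3
    rw [← h3]
    exact Finset.sum_congr rfl fun i _ => mul_comm _ _
  simp only [Finset.sum_mul]
  rw [Finset.sum_comm]
  refine Finset.sum_eq_zero fun j _ => ?_
  rw [← mul_zero (ξ j), ← h1 j, Finset.mul_sum]
  exact Finset.sum_congr rfl fun i _ => by ring

/-- A curve in the plane through `(x, y)` along which the product of the coordinates is
`x y + t ^ 2 η`. -/
theorem exists_hyperbola (x y η : ℂ) : ∃ X Y : Polynomial ℂ,
    X * Y = Polynomial.C (x * y) + Polynomial.C η * Polynomial.X ^ 2 ∧ X.eval 0 = x ∧ Y.eval 0 = y ∧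
      (η = 0 → X = Polynomial.C x ∧ Y = Polynomial.C y) := by
  by_cases hη : η = 0
  · exact ⟨Polynomial.C x, Polynomial.C y, by simp [hη], by simp, by simp, fun _ => ⟨rfl, rfl⟩⟩
  by_cases hx : x = 0
  · by_cases hy : y = 0
    -- When both coordinates start at zero, each must move linearly in the parameter; this is why
    -- the product varies with its square.
    · refine ⟨Polynomial.C η * Polynomial.X, Polynomial.X, ?_, by simp [hx], by simp [hy],
        fun h => absurd h hη⟩
      rw [hx, zero_mul, map_zero]
      ring
    · refine ⟨Polynomial.C x + Polynomial.C (y⁻¹ * η) * Polynomial.X ^ 2, Polynomial.C y, ?_,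
        by simp, by simp, fun h => absurd h hη⟩
      have h1 : Polynomial.C (y⁻¹ * η) * Polynomial.C y = Polynomial.C η := by
        rw [← map_mul]
        congr 1
        field_simp
      rw [add_mul, ← map_mul, mul_right_comm, h1]
  · refine ⟨Polynomial.C x, Polynomial.C y + Polynomial.C (x⁻¹ * η) * Polynomial.X ^ 2, ?_,
      by simp, by simp, fun h => absurd h hη⟩
    have h1 : Polynomial.C x * Polynomial.C (x⁻¹ * η) = Polynomial.C η := by
      rw [← map_mul]
      congr 1
      field_simp
    rw [mul_add, ← map_mul, ← mul_assoc, h1]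

/-- Along the hyperbolas the products `x_k y_k` change by `t ^ 2 η k`, which keeps the point in the
zero fibre because `η` is a relation. -/
theorem exists_curve {η : Fin n → ℤ} (hη : ∑ k, η k • B k = 0) (v : zeroFibre B ⊤)
    (hv : ∀ u, η (idx u) = 0 → v.1 u = 0) : ∃ W : Fin n ⊕ Fin n → Polynomial ℂ,
      (∀ t, (fun u => (W u).eval t) ∈ zeroFibre B ⊤) ∧ (∀ u, (W u).eval 0 = v.1 u) ∧
        ∀ u, W u ≠ 0 ↔ η (idx u) ≠ 0 := by
  choose X Y hXY hX hY hz using fun k => exists_hyperbola (v.1 (Sum.inl k)) (v.1 (Sum.inr k)) (η k)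
  refine ⟨Sum.elim X Y, fun t ξ hξ => ?_, ?_, ?_⟩
  · rw [eval_moment]
    have h1 : ∀ i, (Sum.elim X Y (Sum.inl i)).eval t * (Sum.elim X Y (Sum.inr i)).eval t =
        v.1 (Sum.inl i) * v.1 (Sum.inr i) + t ^ 2 * η i := fun i => by
      have h2 := congrArg (Polynomial.eval t) (hXY i)
      rw [Polynomial.eval_mul] at h2
      rw [Sum.elim_inl, Sum.elim_inr, h2]
      simp
      ring
    simp only [h1, mul_add, Finset.sum_add_distrib, mul_left_comm _ (t ^ 2)]
    rw [← Finset.mul_sum, sum_pairing_of_relation hη, ← eval_moment, v.2 ξ hξ]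
    simp
  · rintro (k | k)
    · exact hX k
    · exact hY k
  · intro u
    constructor
    · intro hu h0
      have h0' : (η (idx u) : ℂ) = 0 := by rw [h0, Int.cast_zero]
      have h1 := hv u h0
      rcases u with k | k
      · exact hu (by rw [Sum.elim_inl, (hz k h0').1, h1, map_zero])
      · exact hu (by rw [Sum.elim_inr, (hz k h0').2, h1, map_zero])
    · intro h0
      have h1 : X (idx u) * Y (idx u) ≠ 0 := by
        rw [hXY]
        intro h2
        have h3 := congrArg (fun p => Polynomial.coeff p 2) h2
        simp at h3
        exact h0 h3
      rcases u with k | k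
      · exact left_ne_zero_of_mul h1
      · exact right_ne_zero_of_mul h1

/-! ### Strata, their closures and their parabolic subgroups -/

namespace ChartData

variable (𝒟 : ChartData B)

theorem hull_E : hull B 𝒟.E = 𝒟.E := by
  ext k
  exact 𝒟.basis.mem_hull_iff (fun i hi => 𝒟.I_sub_E hi) fun _ h => h

theorem flat_subset_iff {z : Pts (Cone B)} : flat z ⊆ 𝒟.E ↔ activeIdx z ⊆ 𝒟.E := by
  refine ⟨(subset_hull B _).trans, fun h => ?_⟩
  have h1 := hull_subset_hull (h.trans (subset_hull B 𝒟.E))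
  rwa [hull_E] at h1

theorem flat_pr (v : zeroFibre B ⊤) (hv : ∀ u, v.1 u ≠ 0 ↔ idx u ∈ 𝒟.E) :
    flat (pr B ⊤ v) = 𝒟.E := by
  rw [𝒟.flat_eq_iff]
  · exact activeIdx_pr_subset v fun u hu => not_not.1 (mt (hv u).1 hu)
  · exact (pr_redMon_ne_zero v 𝒟.wt_mon).2 fun u hu => (hv u).2 (𝒟.idx_mem_E_of_mon hu)

theorem exists_relation_E : ∃ η : Fin n → ℤ, ∑ k, η k • B k = 0 ∧ ∀ k, η k ≠ 0 ↔ k ∈ 𝒟.E :=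
  𝒟.basis.exists_relation (fun _ hi => 𝒟.I_sub_E hi) (fun _ h => h) 𝒟.noncoloop

/-- A point of the zero fibre without coordinates outside the flat is a limit of points of the zero
fibre all of whose coordinates in the flat are nonzero. -/
theorem exists_curve_E (v : zeroFibre B ⊤) (hv : ∀ u, idx u ∉ 𝒟.E → v.1 u = 0) :
    ∃ (W : Fin n ⊕ Fin n → Polynomial ℂ) (_ : ∀ t, (fun u => (W u).eval t) ∈ zeroFibre B ⊤)
      (g : Polynomial ℂ), g ≠ 0 ∧ (∀ u, (W u).eval 0 = v.1 u) ∧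
        ∀ t, g.eval t ≠ 0 → ∀ u, (W u).eval t ≠ 0 ↔ idx u ∈ 𝒟.E := by
  classical
  obtain ⟨η, hη, hηE⟩ := 𝒟.exists_relation_E
  obtain ⟨W, hW, hW0, hWE⟩ := exists_curve hη v fun u hu => hv u fun h => (hηE _).2 h hu
  refine ⟨W, hW, ∏ u, if W u = 0 then 1 else W u, ?_, hW0, fun t ht u => ?_⟩
  · refine Finset.prod_ne_zero_iff.2 fun u _ => ?_
    split_ifs with h
    · exact one_ne_zero
    · exact h
  · rw [← hηE, ← hWE]
    refine ⟨fun h h0 => h (by rw [h0, Polynomial.eval_zero]), fun h => ?_⟩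
    rw [Polynomial.eval_prod, Finset.prod_ne_zero_iff] at ht
    have h1 := ht u (Finset.mem_univ u)
    rwa [if_neg h] at h1

/-- The origin is deformed along the curve of `exists_curve_E`. -/
theorem exists_generic : ∃ v : zeroFibre B ⊤, ∀ u, v.1 u ≠ 0 ↔ idx u ∈ 𝒟.E := by
  obtain ⟨W, hW, g, hg, -, hgW⟩ := 𝒟.exists_curve_E
    ⟨0, fun ξ _ => by simp [moment]⟩ fun _ _ => rfl
  obtain ⟨t, ht⟩ : ∃ t, g.eval t ≠ 0 := by
    by_contra! h
    exact hg (Polynomial.funext fun t => by rw [h, Polynomial.eval_zero])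
  exact ⟨⟨_, hW t⟩, hgW t ht⟩

/-- An invariant vanishing on the stratum becomes a polynomial in the parameter of the curve that is
zero wherever `g` is nonzero, hence zero also at the start. -/
theorem pr_mem_closure (v : zeroFibre B ⊤) (hv : ∀ u, idx u ∉ 𝒟.E → v.1 u = 0) :
    pr B ⊤ v ∈ closure {z | flat z = 𝒟.E} := by
  obtain ⟨W, hW, g, hg, hW0, hgW⟩ := 𝒟.exists_curve_E v hv
  rw [Pts.mem_closure_iff]
  intro a ha
  obtain ⟨p, rfl⟩ := Ideal.Quotient.mkₐ_surjective ℂ (redIdeal B ⊤) a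
  have heval : ∀ t, (MvPolynomial.aeval W (p : MvPolynomial (Fin n ⊕ Fin n) ℂ)).eval t =
      MvPolynomial.aeval (fun u => (W u).eval t) (p : MvPolynomial (Fin n ⊕ Fin n) ℂ) := fun t => by
    rw [← Polynomial.coe_aeval_eq_eval, ← AlgHom.coe_toRingHom, ← AlgHom.coe_toRingHom]
    exact congrArg (fun F : MvPolynomial (Fin n ⊕ Fin n) ℂ →ₐ[ℂ] ℂ =>
        F (p : MvPolynomial (Fin n ⊕ Fin n) ℂ))
      (MvPolynomial.comp_aeval (R := ℂ) W (Polynomial.aeval t))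
  have hzero : MvPolynomial.aeval W (p : MvPolynomial (Fin n ⊕ Fin n) ℂ) = 0 := by
    refine (mul_eq_zero.1 (Polynomial.funext fun t => ?_)).resolve_right hg
    rw [Polynomial.eval_mul, Polynomial.eval_zero]
    by_cases ht : g.eval t = 0
    · rw [ht, mul_zero]
    · rw [heval, ← pr_mk ⟨_, hW t⟩, ha _ (𝒟.flat_pr ⟨_, hW t⟩ (hgW t ht)), zero_mul]
  have h0 := heval 0
  rw [hzero, Polynomial.eval_zero, funext hW0] at h0
  exact h0.symm

/-- Every point of the cone lifts to the zero fibre, without coordinates outside its flat. -/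
theorem exists_pr {z : Pts (Cone B)} (hz : z.val 𝒟.f ≠ 0) (hflat : flat z = 𝒟.E) :
    ∃ v : zeroFibre B ⊤, (∀ u, idx u ∉ 𝒟.E → v.1 u = 0) ∧ pr B ⊤ v = z := by
  set P := Localization.Away 𝒟.g
  obtain ⟨ψ, hψ⟩ : ∃ ψ : P ⊗[ℂ] 𝒟.SliceRing →ₐ[ℂ] ℂ,
      ∀ w, ψ w = (z.toAway hz).val (𝒟.leafEquiv.symm w) :=
    ⟨(z.toAway hz).val.comp 𝒟.leafEquiv.symm.toAlgHom, fun _ => rfl⟩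
  have hψa : ∀ a, ψ (𝒟.coneMap 𝒟.leafFun a) = z.val a := fun a => by
    rw [hψ]
    refine Eq.trans ?_ (z.toAway_algebraMap hz a)
    exact congrArg (z.toAway hz).val (𝒟.chartEquiv_symm_coneMap 𝒟.inverts_leafFun
      𝒟.generates_leafFun 𝒟.represents_leafFun a)
  have hψq : ∀ q, ψ (1 ⊗ₜ q) = 𝒟.sliceVertex q := fun q => (hψ _).trans <|
    (𝒟.flat_ofAway_iff 𝒟.inverts_leafFun 𝒟.generates_leafFun 𝒟.represents_leafFun
      (z.toAway hz)).1 (by rw [z.ofAway_toAway hz]; exact hflat) q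
  -- The lift is the gauge-fixed point whose leaf coordinates are those of `z` and whose slice
  -- coordinates are zero; the latter is correct because `z` lies over the vertex.
  let θ : P ⊗[ℂ] MvPolynomial (𝒟.F ⊕ 𝒟.F) ℂ →ₐ[ℂ] ℂ := Algebra.TensorProduct.productMap
    (ψ.comp (Algebra.TensorProduct.includeLeft (R := ℂ) (S := ℂ) (A := P) (B := 𝒟.SliceRing)))
    (MvPolynomial.aeval 0)
  have hθ : ∀ w, ψ (𝒟.proj P w) = θ (𝒟.incl P w) := fun w => by
    induction w using TensorProduct.induction_on with
    | zero => simp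
    | add w w' h h' => rw [map_add, map_add, map_add, map_add, h, h']
    | tmul p q =>
      rw [proj_tmul, incl_tmul, Algebra.TensorProduct.productMap_apply_tmul, AlgHom.comp_apply,
        Algebra.TensorProduct.includeLeft_apply]
      have h1 : p ⊗ₜ[ℂ] 𝒟.sliceMk q = p ⊗ₜ 1 * 1 ⊗ₜ 𝒟.sliceMk q := by
        rw [Algebra.TensorProduct.tmul_mul_tmul, one_mul, mul_one]
      rw [h1, map_mul, hψq]
      rfl
  let v : Fin n ⊕ Fin n → ℂ := fun u => θ (𝒟.sub 𝒟.leafFun (MvPolynomial.X u))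
  have hv : ∀ p : invariants B ⊤, MvPolynomial.aeval v (p : MvPolynomial (Fin n ⊕ Fin n) ℂ) =
      z.val (Ideal.Quotient.mkₐ ℂ (redIdeal B ⊤) p) := fun p => by
    rw [← hψa, coneMap_mk, hθ, incl_resInv]
    have h1 : MvPolynomial.aeval v = θ.comp (𝒟.sub 𝒟.leafFun) :=
      MvPolynomial.algHom_ext fun u => by rw [MvPolynomial.aeval_X]; rfl
    rw [h1, AlgHom.comp_apply]
  refine ⟨⟨v, fun ξ hξ => ?_⟩, fun u hu => ?_, Pts.ext fun a => ?_⟩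
  · have h1 := hv ⟨moment B ξ, moment_mem_invariants ξ⟩
    have h2 : Ideal.Quotient.mkₐ ℂ (redIdeal B ⊤) ⟨moment B ξ, moment_mem_invariants ξ⟩ = 0 :=
      Ideal.Quotient.eq_zero_iff_mem.2 (Ideal.subset_span ⟨ξ, hξ, rfl⟩)
    rw [h2, map_zero] at h1
    exact h1
  · obtain ⟨u, rfl⟩ := 𝒟.exists_emb (𝒟.mem_moved.2 hu)
    have hI : idx (𝒟.emb u) ∉ 𝒟.I := fun h => hu (𝒟.I_sub_E h)
    change θ (𝒟.sub 𝒟.leafFun (MvPolynomial.X (𝒟.emb u))) = 0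
    rw [sub_X, 𝒟.coordImage_of_not_mem _ hI, base_emb,
      Algebra.TensorProduct.productMap_apply_tmul, MvPolynomial.aeval_X, Pi.zero_apply, mul_zero]
  · obtain ⟨p, rfl⟩ := Ideal.Quotient.mkₐ_surjective ℂ (redIdeal B ⊤) a
    rw [pr_mk]
    exact hv p

/-- A point whose active indices lie in the flat has a smaller or equal flat of its own; its lift
from a chart there has no coordinates outside that flat. -/
theorem stratumClosure_H (hB : IsFaithful B) (hu : IsUnimodular B) :
    stratumClosure B 𝒟.H = {z | activeIdx z ⊆ 𝒟.E} := by
  ext z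
  constructor
  · rintro ⟨v, hv, rfl⟩
    refine activeIdx_pr_subset v fun u hu => ?_
    have h1 := hv (idx u) (𝒟.mem_moved.2 hu)
    rcases u with k | k
    · exact h1.1
    · exact h1.2
  · intro hz
    obtain ⟨𝒟', hz', hflat⟩ := exists_chartData hB hu z
    obtain ⟨v, hv, rfl⟩ := 𝒟'.exists_pr hz' hflat
    have h1 : 𝒟'.E ⊆ 𝒟.E := hflat ▸ 𝒟.flat_subset_iff.2 hz
    exact ⟨v, fun i hi => ⟨hv _ fun h => 𝒟.mem_moved.1 hi (h1 h),
      hv _ fun h => 𝒟.mem_moved.1 hi (h1 h)⟩, rfl⟩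

/-- Inactivity outside the flat means that certain monomials vanish, which is a closed condition;
the converse is the deformation along curves. -/
theorem closure_leaf (hB : IsFaithful B) (hu : IsUnimodular B) :
    closure {z | flat z = 𝒟.E} = stratumClosure B 𝒟.H := by
  apply Set.Subset.antisymm
  · rw [𝒟.stratumClosure_H hB hu]
    rintro z hz _ ⟨u, ⟨s, hs, hsu, hne⟩, rfl⟩
    by_contra hE
    refine hne (Pts.mem_closure_iff.1 hz _ fun z' hz' => ?_)
    by_contra hne'
    have h1 : idx u ∈ flat z' := subset_hull B _ ⟨u, ⟨s, hs, hsu, hne'⟩, rfl⟩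
    rw [hz'] at h1
    exact hE h1
  · rintro _ ⟨v, hv, rfl⟩
    refine 𝒟.pr_mem_closure v fun u hu => ?_
    have h1 := hv (idx u) (𝒟.mem_moved.2 hu)
    rcases u with k | k
    · exact h1.1
    · exact h1.2

theorem isMaximalParabolicOf_H (hB : IsFaithful B) (hu : IsUnimodular B) :
    IsMaximalParabolicOf B {z | flat z = 𝒟.E} 𝒟.H := by
  refine ⟨⟨𝒟.isParabolic_H, 𝒟.closure_leaf hB hu⟩, ?_⟩
  classical
  rintro H ⟨-, hH⟩ τ hτ
  -- At a generic point `x_i y_i ≠ 0` for all `i ∈ I`. As this is an invariant function, no lift of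
  -- the point has vanishing coordinates there, so `H` cannot move them.
  obtain ⟨v, hv⟩ := 𝒟.exists_generic
  have h1 : pr B ⊤ v ∈ stratumClosure B H := by
    rw [← hH]
    exact subset_closure (𝒟.flat_pr v hv)
  obtain ⟨v', hv', hvv'⟩ := h1
  intro i hi
  by_contra hne
  have h2 : i ∈ movedCoords B H := by
    rw [movedCoords, Finset.mem_filter]
    exact ⟨Finset.mem_univ i, τ, hτ, hne⟩
  have h3 : (pr B ⊤ v).val (redMon B ⊤ (pairExp i)) ≠ 0 :=
    (pr_redMon_ne_zero v (wt_pairExp i)).2 fun u hu => (hv u).2 (by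
      rw [pairExp_apply] at hu
      have h4 : idx u = i := by_contra fun h => hu (if_neg h)
      rw [h4]
      exact 𝒟.I_sub_E hi)
  rw [← hvv', pr_redMon_ne_zero v' (wt_pairExp i)] at h3
  exact h3 (Sum.inl i) (by simp [pairExp_apply]) (hv' i h2).1

/-- A generic point lies in the chart around every point of the stratum, because all coordinates of
the flat are nonzero at it; this gives connectedness. -/
theorem isSymplecticPiece_leaf (hB : IsFaithful B) (hu : IsUnimodular B) :
    IsSymplecticPiece (redBracket B ⊤) {z | flat z = 𝒟.E} := by
  obtain ⟨v, hv⟩ := 𝒟.exists_generic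
  refine isSymplecticPiece_of_charts (z₀ := pr B ⊤ v) (fun z hz => ?_) (𝒟.flat_pr v hv)
  obtain ⟨𝒟', hz', hflat⟩ := exists_chartData hB hu z
  have hE : 𝒟'.E = 𝒟.E := hflat.symm.trans hz
  have key : ∀ E' : Set (Fin n), 𝒟'.E = E' → ∃ C : LeafChart (redBracket B ⊤) {z | flat z = E'} z,
      C.f = 𝒟'.f := by
    rintro _ rfl
    exact ⟨𝒟'.leafChart z hz', rfl⟩
  obtain ⟨C, hC⟩ := key _ hE
  refine ⟨C, ?_⟩
  rw [hC, pr_redMon_ne_zero v 𝒟'.wt_mon]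
  exact fun u hu => (hv u).2 (hE ▸ 𝒟'.idx_mem_E_of_mon hu)

end ChartData

/-- The symplectic leaves are the sets of points with a given flat. -/
theorem IsSymplecticLeaf.eq_flat (hB : IsFaithful B) (hu : IsUnimodular B) {Z : Set (Pts (Cone B))}
    (hZ : IsSymplecticLeaf (redBracket B ⊤) Z) {z : Pts (Cone B)} (hz : z ∈ Z) :
    Z = {z' | flat z' = flat z} := by
  have hsub : Z ⊆ {z' | flat z' = flat z} := by
    refine IsSymplecticPiece.subset_of_charts flat (fun z => ?_) hZ.prop hz
    obtain ⟨𝒟, hz', hflat⟩ := exists_chartData hB hu z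
    rw [hflat]
    exact ⟨𝒟.leafChart z hz'⟩
  obtain ⟨𝒟, -, hflat⟩ := exists_chartData hB hu z
  -- The stratum is itself a symplectic piece, so maximality of the leaf turns the inclusion into an
  -- equality.
  exact hZ.eq_of_subset (by rw [hflat]; exact 𝒟.isSymplecticPiece_leaf hB hu) hsub

end Closure

end

end Hypertoric

theorem theorem5p1 {n m : ℕ} (B : Matrix (Fin n) (Fin m) ℤ)
    (hfaithful : Hypertoric.IsFaithful B) (hunimodular : Hypertoric.IsUnimodular B)
    (Z : Set (Hypertoric.Pts (Hypertoric.Cone B)))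
    (hZ : Hypertoric.IsSymplecticLeaf (Hypertoric.redBracket B ⊤) Z)
    (hvertex : Z ≠ {Hypertoric.vertex B ⊤})
    (z : Hypertoric.Pts (Hypertoric.Cone B)) (hz : z ∈ Z) :
    -- the maximal parabolic subgroup of `Z`, which determines the slice `S`
    ∃ H : Subgroup (Fin m → ℂˣ), Hypertoric.IsMaximalParabolicOf B Z H ∧
    -- `X° = {f ≠ 0}`, a `ℂˣ`-stable open neighbourhood of `z`
    ∃ (f : Hypertoric.Cone B)
      (hf : Hypertoric.IsWeightVector (Hypertoric.redAct B ⊤ fun _ => 1) f), z.val f ≠ 0 ∧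
    -- `Z°`, the complement in `𝔸^{2d}` of the linear hyperplanes `ℓ i = 0`, with degrees `a`
    ∃ (d k : ℕ) (a : Fin d → ℤ) (ℓ : Fin k → MvPolynomial (Fin d ⊕ Fin d) ℂ)
      (hℓ : Hypertoric.IsWeightVector (Hypertoric.weightAct a) (∏ i, ℓ i)),
      k ≤ n ∧ (∀ i, (ℓ i).IsHomogeneous 1 ∧ ℓ i ≠ 0) ∧
    -- the degrees `w` of the coordinates on `S`, and the isomorphism `X° ≅ Z° × S`
    ∃ (w : Hypertoric.movedCoords B H → ℤ)
      (Φ : Localization.Away f ≃ₐ[ℂ]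
        Localization.Away (∏ i, ℓ i) ⊗[ℂ] Hypertoric.SliceCone B H),
      -- it is Poisson
      (∀ u v, Φ (Hypertoric.awayBracket (Hypertoric.redBracket B ⊤) f u v) =
        Hypertoric.prodBracket
          (Hypertoric.awayBracket (Hypertoric.polyBracket (Fin d)) (∏ i, ℓ i))
          (Hypertoric.redBracket (Hypertoric.sliceWeights B H) H) (Φ u) (Φ v)) ∧
      -- it is `ℂˣ`-equivariant
      (∀ t u, Φ (Hypertoric.awayAct (Hypertoric.redAct B ⊤ fun _ => 1) f hf t u) =
        Algebra.TensorProduct.map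
          (Hypertoric.awayAct (Hypertoric.weightAct a) (∏ i, ℓ i) hℓ t)
          (Hypertoric.redAct (Hypertoric.sliceWeights B H) H w t) (Φ u)) ∧
      -- it identifies `X° ∩ Z` with `Z° × {vertex of S}`
      ∀ p : Hypertoric.Pts (Localization.Away f), p.ofAway ∈ Z ↔
        ∀ s : Hypertoric.SliceCone B H,
          p.val (Φ.symm (1 ⊗ₜ[ℂ] s)) =
            (Hypertoric.vertex (Hypertoric.sliceWeights B H) H).val s := by
  obtain ⟨𝒟, hzf, hflat⟩ := Hypertoric.exists_chartData hfaithful hunimodular z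
  obtain rfl : Z = {z' | Hypertoric.flat z' = 𝒟.E} := by
    rw [← hflat]
    exact hZ.eq_flat hfaithful hunimodular hz
  exact ⟨𝒟.H, 𝒟.isMaximalParabolicOf_H hfaithful hunimodular, 𝒟.f, 𝒟.isWeightVector_f, hzf,
    𝒟.dim, 𝒟.invCoords.card, 𝒟.leafWeight, 𝒟.hyperplane, 𝒟.isWeightVector_g,
    𝒟.card_invCoords_le, fun r => ⟨𝒟.hyperplane_isHomogeneous r, 𝒟.hyperplane_ne_zero r⟩,
    𝒟.sliceWeight, 𝒟.leafEquiv,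
    𝒟.chart_bracket 𝒟.inverts_leafFun 𝒟.isCanonical_leafFun,
    fun t => 𝒟.chart_act 𝒟.inverts_leafFun (𝒟.isGraded_leafFun t),
    𝒟.flat_ofAway_iff 𝒟.inverts_leafFun 𝒟.generates_leafFun 𝒟.represents_leafFun⟩
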